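/- Let $\mathbb P=\mathbb P(1,1,1,1,2,2,2)$ be the weighted projective space over $\mathbb C$ with homogeneous coordinates $x_0,\dots,x_6$. For $t\in\mathbb C$ let $\check X_{5,t}\subset\mathbb P$ be the pfaffian variety defined by the five $4\times4$ pfaffians $P_1,\dots,P_5$ ($P_i$ is obtained by deleting row and column $i$) of the skew-symmetric matrix $$N_{5,t}=\begin{pmatrix}0&tx_6&x_4&x_0x_1&tx_5\\-tx_6&0&t(x_0^2+x_1^2)&x_5&x_2x_3\\-x_4&-t(x_0^2+x_1^2)&0&t(x_2^2+x_3^2)&x_6\\-x_0x_1&-x_5&-t(x_2^2+x_3^2)&0&tx_4\\-tx_5&-x_2x_3&-x_6&-tx_4&0\end{pmatrix}.$$ Pfaffians are taken with the convention $\mathrm{Pf}(N)=\frac1{r!\,2^r}\sum_{\sigma\in\mathfrak S_{2r}}\mathrm{sign}(\sigma)\prod_{i=1}^r n_{\sigma(i)\,\sigma(r+i)}$ for a skew-symmetric matrix of size $2r$. Let $$\alpha=\mathrm{Res}\,\frac{P_{2,4,5}\,\Omega_0}{P_2P_4P_5},\qquad \Omega_0=\frac1{(2\pi i)^6}\sum_{i=0}^6(-1)^iw_ix_i\,dx_0\wedge\dots\wedge\widehat{dx_i}\wedge\dots\wedge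 dx_6,$$ where $w=(1,1,1,1,2,2,2)$ and $P_{2,4,5}=x_4$ is the pfaffian of $N_{5,t}$ with rows and columns $2,4,5$ deleted. On the chart $x_0=1$, in the local coordinates $x_1,x_2,x_4$, $$\alpha=\frac1{(2\pi i)^3}\,\frac{P_{2,4,5}}{\partial(P_2,P_4,P_5)/\partial(x_3,x_5,x_6)}\,dx_1\wedge dx_2\wedge dx_4 .$$ Let $\varepsilon>0$. Then there is $\delta>0$ such that the following holds. On the chart $x_0=1$, the torus $\{|x_1|=|x_2|=|x_4|=\varepsilon\}$ in the component $\{x_3=x_5=x_6=0\}$ of $\check X_{5,0}$ extends to a continuous family of torus cycles $\gamma_t\subset\check X_{5,t}$, $|t|<\delta$, each parametrized by its coordinates $(x_1,x_2,x_4)$. For every such family, $P_{2,4,5}$ and $\partial(P_2,P_4,P_5)/\partial(x_3,x_5,x_6)$ have no zeros on $\gamma_t$ for $|t|<\delta$, and the fundamental period $\int_{\gamma_t}\alpha$ (with the standard orientation of the torus) is a function $\Phi_0(\phi)$ of $\phi=t^{10}$, given for $|\phi|<\delta^{10}$ by the convergent series $$\Phi_0(\phi)=\sum_{n=0}^\infty\binom{2n}{n}\sum_{k=0}^n\binom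 nk\binom{n+k}{n}\binom{2n+2k}{n+k}\binom{2n+k}{2n-k}\,\phi^n .$$ Moreover, with $\Theta=\phi\frac{d}{d\phi}$, the Picard--Fuchs operator of this period is $$\begin{aligned}\mathscr D_5={}&\Theta^4-2^2\phi(500\Theta^4+976\Theta^3+677\Theta^2+189\Theta+19)\\&+2^4\phi^2(3968\Theta^4+3968\Theta^3-1336\Theta^2-1164\Theta-177)\\&-2^{10}\phi^3(500\Theta^4+24\Theta^3-37\Theta^2+6\Theta+3)+2^{12}\phi^4(2\Theta+1)^4,\end{aligned}$$ that is, $\mathscr D_5\Phi_0=0$ near $\phi=0$, and no nonzero operator $\sum_i p_i(\phi)\Theta^i$ with $p_i\in\mathbb C[\phi]$ of order less than $4$ annihilates $\Phi_0$. (This operator is the Calabi--Yau equation listed as No. 302 in the tables of Almkvist, van Enckevort, van Straten and Zudilin.) -/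

import Mathlib

open Polynomial Filter Topology
open scoped Real

noncomputable section

namespace PfaffianMirror

/-! ### Pfaffians -/

/-- The pfaffian of a skew-symmetric `2r × 2r` matrix, with the sign convention
`Pf(N) = 1 / (r! 2^r) ∑_σ sign(σ) ∏_{i ≤ r} N_{σ(i), σ(r+i)}`. -/
def pfaffian {r : ℕ} (N : Matrix (Fin (r + r)) (Fin (r + r)) ℂ) : ℂ :=
  ((r.factorial : ℂ) * 2 ^ r)⁻¹ *
    ∑ σ : Equiv.Perm (Fin (r + r)),
      ((Equiv.Perm.sign σ : ℤ) : ℂ) * ∏ i : Fin r, N (σ (Fin.castAdd r i)) (σ (Fin.natAdd r i))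

/-! ### The family in the weighted projective space `ℙ(1,1,1,1,2,2,2)` -/

/-- The weights of the homogeneous coordinates `x₀, …, x₆`. -/
def weight : Fin 7 → ℕ := ![1, 1, 1, 1, 2, 2, 2]

/-- Two nonzero vectors are equivalent if they lie in the same orbit of
`c • (x₀, …, x₆) = (c ^ w₀ * x₀, …, c ^ w₆ * x₆)`, `c ∈ ℂˣ`. -/
def weightedSetoid : Setoid {x : Fin 7 → ℂ // x ≠ 0} where
  r x y := ∃ c : ℂˣ, ∀ i, y.1 i = (c : ℂ) ^ weight i * x.1 i
  iseqv :=
    { refl := fun _ => ⟨1, fun _ => by simp⟩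
      symm := by
        rintro x y ⟨c, hc⟩
        refine ⟨c⁻¹, fun i => ?_⟩
        rw [hc i, ← mul_assoc, ← mul_pow]
        simp
      trans := by
        rintro x y z ⟨c, hc⟩ ⟨d, hd⟩
        refine ⟨d * c, fun i => ?_⟩
        rw [hd i, hc i, ← mul_assoc, ← mul_pow]
        simp }

/-- The weighted projective space `ℙ(1,1,1,1,2,2,2)` over `ℂ`. -/
def WeightedProjectiveSpace : Type := Quotient weightedSetoid

/-- The skew-symmetric matrix `N_{5,t}` of weighted quadratic forms. -/
def mirrorMatrix (t : ℂ) (x : Fin 7 → ℂ) : Matrix (Fin 5) (Fin 5) ℂ :=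
  !![0, t * x 6, x 4, x 0 * x 1, t * x 5;
     -(t * x 6), 0, t * (x 0 ^ 2 + x 1 ^ 2), x 5, x 2 * x 3;
     -x 4, -(t * (x 0 ^ 2 + x 1 ^ 2)), 0, t * (x 2 ^ 2 + x 3 ^ 2), x 6;
     -(x 0 * x 1), -x 5, -(t * (x 2 ^ 2 + x 3 ^ 2)), 0, t * x 4;
     -(t * x 5), -(x 2 * x 3), -x 6, -(t * x 4), 0]

/-- The `4 × 4` pfaffian obtained by deleting row and column `i`. The indices are
`0, …, 4`, so this is `P_{i+1}` in `1`-based notation. -/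
def subPfaffian (t : ℂ) (x : Fin 7 → ℂ) (i : Fin 5) : ℂ :=
  pfaffian (r := 2) ((mirrorMatrix t x).submatrix i.succAbove i.succAbove)

/-- The `2 × 2` pfaffian `P_{2,4,5}` (`1`-based notation) obtained by deleting rows and columns
`2, 4, 5`. -/
def subPfaffian245 (t : ℂ) (x : Fin 7 → ℂ) : ℂ :=
  pfaffian (r := 1) ((mirrorMatrix t x).submatrix ![0, 2] ![0, 2])

/-- The pfaffian variety in `ℙ(1,1,1,1,2,2,2)` cut out by the five `4 × 4` pfaffians of
`N_{5,t}`. -/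
def mirrorFiber (t : ℂ) : Set WeightedProjectiveSpace :=
  {p | ∃ x : {x : Fin 7 → ℂ // x ≠ 0},
    Quotient.mk weightedSetoid x = p ∧ ∀ i, subPfaffian t x.1 i = 0}

/-- The point with homogeneous coordinates `x` lies on the fibre over `t`. -/
def LiesOn (t : ℂ) (x : Fin 7 → ℂ) : Prop :=
  ∃ h : x ≠ 0, Quotient.mk weightedSetoid ⟨x, h⟩ ∈ mirrorFiber t

/-! ### The holomorphic three-form -/

/-- The Jacobian determinant `∂(P₂, P₄, P₅) / ∂(x₃, x₅, x₆)` (the pfaffians in `1`-based, the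
coordinates in `0`-based notation). -/
def jacobian (t : ℂ) (x : Fin 7 → ℂ) : ℂ :=
  (Matrix.of fun a b : Fin 3 =>
    deriv (fun z : ℂ =>
      subPfaffian t (Function.update x ((![3, 5, 6] : Fin 3 → Fin 7) b) z)
        ((![1, 3, 4] : Fin 3 → Fin 5) a))
      (x ((![3, 5, 6] : Fin 3 → Fin 7) b))).det

/-- The holomorphic three-form `α = Res (P_{2,4,5} Ω₀ / (P₂ P₄ P₅))` on the chart `x₀ = 1`,
where `Ω₀ = (2πi)⁻⁶ ∑ (-1)^i wᵢ xᵢ dx₀ ∧ … (omit dxᵢ) … ∧ dx₆`, so that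
`Ω₀ = (2πi)⁻⁶ dx₁ ∧ … ∧ dx₆ = (2πi)⁻⁶ dx₃ ∧ dx₅ ∧ dx₆ ∧ dx₁ ∧ dx₂ ∧ dx₄` there. The residue along
`P₂ = P₄ = P₅ = 0` is normalized by `Res (dP₂/P₂ ∧ dP₄/P₄ ∧ dP₅/P₅ ∧ β) = (2πi)³ β`. In the local
coordinates `x₁, x₂, x₄` on the variety this gives
`α = (2πi)⁻³ P_{2,4,5} / (∂(P₂,P₄,P₅)/∂(x₃,x₅,x₆)) dx₁ ∧ dx₂ ∧ dx₄`,
and `formCoefficient` is its coefficient. -/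
def formCoefficient (t : ℂ) (x : Fin 7 → ℂ) : ℂ :=
  ((2 * π * Complex.I) ^ 3)⁻¹ * (subPfaffian245 t x / jacobian t x)

/-! ### The torus cycle and the fundamental period -/

/-- The torus `|x₁| = |x₂| = |x₄| = ε`. -/
def torus (ε : ℝ) : Set (Fin 3 → ℂ) := {u | ∀ i, ‖u i‖ = ε}

/-- A continuous family, over the disc `|t| < δ`, of torus cycles in the chart `x₀ = 1` of the
fibres, each parametrized by its coordinates `(x₁, x₂, x₄) = (u₀, u₁, u₂)`, that extends the torus
`|x₁/x₀| = |x₂/x₀| = |x₄/x₀²| = ε` in the component `H = {x₃ = x₅ = x₆ = 0}` of the fibre over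
`t = 0`. -/
structure IsTorusCycle (ε δ : ℝ) (γ : ℂ → (Fin 3 → ℂ) → (Fin 7 → ℂ)) : Prop where
  continuousOn : ContinuousOn (fun p : ℂ × (Fin 3 → ℂ) => γ p.1 p.2)
    (Metric.ball (0 : ℂ) δ ×ˢ torus ε)
  liesOn : ∀ t ∈ Metric.ball (0 : ℂ) δ, ∀ u ∈ torus ε, LiesOn t (γ t u)
  coords : ∀ t ∈ Metric.ball (0 : ℂ) δ, ∀ u ∈ torus ε,
    γ t u 0 = 1 ∧ γ t u 1 = u 0 ∧ γ t u 2 = u 1 ∧ γ t u 4 = u 2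
  base : ∀ u ∈ torus ε, γ 0 u 3 = 0 ∧ γ 0 u 5 = 0 ∧ γ 0 u 6 = 0

/-- The period `∫_{γ_t} α`, where `dx₁ ∧ dx₂ ∧ dx₄` is integrated over the torus
`|x₁| = |x₂| = |x₄| = ε` with its standard orientation. -/
def period (ε : ℝ) (γ : ℂ → (Fin 3 → ℂ) → (Fin 7 → ℂ)) (t : ℂ) : ℂ :=
  torusIntegral (fun u : Fin 3 → ℂ => formCoefficient t (γ t u)) 0 (fun _ => ε)

/-- The coefficient of `φ ^ n` in the fundamental period. -/
def periodCoeff (n : ℕ) : ℕ :=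
  (2 * n).choose n * ∑ k ∈ Finset.range (n + 1),
    n.choose k * (n + k).choose n * (2 * n + 2 * k).choose (n + k)
      * (2 * n + k).choose (2 * n - k)

/-! ### Differential operators -/

/-- The Euler operator `Θ = φ d/dφ`. -/
def euler (f : ℂ → ℂ) : ℂ → ℂ := fun z => z * deriv f z

/-- The action on functions of the operator `∑ pᵢ(φ) Θ^i`, with `pᵢ ∈ ℂ[φ]` written to the left of
`Θ^i`. An operator is encoded as the polynomial with the same coefficients, whose outer variable
stands for `Θ` and whose inner variable stands for `φ`; its order is its degree in `Θ`. -/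
def applyOp (L : ℂ[X][X]) (f : ℂ → ℂ) : ℂ → ℂ :=
  fun z => L.sum fun i p => p.eval z * (euler^[i] f) z

/-- `L` is the Picard–Fuchs operator of the period `Φ` (a function near `φ = 0`): it annihilates
`Φ`, and no nonzero operator with polynomial coefficients of smaller order does. Such an operator
generates the left ideal of all operators over `ℂ(φ)` that annihilate `Φ`, and it is unique up to
multiplication by a rational function on the left. -/
def IsPicardFuchsOperator (L : ℂ[X][X]) (Φ : ℂ → ℂ) : Prop :=
  L ≠ 0 ∧ (∀ᶠ z in 𝓝 (0 : ℂ), applyOp L Φ z = 0) ∧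
    ∀ M : ℂ[X][X], M ≠ 0 → (∀ᶠ z in 𝓝 (0 : ℂ), applyOp M Φ z = 0) →
      L.natDegree ≤ M.natDegree

/-- The operator `𝒟₅`, which is the Calabi–Yau equation No. 302 in the tables of Almkvist,
van Enckevort, van Straten and Zudilin. Here `X` is `Θ` and `C X` is `φ`. -/
def operatorD5 : ℂ[X][X] :=
  X ^ 4
    - 2 ^ 2 * C X * (500 * X ^ 4 + 976 * X ^ 3 + 677 * X ^ 2 + 189 * X + 19)
    + 2 ^ 4 * C X ^ 2 * (3968 * X ^ 4 + 3968 * X ^ 3 - 1336 * X ^ 2 - 1164 * X - 177)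
    - 2 ^ 10 * C X ^ 3 * (500 * X ^ 4 + 24 * X ^ 3 - 37 * X ^ 2 + 6 * X + 3)
    + 2 ^ 12 * C X ^ 4 * (2 * X + 1) ^ 4

end PfaffianMirror

end

/-! Near the torus the fibre is a graph. On the chart `x₀ = 1` with `x₁, x₂, x₄` nonzero, `P₄ = P₅ =
P₂ = 0` can be written as a fixed-point equation `y = S(y)` for `y = (x₃, x₅, x₆)` (`solveMap`), and
`P₁`, `P₃` then vanish because `x₄ P₁`, `x₄ P₃` lie in the ideal of the other three
(`liesOn_chartPoint_iff`). For small `t` the map `S` contracts the polydisc of radius `ε` into the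
one of radius `ε / 4`. So there is exactly one solution in the polydisc, it depends continuously on
the parameters, and a continuous family that starts at `0` can never leave the polydisc: the family
of tori exists and is unique.

The period is a constant term. Taking residues successively in `x₅`, `x₆`, `x₃` shows that `x₁ x₂ x₄
· x₄ / J`, with `J` the Jacobian, is the average over `|x₃| = |x₅| = |x₆| = ε` of `∏ (1 - Sᵢ /
xᵢ)⁻¹` (`circleAverage_kernel`). Hence the period is an average over a six-dimensional torus. Each
`Sᵢ / xᵢ` is a sum of two terms, so the product of geometric series has six exponents. Averaging
leaves a family with two free exponents (`torusAverage_residue`) and gives `∑ binom(2n, n)² A(2n)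
t^(10 n)`, where `A(N) = ∑ binom(N, k)² binom(N + k, k)` are the Apéry numbers for `ζ(2)`.

The coefficients of the theorem are the same numbers (`periodCoeff_eq`): creative telescoping gives
a recurrence of order two for the sum in the theorem, Apéry's recurrence restricted to even indices
gives the same one for `binom(2n, n) A(2n)`, and the initial values agree.

The operator annihilates the period because its recurrence of order four is a left multiple, up to a
nowhere vanishing factor, of this recurrence of order two (`periodCoeff_recurrence_four`).

It is minimal for two reasons. The coefficients `a n` are not hypergeometric: a rational ratio `a (n
+ 1) / a n` would force a rational root of a quadratic form whose roots involve `√5`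
(`rat_not_hypergeometric`). And the recurrence has `(n + 2) ^ 4` in front of its top term (all
exponents at `φ = 0` are zero). Given any annihilating operator with lowest coefficient `m₀(Θ)`, all
lower terms of its recurrence can be rewritten by `a (n + 1)`, with a multiple of `(n + 1) ^ 4`, and
`a n`; non-hypergeometricity then forces `Θ ^ 4 ∣ m₀` (`X_pow_four_dvd_of_recurrence`), hence order
at least four. -/

noncomputable section

namespace PfaffianMirror

/-! ### The Apéry numbers for `ζ(2)` and their recurrence -/

/-- The Apéry numbers for `ζ(2)`. -/
def apery (N : ℕ) : ℕ := ∑ k ∈ Finset.range (N + 1), N.choose k ^ 2 * (N + k).choose k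

/-- The quadratic polynomial `11 x² + 11 x + 3` in the recurrence of the Apéry numbers. -/
def aperyQuad {R : Type*} [CommRing R] (x : R) : R := 11 * x ^ 2 + 11 * x + 3

lemma choose_mul_succ_cast (n k : ℕ) :
    (n.choose k : ℚ) * (n + 1) = (n + 1).choose k * (n + 1 - k) := by
  rcases le_or_gt k (n + 1) with h | h
  · have := Nat.choose_mul_succ_eq n k
    have h2 : (((n + 1 - k : ℕ)) : ℚ) = n + 1 - k := by push_cast [Nat.cast_sub h]; ring
    rw [← h2]
    exact_mod_cast this
  · rw [Nat.choose_eq_zero_of_lt h, Nat.choose_eq_zero_of_lt (by omega : n < k)]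
    simp

lemma choose_succ_right_cast (n k : ℕ) :
    (n.choose (k + 1) : ℚ) * (k + 1) = n.choose k * (n - k) := by
  rcases le_or_gt k n with h | h
  · have := Nat.choose_succ_right_eq n k
    rw [← Nat.cast_sub h]
    exact_mod_cast this
  · rw [Nat.choose_eq_zero_of_lt h, Nat.choose_eq_zero_of_lt (by omega : n < k + 1)]
    simp

lemma succ_choose_succ_cast (n k : ℕ) :
    ((n + 1).choose (k + 1) : ℚ) * (k + 1) = n.choose k * (n + 1) := by
  have := Nat.add_one_mul_choose_eq n k
  have h : ((n + 1 : ℚ)) * n.choose k = (n + 1).choose (k + 1) * (k + 1) := by exact_mod_cast this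
  linarith

lemma apery_eq_sum {N M : ℕ} (h : N ≤ M) :
    (apery N : ℚ) =
      ∑ k ∈ Finset.range (M + 1), (N.choose k : ℚ) ^ 2 * (N + k).choose k := by
  rw [apery]
  push_cast
  refine Finset.sum_subset (fun k hk => ?_) fun k _ hk => ?_
  · simp only [Finset.mem_range] at hk ⊢; omega
  · rw [Nat.choose_eq_zero_of_lt (by simpa using hk)]; simp

/-- The rational certificate in the proof of the Apéry recurrence. -/
def aperyCert (N k : ℕ) : ℚ :=
  ((N + 2).choose k : ℚ) ^ 2 * (N + k).choose k / (N + 2) ^ 2 * k ^ 3 *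
    (-(N + 1) * (11 * (N + 1) ^ 2 + 15 * (N + 1) + 4) + (N + 1) * (6 * (N + 1) + 1) * k
      + (N + 1) * k ^ 2) / (N + 1) ^ 2

/-- Creative telescoping: divided by a common product of binomials, the claim is an identity of
rational functions of `N` and `k`. -/
lemma aperyCert_sub (N k : ℕ) :
    ((N : ℚ) + 2) ^ 2 * ((N + 2).choose k ^ 2 * (N + 2 + k).choose k)
      - aperyQuad ((N : ℚ) + 1) * ((N + 1).choose k ^ 2 * (N + 1 + k).choose k)
      - ((N : ℚ) + 1) ^ 2 * (N.choose k ^ 2 * (N + k).choose k)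
      = aperyCert N (k + 1) - aperyCert N k := by
  have h1 := choose_mul_succ_cast N k
  have h2 := choose_mul_succ_cast (N + 1) k
  have h3 := choose_mul_succ_cast (N + k) k
  have h4 := choose_mul_succ_cast (N + 1 + k) k
  have h5 := choose_succ_right_cast (N + 2) k
  have h6 := succ_choose_succ_cast (N + k) k
  rw [show N + k + 1 = N + 1 + k by ring] at h3
  rw [show N + 1 + k + 1 = N + 2 + k by ring] at h4
  rw [show N + 1 + 1 = N + 2 by ring] at h2
  push_cast at h1 h2 h3 h4 h5 h6
  have e1 : (N : ℚ) + 1 ≠ 0 := by positivity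
  have e2 : (N : ℚ) + 2 ≠ 0 := by positivity
  have e3 : (k : ℚ) + 1 ≠ 0 := by positivity
  -- Everything is expressed by `binom(N + 2, k)` and `binom(N + k, k)`. Lowering the top index of
  -- the first and raising that of the second needs only denominators that never vanish, so no case
  -- distinction on `k ≤ N` arises.
  have g2 : ((N + 1).choose k : ℚ) = (N + 2).choose k * (N + 2 - k) / (N + 2) := by
    field_simp; linear_combination h2
  have g1 : (N.choose k : ℚ) =
      (N + 2).choose k * (N + 2 - k) * (N + 1 - k) / ((N + 2) * (N + 1)) := by
    rw [g2] at h1; field_simp at h1 ⊢; linear_combination h1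
  have g3 : ((N + 1 + k).choose k : ℚ) = (N + k).choose k * (N + k + 1) / (N + 1) := by
    field_simp; linear_combination -h3
  have g4 : ((N + 2 + k).choose k : ℚ) =
      (N + k).choose k * (N + k + 1) * (N + k + 2) / ((N + 1) * (N + 2)) := by
    rw [g3] at h4; field_simp at h4 ⊢; linear_combination -h4
  have g5 : ((N + 2).choose (k + 1) : ℚ) = (N + 2).choose k * (N + 2 - k) / (k + 1) := by
    field_simp; linear_combination h5
  have g6 : ((N + (k + 1)).choose (k + 1) : ℚ) = (N + k).choose k * (N + k + 1) / (k + 1) := by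
    field_simp; rw [← add_assoc]; linear_combination h6
  rw [aperyCert, aperyCert, g1, g2, g3, g4, g5, g6, aperyQuad]
  push_cast
  generalize ((N + 2).choose k : ℚ) = c
  generalize ((N + k).choose k : ℚ) = d
  field_simp
  ring

/-- The telescoping identity is summed over `0 ≤ k ≤ N + 2`. The boundary terms vanish: at `k = 0`
by the factor `k ^ 3`, at `k = N + 3` by `binom(N + 2, N + 3) = 0`. -/
theorem apery_recurrence (N : ℕ) :
    ((N : ℚ) + 2) ^ 2 * apery (N + 2) =
      aperyQuad ((N : ℚ) + 1) * apery (N + 1) + ((N : ℚ) + 1) ^ 2 * apery N := by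
  have h := Finset.sum_range_sub (aperyCert N) (N + 2 + 1)
  simp only [← aperyCert_sub, Finset.sum_sub_distrib, ← Finset.mul_sum] at h
  rw [← apery_eq_sum le_rfl, ← apery_eq_sum (by omega : N + 1 ≤ N + 2),
    ← apery_eq_sum (by omega : N ≤ N + 2)] at h
  have h0 : aperyCert N (N + 2 + 1) = 0 := by
    rw [aperyCert, Nat.choose_eq_zero_of_lt (by omega : N + 2 < N + 2 + 1)]; simp
  have h1 : aperyCert N 0 = 0 := by simp [aperyCert]
  rw [h0, h1] at h
  linarith

/-- The middle coefficient of the recurrence of the numbers `binom (2n) n ^ 2 * apery (2n)`. -/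
def midCoeff {R : Type*} [CommRing R] (n : R) : R :=
  aperyQuad (2 * n - 1) * (2 * n + 1) ^ 4
    + aperyQuad (2 * n + 1) * (aperyQuad (2 * n) * aperyQuad (2 * n - 1) + (2 * n) ^ 4)

/-- Three consecutive instances of the Apéry recurrence contain two Apéry numbers of odd index,
which are eliminated; this is where `midCoeff` comes from. -/
lemma apery_even_recurrence (n : ℕ) :
    aperyQuad (2 * (n : ℚ) + 1) * (2 * n + 3) ^ 2 * (2 * n + 4) ^ 2 * apery (2 * (n + 2))
      = midCoeff ((n : ℚ) + 1) * apery (2 * (n + 1))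
        - aperyQuad (2 * (n : ℚ) + 3) * (2 * n + 2) ^ 2 * (2 * n + 1) ^ 2 * apery (2 * n) := by
  have h0 := apery_recurrence (2 * n)
  have h1 := apery_recurrence (2 * n + 1)
  have h2 := apery_recurrence (2 * n + 2)
  rw [show 2 * (n + 1) = 2 * n + 2 by ring, show 2 * (n + 2) = 2 * n + 2 + 2 by ring]
  rw [show 2 * n + 1 + 2 = 2 * n + 2 + 1 by ring, show 2 * n + 1 + 1 = 2 * n + 2 by ring] at h1
  simp only [aperyQuad, midCoeff] at *
  push_cast at *
  linear_combination (11 * (2 * (n : ℚ) + 1) ^ 2 + 11 * (2 * n + 1) + 3) * (2 * n + 3) ^ 2 * h2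
    + (11 * (2 * (n : ℚ) + 1) ^ 2 + 11 * (2 * n + 1) + 3) *
      (11 * (2 * (n : ℚ) + 3) ^ 2 + 11 * (2 * n + 3) + 3) * h1
    - (11 * (2 * (n : ℚ) + 3) ^ 2 + 11 * (2 * n + 3) + 3) * (2 * n + 2) ^ 2 * h0

/-! ### The coefficients of the period in terms of Apéry numbers -/

/-- The summand of `periodCoeff n / binom (2n) n`. -/
def periodTerm (n k : ℕ) : ℚ :=
  n.choose k * (n + k).choose k * (n + k).centralBinom * (2 * n + k).choose (2 * k)

/-- The sum `periodCoeff n / binom (2n) n`. -/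
def periodSum (n : ℕ) : ℚ := ∑ k ∈ Finset.range (n + 1), periodTerm n k

lemma periodCoeff_eq_mul_periodSum (n : ℕ) :
    (periodCoeff n : ℚ) = n.centralBinom * periodSum n := by
  rw [periodCoeff, periodSum, Nat.centralBinom]
  push_cast
  congr 1
  refine Finset.sum_congr rfl fun k hk => ?_
  have hk : k ≤ n := by simpa [Nat.lt_succ_iff] using hk
  rw [periodTerm, Nat.centralBinom, Nat.choose_symm_add (a := n) (b := k),
    ← Nat.choose_symm (by omega : 2 * n - k ≤ 2 * n + k),
    show 2 * n + k - (2 * n - k) = 2 * k by omega, show 2 * (n + k) = 2 * n + 2 * k by ring]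

lemma periodSum_eq_sum {n M : ℕ} (h : n ≤ M) :
    periodSum n = ∑ k ∈ Finset.range (M + 1), periodTerm n k := by
  refine Finset.sum_subset (fun k hk => ?_) fun k _ hk => ?_
  · simp only [Finset.mem_range] at hk ⊢; omega
  · rw [periodTerm, Nat.choose_eq_zero_of_lt (by simpa using hk)]; simp

/-- The common factor of `periodTerm n k`, `periodTerm (n + 1) k`, `periodTerm (n + 2) k` as
rational functions. -/
def periodBase (n k : ℕ) : ℚ :=
  (n + 2).choose k * (n + k).choose k * (n + k).centralBinom * (2 * n + 4 + k).choose (2 * k) /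
    ((n + k + 1) * (n + k + 2) * (2 * n + k + 1) * (2 * n + k + 2) * (2 * n + k + 3)
      * (2 * n + k + 4))

lemma centralBinom_succ_cast (m : ℕ) :
    ((m + 1).centralBinom : ℚ) = m.centralBinom * (2 * (2 * m + 1)) / (m + 1) := by
  have h := Nat.succ_mul_centralBinom_succ m
  have h' : ((m : ℚ) + 1) * (m + 1).centralBinom = 2 * (2 * m + 1) * m.centralBinom := by
    exact_mod_cast h
  have : (m : ℚ) + 1 ≠ 0 := by positivity
  field_simp
  linarith

lemma choose_eq_succ_div (m k : ℕ) :
    (m.choose k : ℚ) = (m + 1).choose k * (m + 1 - k) / (m + 1) := by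
  have h := choose_mul_succ_cast m k
  have : (m : ℚ) + 1 ≠ 0 := by positivity
  field_simp
  linarith

/-- This and the next two lemmas write the three shifted summands as polynomial multiples of
`periodBase`, which reduces the recurrence to a polynomial identity. As before, the base uses the
largest top index where lowering it yields a polynomial factor, and the smallest index for the other
binomials. -/
lemma periodTerm_add_two (n k : ℕ) :
    periodTerm (n + 2) k * ((n + 1) * (n + 2)) = periodBase n k *
      ((n + k + 1) * (n + k + 2) * (2 * (2 * (n + k) + 1)) * (2 * (2 * (n + k) + 3))
        * ((2 * n + k + 1) * (2 * n + k + 2) * (2 * n + k + 3) * (2 * n + k + 4))) := by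
  have h3 := choose_mul_succ_cast (n + k) k
  have h4 := choose_mul_succ_cast (n + 1 + k) k
  rw [show n + k + 1 = n + 1 + k by ring] at h3
  rw [show n + 1 + k + 1 = n + 2 + k by ring] at h4
  push_cast at h3 h4
  rw [periodTerm, periodBase, show n + 2 + k = n + k + 1 + 1 by ring, centralBinom_succ_cast,
    centralBinom_succ_cast, show n + k + 1 + 1 = n + 2 + k by ring,
    show 2 * (n + 2) + k = 2 * n + 4 + k by ring]
  have e1 : (n : ℚ) + 1 ≠ 0 := by positivity
  have e2 : (n : ℚ) + 2 ≠ 0 := by positivity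
  have g3 : ((n + 1 + k).choose k : ℚ) = (n + k).choose k * (n + k + 1) / (n + 1) := by
    field_simp; linear_combination -h3
  have g4 : ((n + 2 + k).choose k : ℚ) =
      (n + k).choose k * (n + k + 1) * (n + k + 2) / ((n + 1) * (n + 2)) := by
    rw [g3] at h4; field_simp at h4 ⊢; linear_combination -h4
  rw [g4]
  push_cast
  have e3 : (n : ℚ) + k + 1 + 1 ≠ 0 := by positivity
  have e4 : (n : ℚ) + k + 1 ≠ 0 := by positivity
  have e5 : (n : ℚ) + k + 2 ≠ 0 := by positivity
  have e6 : 2 * (n : ℚ) + k + 1 ≠ 0 := by positivity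
  have e7 : 2 * (n : ℚ) + k + 2 ≠ 0 := by positivity
  have e8 : 2 * (n : ℚ) + k + 3 ≠ 0 := by positivity
  have e9 : 2 * (n : ℚ) + k + 4 ≠ 0 := by positivity
  field_simp
  ring

lemma periodTerm_add_one (n k : ℕ) :
    periodTerm (n + 1) k * ((n + 1) * (n + 2)) = periodBase n k *
      ((n + 2 - k) * (n + k + 1) * (n + k + 2) * (2 * (2 * (n + k) + 1))
        * ((2 * n + k + 1) * (2 * n + k + 2) * (2 * n + 4 - k) * (2 * n + 3 - k))) := by
  have h3 := choose_mul_succ_cast (n + k) k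
  rw [show n + k + 1 = n + 1 + k by ring] at h3
  push_cast at h3
  rw [periodTerm, periodBase, show n + 1 + k = n + k + 1 by ring, centralBinom_succ_cast,
    show n + k + 1 = n + 1 + k by ring, show 2 * (n + 1) + k = 2 * n + 2 + k by ring,
    choose_eq_succ_div (2 * n + 2 + k), choose_eq_succ_div (2 * n + 2 + k + 1),
    choose_eq_succ_div (n + 1), show 2 * n + 2 + k + 1 + 1 = 2 * n + 4 + k by ring]
  have e1 : (n : ℚ) + 1 ≠ 0 := by positivity
  have g3 : ((n + 1 + k).choose k : ℚ) = (n + k).choose k * (n + k + 1) / (n + 1) := by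
    field_simp; linear_combination -h3
  rw [g3]
  push_cast
  have e2 : (n : ℚ) + 1 + 1 ≠ 0 := by positivity
  have e4 : (n : ℚ) + k + 1 ≠ 0 := by positivity
  have e5 : (n : ℚ) + k + 2 ≠ 0 := by positivity
  have e6 : 2 * (n : ℚ) + k + 1 ≠ 0 := by positivity
  have e7 : 2 * (n : ℚ) + k + 2 ≠ 0 := by positivity
  have e8 : 2 * (n : ℚ) + k + 3 ≠ 0 := by positivity
  have e9 : 2 * (n : ℚ) + k + 4 ≠ 0 := by positivity
  have e10 : 2 * (n : ℚ) + 2 + k + 1 ≠ 0 := by positivity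
  have e11 : 2 * (n : ℚ) + 2 + k + 1 + 1 ≠ 0 := by positivity
  rw [show n + 1 + 1 = n + 2 by ring]
  field_simp
  ring

lemma periodTerm_eq (n k : ℕ) :
    periodTerm n k * ((n + 1) * (n + 2)) = periodBase n k *
      ((n + 2 - k) * (n + 1 - k) * (n + k + 1) * (n + k + 2)
        * ((2 * n + 4 - k) * (2 * n + 3 - k) * (2 * n + 2 - k) * (2 * n + 1 - k))) := by
  rw [periodTerm, periodBase, 
    choose_eq_succ_div (2 * n + k), choose_eq_succ_div (2 * n + k + 1),
    choose_eq_succ_div (2 * n + k + 1 + 1), choose_eq_succ_div (2 * n + k + 1 + 1 + 1),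
    choose_eq_succ_div n, choose_eq_succ_div (n + 1),
    show 2 * n + k + 1 + 1 + 1 + 1 = 2 * n + 4 + k by ring]
  push_cast
  have e1 : (n : ℚ) + 1 ≠ 0 := by positivity
  have e2 : (n : ℚ) + 1 + 1 ≠ 0 := by positivity
  have e4 : (n : ℚ) + k + 1 ≠ 0 := by positivity
  have e5 : (n : ℚ) + k + 2 ≠ 0 := by positivity
  have e6 : 2 * (n : ℚ) + k + 1 ≠ 0 := by positivity
  have e7 : 2 * (n : ℚ) + k + 2 ≠ 0 := by positivity
  have e8 : 2 * (n : ℚ) + k + 3 ≠ 0 := by positivity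
  have e9 : 2 * (n : ℚ) + k + 4 ≠ 0 := by positivity
  have e10 : 2 * (n : ℚ) + k + 1 + 1 ≠ 0 := by positivity
  have e11 : 2 * (n : ℚ) + k + 1 + 1 + 1 ≠ 0 := by positivity
  have e12 : 2 * (n : ℚ) + k + 1 + 1 + 1 + 1 ≠ 0 := by positivity
  rw [show n + 1 + 1 = n + 2 by ring]
  field_simp
  ring

lemma periodBase_succ (n k : ℕ) :
    periodBase n (k + 1) * ((k + 1) ^ 3 * (2 * k + 1) * (n + k + 3)) = periodBase n k *
      ((n + k + 1) * (2 * n + 2 * k + 1) * (2 * n + k + 1) * (n + 2 - k) * (2 * n + 4 - k)) := by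
  have h1 := choose_succ_right_cast (n + 2) k
  have h2 := succ_choose_succ_cast (n + k) k
  have h3 := centralBinom_succ_cast (n + k)
  have h4 := succ_choose_succ_cast (2 * n + 4 + k) (2 * k)
  have h5 := choose_succ_right_cast (2 * n + 4 + k + 1) (2 * k + 1)
  push_cast at h1 h2 h3 h4 h5
  have e0 : (k : ℚ) + 1 ≠ 0 := by positivity
  have e1 : 2 * (k : ℚ) + 1 ≠ 0 := by positivity
  have e2 : 2 * (k : ℚ) + 1 + 1 ≠ 0 := by positivity
  have g1 : ((n + 2).choose (k + 1) : ℚ) = (n + 2).choose k * (n + 2 - k) / (k + 1) := by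
    field_simp; linear_combination h1
  have g2 : ((n + k + 1).choose (k + 1) : ℚ) = (n + k).choose k * (n + k + 1) / (k + 1) := by
    field_simp; linear_combination h2
  have g4 : ((2 * n + 4 + k + 1).choose (2 * k + 1) : ℚ) =
      (2 * n + 4 + k).choose (2 * k) * (2 * n + 4 + k + 1) / (2 * k + 1) := by
    field_simp; linear_combination h4
  have g5 : ((2 * n + 4 + k + 1).choose (2 * k + 1 + 1) : ℚ) =
      (2 * n + 4 + k).choose (2 * k) * (2 * n + 4 + k + 1) * (2 * n + 4 - k)
        / ((2 * k + 1) * (2 * k + 1 + 1)) := by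
    rw [g4] at h5; field_simp at h5 ⊢; linear_combination h5
  rw [periodBase, periodBase, show 2 * (k + 1) = 2 * k + 1 + 1 by ring, ← add_assoc, ← add_assoc,
    g1, g2, h3, g5]
  push_cast
  have e4 : (n : ℚ) + k + 1 ≠ 0 := by positivity
  have e5 : (n : ℚ) + k + 2 ≠ 0 := by positivity
  have e6 : 2 * (n : ℚ) + k + 1 ≠ 0 := by positivity
  have e7 : 2 * (n : ℚ) + k + 2 ≠ 0 := by positivity
  have e8 : 2 * (n : ℚ) + k + 3 ≠ 0 := by positivity
  have e9 : 2 * (n : ℚ) + k + 4 ≠ 0 := by positivity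
  have f4 : (n : ℚ) + (k + 1) + 1 ≠ 0 := by positivity
  have f5 : (n : ℚ) + (k + 1) + 2 ≠ 0 := by positivity
  have f6 : 2 * (n : ℚ) + (k + 1) + 1 ≠ 0 := by positivity
  have f7 : 2 * (n : ℚ) + (k + 1) + 2 ≠ 0 := by positivity
  have f8 : 2 * (n : ℚ) + (k + 1) + 3 ≠ 0 := by positivity
  have f9 : 2 * (n : ℚ) + (k + 1) + 4 ≠ 0 := by positivity
  field_simp
  ring

/-- The polynomial factor of the rational certificate in the proof of the recurrence of
`periodSum`. -/
def periodCertPoly (m k : ℚ) : ℚ :=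
  (-1800 * m + 12840 * m ^ 2 - 18976 * m ^ 3 - 102416 * m ^ 4 + 236032 * m ^ 5 + 573760 * m ^ 6
      - 412544 * m ^ 7 - 1362944 * m ^ 8 - 681472 * m ^ 9)
    + (-1800 + 21336 * m - 63504 * m ^ 2 - 96680 * m ^ 3 + 531600 * m ^ 4 + 451328 * m ^ 5
      - 1415744 * m ^ 6 - 2031744 * m ^ 7 - 681472 * m ^ 8) * k
    + (8496 - 57344 * m + 61688 * m ^ 2 + 324792 * m ^ 3 - 420592 * m ^ 4 - 1138560 * m ^ 5
      - 278080 * m ^ 6 + 260480 * m ^ 7) * k ^ 2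
    + (-12816 + 63728 * m - 2976 * m ^ 2 - 323664 * m ^ 3 + 20224 * m ^ 4 + 546304 * m ^ 5
      + 260480 * m ^ 6) * k ^ 3
    + (7776 - 33856 * m - 18432 * m ^ 2 + 160928 * m ^ 3 + 120384 * m ^ 4
      - 35200 * m ^ 5) * k ^ 4
    + (-1656 + 7072 * m + 5344 * m ^ 2 - 35200 * m ^ 3 - 35200 * m ^ 4) * k ^ 5

/-- The rational certificate in the proof of the recurrence of `periodSum`. -/
def periodCert (n k : ℕ) : ℚ :=
  periodBase n k * (k ^ 3 * (2 * k - 1) * (n + k + 2)) * periodCertPoly (n + 1) k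

/-- The telescoping relation for `periodSum` after division by `periodBase`, with `m = n + 1`. -/
lemma periodCert_polynomial_identity (m k : ℚ) :
    2 * aperyQuad (2 * m - 1) * (2 * m + 1) * (m + 1) ^ 3 *
        ((m + k) * (m + k + 1) * (2 * (2 * (m + k) - 1)) * (2 * (2 * (m + k) + 1))
          * ((2 * m + k - 1) * (2 * m + k) * (2 * m + k + 1) * (2 * m + k + 2)))
      - midCoeff m * ((m + 1 - k) * (m + k) * (m + k + 1) * (2 * (2 * (m + k) - 1))
        * ((2 * m + k - 1) * (2 * m + k) * (2 * m + 2 - k) * (2 * m + 1 - k)))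
      + 8 * aperyQuad (2 * m + 1) * m * (2 * m - 1) ^ 3 *
        ((m + 1 - k) * (m - k) * (m + k) * (m + k + 1)
          * ((2 * m + 2 - k) * (2 * m + 1 - k) * (2 * m - k) * (2 * m - 1 - k)))
    = (m + k) * (2 * m + 2 * k - 1) * (2 * m + k - 1) * (m + 1 - k) * (2 * m + 2 - k)
        * periodCertPoly m (k + 1)
      - k ^ 3 * (2 * k - 1) * (m + k + 1) * periodCertPoly m k := by
  simp only [aperyQuad, midCoeff, periodCertPoly]
  ring

lemma periodCert_sub (n k : ℕ) :
    (2 * aperyQuad (2 * (n : ℚ) + 1) * (2 * n + 3) * (n + 2) ^ 3 * periodTerm (n + 2) k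
      - midCoeff ((n : ℚ) + 1) * periodTerm (n + 1) k
      + 8 * aperyQuad (2 * (n : ℚ) + 3) * (n + 1) * (2 * n + 1) ^ 3 * periodTerm n k)
        * ((n + 1) * (n + 2))
      = periodCert n (k + 1) - periodCert n k := by
  have h0 := periodTerm_eq n k
  have h1 := periodTerm_add_one n k
  have h2 := periodTerm_add_two n k
  have h3 := periodBase_succ n k
  have h4 := periodCert_polynomial_identity ((n : ℚ) + 1) k
  rw [show 2 * ((n : ℚ) + 1) - 1 = 2 * n + 1 by ring,
    show 2 * ((n : ℚ) + 1) + 1 = 2 * n + 3 by ring] at h4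
  -- The prefactor of the certificate at `k + 1` is exactly the denominator of `periodBase n (k + 1)
  -- / periodBase n k`, so both certificate values are polynomial multiples of `periodBase n k`.
  have h5 : periodCert n (k + 1) = (periodBase n k *
      ((n + k + 1) * (2 * n + 2 * k + 1) * (2 * n + k + 1) * (n + 2 - k) * (2 * n + 4 - k)))
        * periodCertPoly (n + 1) (k + 1) := by
    rw [← h3, periodCert]
    push_cast
    ring
  rw [h5, periodCert]
  generalize aperyQuad (2 * (n : ℚ) + 1) = q1 at *
  generalize aperyQuad (2 * (n : ℚ) + 3) = q3 at *
  generalize midCoeff ((n : ℚ) + 1) = q at *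
  generalize periodCertPoly ((n : ℚ) + 1) k = c at *
  generalize periodCertPoly ((n : ℚ) + 1) (k + 1) = d at *
  linear_combination (2 * q1 * (2 * n + 3) * (n + 2) ^ 3) * h2 - q * h1
    + (8 * q3 * (n + 1) * (2 * n + 1) ^ 3) * h0 + periodBase n k * h4

theorem periodSum_recurrence (n : ℕ) :
    2 * aperyQuad (2 * (n : ℚ) + 1) * (2 * n + 3) * (n + 2) ^ 3 * periodSum (n + 2)
      = midCoeff ((n : ℚ) + 1) * periodSum (n + 1)
      - 8 * aperyQuad (2 * (n : ℚ) + 3) * (n + 1) * (2 * n + 1) ^ 3 * periodSum n := by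
  have h := Finset.sum_range_sub (periodCert n) (n + 2 + 1)
  simp only [← periodCert_sub, ← Finset.sum_mul, Finset.sum_add_distrib, Finset.sum_sub_distrib,
    ← Finset.mul_sum] at h
  rw [← periodSum_eq_sum le_rfl, ← periodSum_eq_sum (by omega : n + 1 ≤ n + 2),
    ← periodSum_eq_sum (by omega : n ≤ n + 2)] at h
  have h0 : periodCert n (n + 2 + 1) = 0 := by
    rw [periodCert, periodBase, Nat.choose_eq_zero_of_lt (by omega : n + 2 < n + 2 + 1)]; simp
  have h1 : periodCert n 0 = 0 := by simp [periodCert]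
  rw [h0, h1, sub_zero] at h
  have e : ((n : ℚ) + 1) * (n + 2) ≠ 0 := by positivity
  have := (mul_eq_zero.1 h).resolve_right e
  linarith

lemma aperyQuad_natCast_pos (n : ℕ) : 0 < aperyQuad (n : ℚ) := by
  rw [aperyQuad]; positivity

theorem periodSum_eq (n : ℕ) : periodSum n = n.centralBinom * apery (2 * n) := by
  induction n using Nat.strong_induction_on with
  | _ n ih =>
    -- A recurrence of order two with nonzero leading coefficient determines the sequence from its
    -- values at `0` and `1`. The recurrence of the right-hand side is that of the even Apéry
    -- numbers, rescaled by the ratios of central binomial coefficients.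
    match n, ih with
    | 0, _ => simp [periodSum, periodTerm, apery]
    | 1, _ => 
      norm_num [periodSum, periodTerm, apery, Finset.sum_range_succ, Nat.choose, Nat.centralBinom]
    | n + 2, ih =>
      have h := periodSum_recurrence n
      rw [ih n (by omega), ih (n + 1) (by omega)] at h
      have h2 := apery_even_recurrence n
      have c1 := centralBinom_succ_cast n
      have c2 := centralBinom_succ_cast (n + 1)
      rw [show n + 1 + 1 = n + 2 by ring, c1] at c2
      rw [c1] at h
      rw [c2]
      have p := aperyQuad_natCast_pos (2 * n + 1)
      push_cast at p c2 h h2 ⊢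
      have e1 : (n : ℚ) + 1 ≠ 0 := by positivity
      have e2 : (n : ℚ) + 1 + 1 ≠ 0 := by positivity
      have e0 : 2 * aperyQuad (2 * (n : ℚ) + 1) * (2 * n + 3) * (n + 2) ^ 3 ≠ 0 := by positivity
      apply mul_left_cancel₀ e0
      rw [h]
      generalize aperyQuad (2 * (n : ℚ) + 1) = q1 at *
      generalize aperyQuad (2 * (n : ℚ) + 3) = q3 at *
      generalize midCoeff ((n : ℚ) + 1) = q at *
      linear_combination (norm := (field_simp; ring))
        -(n.centralBinom : ℚ) * (2 * (2 * n + 1)) / (n + 1) * h2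

/-- The numbers `periodCoeff n` are the squares of central binomial coefficients times the Apéry
numbers of even index. -/
theorem periodCoeff_eq (n : ℕ) : periodCoeff n = n.centralBinom ^ 2 * apery (2 * n) := by
  have h := periodCoeff_eq_mul_periodSum n
  rw [periodSum_eq] at h
  have : (periodCoeff n : ℚ) = (n.centralBinom ^ 2 * apery (2 * n) : ℕ) := by
    rw [h]; push_cast; ring
  exact_mod_cast this

/-- The recurrence of order two of the coefficients of the period. -/
theorem periodCoeff_recurrence (n : ℕ) :
    aperyQuad (2 * (n : ℚ) + 1) * (n + 2) ^ 4 * periodCoeff (n + 2)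
      - midCoeff ((n : ℚ) + 1) * periodCoeff (n + 1)
      + 16 * aperyQuad (2 * (n : ℚ) + 3) * (2 * n + 1) ^ 4 * periodCoeff n = 0 := by
  have h := periodSum_recurrence n
  have c1 := centralBinom_succ_cast n
  have c2 := centralBinom_succ_cast (n + 1)
  rw [show n + 1 + 1 = n + 2 by ring, c1] at c2
  rw [periodCoeff_eq_mul_periodSum, periodCoeff_eq_mul_periodSum, periodCoeff_eq_mul_periodSum,
    c2, c1]
  push_cast
  have e1 : (n : ℚ) + 1 ≠ 0 := by positivity
  have e2 : (n : ℚ) + 1 + 1 ≠ 0 := by positivity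
  generalize aperyQuad (2 * (n : ℚ) + 1) = q1 at *
  generalize aperyQuad (2 * (n : ℚ) + 3) = q3 at *
  generalize midCoeff ((n : ℚ) + 1) = q at *
  field_simp
  linear_combination (2 * (n.centralBinom : ℚ)) * (2 * n + 1) * (n + 2) * h

/-! ### The coefficients of the period are not hypergeometric -/

lemma periodCoeff_pos (n : ℕ) : 0 < periodCoeff n := by
  rw [periodCoeff_eq]
  refine mul_pos (pow_pos (Nat.centralBinom_pos n) 2) ?_
  rw [apery]
  exact Finset.sum_pos (fun k hk => mul_pos
    (pow_pos (Nat.choose_pos (by simpa [Nat.lt_succ_iff] using hk)) 2)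
    (Nat.choose_pos (by omega))) ⟨0, by simp⟩

lemma coeff_taylor_of_natDegree_le {R : Type*} [CommRing R] {u : R[X]} {D : ℕ}
    (h : u.natDegree ≤ D) (r : R) : (taylor r u).coeff D = u.coeff D := by
  rcases h.lt_or_eq with h | h
  · rw [coeff_eq_zero_of_natDegree_lt h, coeff_eq_zero_of_natDegree_lt (by simpa using h)]
  · subst h
    rw [taylor_coeff, hasseDeriv_natDegree_eq_C]
    simp

lemma natDegree_coeff_affine_quad (a : ℚ) :
    (aperyQuad (2 * X + C a) : ℚ[X]).natDegree ≤ 2 ∧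
      (aperyQuad (2 * X + C a) : ℚ[X]).coeff 2 = 44 := by
  have h : (aperyQuad (2 * X + C a) : ℚ[X]) =
      C 44 * X ^ 2 + C (44 * a + 22) * X + C (11 * a ^ 2 + 11 * a + 3) := by
    simp only [aperyQuad, map_add, map_mul, map_pow, map_ofNat]; ring
  rw [h]
  refine ⟨natDegree_quadratic_le, ?_⟩
  generalize 11 * a ^ 2 + 11 * a + 3 = c
  generalize 44 * a + 22 = d
  simp

/-- The roots of the form are `x / y = -984 ± 440 √5`, which are irrational. -/
lemma sq_form_ne_zero {x y : ℚ} (h : 44 * x * x + 86592 * y * x + 11264 * y * y = 0) : y = 0 := by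
  by_contra hy
  have h1 : ((x / y + 984) / 440) ^ 2 = 5 := by
    field_simp
    linarith
  have h2 : Irrational (√5 : ℝ) := (Nat.Prime.irrational_sqrt (by norm_num : Nat.Prime 5))
  apply h2
  refine ⟨|(x / y + 984) / 440|, ?_⟩
  rw [eq_comm, Real.sqrt_eq_iff_mul_self_eq (by norm_num) (by positivity)]
  have : (|(x / y + 984) / 440| * |(x / y + 984) / 440| : ℚ) = 5 := by
    rw [abs_mul_abs_self, ← sq, h1]
  exact_mod_cast this.symm

lemma natDegree_coeff_mul {R : Type*} [CommRing R] {f g : R[X]} {m n : ℕ} {a b : R}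
    (hf : f.natDegree ≤ m ∧ f.coeff m = a) (hg : g.natDegree ≤ n ∧ g.coeff n = b) :
    (f * g).natDegree ≤ m + n ∧ (f * g).coeff (m + n) = a * b :=
  ⟨natDegree_mul_le_of_le hf.1 hg.1, by
    rw [coeff_mul_add_eq_of_natDegree_le hf.1 hg.1, hf.2, hg.2]⟩

lemma natDegree_coeff_pow {R : Type*} [CommRing R] {f : R[X]} {m : ℕ} {a : R}
    (hf : f.natDegree ≤ m ∧ f.coeff m = a) (k : ℕ) :
    (f ^ k).natDegree ≤ k * m ∧ (f ^ k).coeff (k * m) = a ^ k :=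
  ⟨natDegree_pow_le_of_le k hf.1, by rw [coeff_pow_of_natDegree_le hf.1, hf.2]⟩

lemma natDegree_coeff_add {R : Type*} [CommRing R] {f g : R[X]} {m : ℕ} {a b : R}
    (hf : f.natDegree ≤ m ∧ f.coeff m = a) (hg : g.natDegree ≤ m ∧ g.coeff m = b) :
    (f + g).natDegree ≤ m ∧ (f + g).coeff m = a + b :=
  ⟨natDegree_add_le_of_degree_le hf.1 hg.1, by rw [coeff_add, hf.2, hg.2]⟩

lemma natDegree_coeff_linear {R : Type*} [CommRing R] (a b : R) :
    (C a * X + C b : R[X]).natDegree ≤ 1 ∧ (C a * X + C b : R[X]).coeff 1 = a :=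
  ⟨natDegree_linear_le, by simp [coeff_C]⟩

lemma natDegree_coeff_midCoeff :
    (midCoeff (X + 1) : ℚ[X]).natDegree ≤ 6 ∧ (midCoeff (X + 1) : ℚ[X]).coeff 6 = 86592 := by
  have q1 := natDegree_coeff_affine_quad 1
  have q2 := natDegree_coeff_affine_quad 2
  have q3 := natDegree_coeff_affine_quad 3
  have l3 := natDegree_coeff_pow (natDegree_coeff_linear (2 : ℚ) 3) 4
  have l2 := natDegree_coeff_pow (natDegree_coeff_linear (2 : ℚ) 2) 4
  have h := natDegree_coeff_add (natDegree_coeff_mul q1 l3)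
    (natDegree_coeff_mul q3 (natDegree_coeff_add (m := 4) (natDegree_coeff_mul q2 q1) l2))
  have e : (midCoeff (X + 1) : ℚ[X]) = aperyQuad (2 * X + C 1) * (C 2 * X + C 3) ^ 4 +
      aperyQuad (2 * X + C 3) * (aperyQuad (2 * X + C 2) * aperyQuad (2 * X + C 1) +
        (C 2 * X + C 2) ^ 4) := by
    simp only [midCoeff, aperyQuad, map_ofNat, map_one]; ring
  rw [e]
  norm_num at h ⊢
  exact h

lemma exists_nat_eval_eq_zero {K : Type*} [Field K] [CharZero K] {u : K[X]} {n₀ : ℕ}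
    (h : ∀ n : ℕ, n₀ ≤ n → u.eval (n : K) = 0) : u = 0 := by
  refine eq_zero_of_infinite_isRoot u ?_
  refine Set.Infinite.mono (s := (fun n : ℕ => (n : K)) '' Set.Ici n₀) ?_
    ((Set.Ici_infinite n₀).image Nat.cast_injective.injOn)
  rintro _ ⟨n, hn, rfl⟩
  exact h n hn

/-- A first-order relation inserted twice into the recurrence leaves a multiple of the nonzero
number `a (n + 1)`, hence a polynomial identity in `n`. Its leading coefficients satisfy a quadratic
form without nontrivial rational zeros. -/
lemma rat_not_hypergeometric {u v : ℚ[X]} {n₀ : ℕ}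
    (h : ∀ n : ℕ, n₀ ≤ n →
      u.eval ((n : ℚ) + 1) * periodCoeff (n + 1) + v.eval ((n : ℚ) + 1) * periodCoeff n = 0) :
    u = 0 := by
  have key : aperyQuad (2 * X + C 1) * (C 1 * X + C 2) ^ 4 * taylor 2 v * taylor 1 v
      + midCoeff (X + 1) * taylor 2 u * taylor 1 v
      + C 16 * aperyQuad (2 * X + C 3) * (C 2 * X + C 1) ^ 4 * taylor 2 u * taylor 1 u
      = (0 : ℚ[X]) := by
    refine exists_nat_eval_eq_zero (n₀ := n₀) fun n hn => ?_
    have h1 := h n hn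
    have h2 := h (n + 1) (by omega)
    have h3 := periodCoeff_recurrence n
    have ha : (periodCoeff (n + 1) : ℚ) ≠ 0 := by exact_mod_cast (periodCoeff_pos _).ne'
    push_cast at h2
    rw [show (n : ℚ) + 1 + 1 = n + 2 by ring, show n + 1 + 1 = n + 2 by ring] at h2
    simp only [eval_add, eval_mul, eval_pow, eval_C, eval_X, taylor_eval, midCoeff, aperyQuad,
      eval_ofNat, eval_sub, eval_one] at h3 ⊢
    apply mul_left_cancel₀ ha
    generalize eval ((n : ℚ) + 2) u = u2 at *
    generalize eval ((n : ℚ) + 2) v = v2 at *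
    generalize eval ((n : ℚ) + 1) u = u1 at *
    generalize eval ((n : ℚ) + 1) v = v1 at *
    linear_combination (-u2 * v1) * h3
      + (11 * (2 * (n : ℚ) + 1) ^ 2 + 11 * (2 * n + 1) + 3) * (n + 2) ^ 4 * v1 * h2
      + 16 * (11 * (2 * (n : ℚ) + 3) ^ 2 + 11 * (2 * n + 3) + 3) * (2 * n + 1) ^ 4 * u2 * h1
  set D := max u.natDegree v.natDegree with hD
  have hu : u.natDegree ≤ D := le_max_left _ _
  have hv : v.natDegree ≤ D := le_max_right _ _
  have tu : ∀ r, (taylor r u).natDegree ≤ D ∧ (taylor r u).coeff D = u.coeff D :=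
    fun r => ⟨by simpa using hu, coeff_taylor_of_natDegree_le hu r⟩
  have tv : ∀ r, (taylor r v).natDegree ≤ D ∧ (taylor r v).coeff D = v.coeff D :=
    fun r => ⟨by simpa using hv, coeff_taylor_of_natDegree_le hv r⟩
  have c1 := natDegree_coeff_mul (natDegree_coeff_mul (natDegree_coeff_mul
    (natDegree_coeff_affine_quad 1) (natDegree_coeff_pow (natDegree_coeff_linear (1 : ℚ) 2) 4))
    (tv 2)) (tv 1)
  have c2 := natDegree_coeff_mul (natDegree_coeff_mul natDegree_coeff_midCoeff (tu 2)) (tv 1)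
  have c16 : (C 16 : ℚ[X]).natDegree ≤ 0 ∧ (C 16 : ℚ[X]).coeff 0 = 16 := by simp
  have c3 := natDegree_coeff_mul (natDegree_coeff_mul (natDegree_coeff_mul (natDegree_coeff_mul c16
    (natDegree_coeff_affine_quad 3)) (natDegree_coeff_pow (natDegree_coeff_linear (2 : ℚ) 1) 4))
    (tu 2)) (tu 1)
  norm_num at c1 c2 c3
  -- Shifts do not change the coefficient in degree `D`, and each coefficient of the recurrence has
  -- degree at most `6`. Comparison in degree `6 + 2 D` gives the quadratic form in the coefficients
  -- of `X ^ D` in `v` and `u`; one of these is a leading coefficient.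
  have hk := congrArg (fun f : ℚ[X] => f.coeff (6 + D + D)) key
  simp only [coeff_add] at hk
  have hk' : 44 * v.coeff D * v.coeff D + 86592 * u.coeff D * v.coeff D
      + 11264 * u.coeff D * u.coeff D = 0 := by
    rw [← c1.2, ← c2.2, ← c3.2]
    simpa using hk
  have hy := sq_form_ne_zero hk'
  have hx : v.coeff D = 0 := by
    rw [hy] at hk'
    simpa using hk'
  rcases le_total u.natDegree v.natDegree with hle | hle
  · have hDv : D = v.natDegree := max_eq_right hle
    have hv0 : v = 0 := by rwa [hDv, coeff_natDegree, leadingCoeff_eq_zero] at hx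
    have : taylor 1 u = 0 := by
      refine exists_nat_eval_eq_zero (n₀ := n₀) fun n hn => ?_
      have h1 := h n hn
      have ha : (periodCoeff (n + 1) : ℚ) ≠ 0 := by exact_mod_cast (periodCoeff_pos _).ne'
      rw [hv0] at h1
      simpa [taylor_eval, ha] using h1
    exact (taylor_injective 1 (by rw [this, map_zero]))
  · have hDu : D = u.natDegree := max_eq_left hle
    rwa [hDu, coeff_natDegree, leadingCoeff_eq_zero] at hy

/-- The image of a polynomial under a linear map applied to its coefficients. -/
def mapCoeff (f : ℂ →ₗ[ℚ] ℚ) (u : ℂ[X]) : ℚ[X] :=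
  ∑ i ∈ Finset.range (u.natDegree + 1), monomial i (f (u.coeff i))

lemma coeff_mapCoeff (f : ℂ →ₗ[ℚ] ℚ) (u : ℂ[X]) (k : ℕ) :
    (mapCoeff f u).coeff k = f (u.coeff k) := by
  rw [mapCoeff, finsetSum_coeff]
  simp only [coeff_monomial, Finset.sum_ite_eq', Finset.mem_range]
  split_ifs with h
  · rfl
  · rw [coeff_eq_zero_of_natDegree_lt (by omega), map_zero]

lemma eval_mapCoeff (f : ℂ →ₗ[ℚ] ℚ) (u : ℂ[X]) (r : ℚ) :
    (mapCoeff f u).eval r = f (u.eval (r : ℂ)) := by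
  rw [mapCoeff, eval_finsetSum, eval_eq_sum_range, map_sum]
  refine Finset.sum_congr rfl fun i _ => ?_
  rw [eval_monomial, mul_comm (u.coeff i), mul_comm (f _), ← smul_eq_mul, ← map_smul]
  congr 1
  rw [Rat.smul_def]
  push_cast
  rfl

/-- The numbers `n` and `periodCoeff n` are rational, so every `ℚ`-linear functional on `ℂ`, applied
to the coefficients of `u` and `v`, preserves the relation and reduces it to the rational case. Such
functionals separate points. -/
theorem not_hypergeometric {u v : ℂ[X]} {n₀ : ℕ}
    (h : ∀ n : ℕ, n₀ ≤ n →
      u.eval ((n : ℂ) + 1) * periodCoeff (n + 1) + v.eval ((n : ℂ) + 1) * periodCoeff n = 0) :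
    u = 0 := by
  ext k
  rw [coeff_zero, ← Module.forall_dual_apply_eq_zero_iff ℚ]
  intro f
  rw [← coeff_mapCoeff f]
  have : mapCoeff f u = 0 := by
    refine rat_not_hypergeometric (v := mapCoeff f v) (n₀ := n₀) fun n hn => ?_
    have h1 := congrArg f (h n hn)
    rw [map_add, map_zero] at h1
    rw [eval_mapCoeff, eval_mapCoeff, mul_comm, mul_comm (f (eval _ v)), ← smul_eq_mul,
      ← smul_eq_mul, ← map_smul, ← map_smul, ← h1]
    congr 2 <;> · rw [Rat.smul_def, mul_comm]; push_cast; rfl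
  rw [this, coeff_zero]

/-! ### Differential operators and recurrences -/

/-- The coefficient of `φ ^ j` in an operator, as a polynomial in `Θ`. -/
def opCoeff (L : ℂ[X][X]) (j : ℕ) : ℂ[X] :=
  ∑ i ∈ Finset.range (L.natDegree + 1), monomial i ((L.coeff i).coeff j)

lemma coeff_opCoeff (L : ℂ[X][X]) (i j : ℕ) : (opCoeff L j).coeff i = (L.coeff i).coeff j := by
  rw [opCoeff, finsetSum_coeff]
  simp only [coeff_monomial, Finset.sum_ite_eq', Finset.mem_range]
  split_ifs with h
  · rfl
  · rw [coeff_eq_zero_of_natDegree_lt (p := L) (by omega), coeff_zero]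

lemma natDegree_opCoeff_le (L : ℂ[X][X]) (j : ℕ) : (opCoeff L j).natDegree ≤ L.natDegree := by
  refine natDegree_le_iff_coeff_eq_zero.2 fun i hi => ?_
  rw [coeff_opCoeff, coeff_eq_zero_of_natDegree_lt hi, coeff_zero]

/-- A bound for the degrees of the coefficients of an operator. -/
def opWidth (L : ℂ[X][X]) : ℕ :=
  (Finset.range (L.natDegree + 1)).sup (fun i => (L.coeff i).natDegree) + 1

lemma natDegree_coeff_lt_opWidth (L : ℂ[X][X]) (i : ℕ) : (L.coeff i).natDegree < opWidth L := by
  rcases lt_or_ge L.natDegree i with h | h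
  · rw [coeff_eq_zero_of_natDegree_lt h]; simp [opWidth]
  · exact Nat.lt_succ_of_le (Finset.le_sup (f := fun i => (L.coeff i).natDegree) (by simpa [Nat.lt_succ_iff] using h))

lemma opCoeff_eq_zero (L : ℂ[X][X]) {j : ℕ} (h : opWidth L ≤ j) : opCoeff L j = 0 := by
  ext i
  rw [coeff_opCoeff, coeff_zero,
    coeff_eq_zero_of_natDegree_lt ((natDegree_coeff_lt_opWidth L i).trans_le h)]

/-- The coefficient of `φ ^ N` of the result of applying an operator to `∑ cₙ φ ^ n`. -/
def opSeq (L : ℂ[X][X]) (c : ℕ → ℂ) (N : ℕ) : ℂ :=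
  ∑ j ∈ Finset.range (N + 1), (opCoeff L j).eval ((N - j : ℕ) : ℂ) * c (N - j)

lemma hasSum_shift {g : ℕ → ℂ} {s : ℂ} (h : HasSum g s) (j : ℕ) :
    HasSum (fun N => if j ≤ N then g (N - j) else 0) s := by
  rw [← (add_left_injective j).hasSum_iff]
  · simpa [Function.comp_def] using h
  · intro N hN
    rw [if_neg]
    intro hj
    exact hN ⟨N - j, Nat.sub_add_cancel hj⟩

/-- Termwise differentiation is justified by the summable majorant `‖c n‖ r ^ n` on a ball with `‖z‖
< r < ρ`. -/
lemma hasSum_euler {f : ℂ → ℂ} {c : ℕ → ℂ} {ρ : ℝ}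
    (h : ∀ z : ℂ, ‖z‖ < ρ → HasSum (fun n => c n * z ^ n) (f z)) {z : ℂ} (hz : ‖z‖ < ρ) :
    HasSum (fun n : ℕ => (n * c n) * z ^ n) (euler f z) := by
  obtain ⟨r, hr1, hr2⟩ := exists_between hz
  have hr0 : 0 ≤ r := (norm_nonneg z).trans hr1.le
  have hs : Summable fun n => ‖c n * (r : ℂ) ^ n‖ :=
    (h r (by rwa [Complex.norm_real, Real.norm_of_nonneg hr0])).summable.norm
  have hd := Complex.hasSum_deriv_of_summable_norm (F := fun n w => c n * w ^ n)
    (U := Metric.ball 0 r) (z := z) hs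
    (fun n => (differentiable_id.pow n).const_mul (c n) |>.differentiableOn) Metric.isOpen_ball
    (fun n w hw => by
      rw [norm_mul, norm_mul, norm_pow, norm_pow, Complex.norm_real, Real.norm_of_nonneg hr0]
      gcongr
      exact (mem_ball_zero_iff.1 hw).le) (by simpa using hr1)
  have he : (fun w => ∑' n, c n * w ^ n) =ᶠ[𝓝 z] f := by
    filter_upwards [Metric.isOpen_ball.mem_nhds
      (show z ∈ Metric.ball (0 : ℂ) ρ by simpa using hz)] with w hw
    exact (h w (by simpa using hw)).tsum_eq
  rw [he.deriv_eq] at hd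
  refine (congrArg (fun g => HasSum g _) (funext fun n => ?_)).mpr (hd.mul_left z)
  rw [deriv_const_mul_field, deriv_pow_field]
  rcases n with _ | n
  · simp
  · simp; ring

lemma hasSum_iterate_euler {f : ℂ → ℂ} {c : ℕ → ℂ} {ρ : ℝ}
    (h : ∀ z : ℂ, ‖z‖ < ρ → HasSum (fun n => c n * z ^ n) (f z)) (i : ℕ) :
    ∀ z : ℂ, ‖z‖ < ρ → HasSum (fun n : ℕ => ((n : ℂ) ^ i * c n) * z ^ n) ((euler^[i] f) z) := by
  induction i with
  | zero => simpa using h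
  | succ i ih =>
    intro z hz
    rw [Function.iterate_succ_apply']
    have := hasSum_euler ih hz
    simpa only [pow_succ', mul_assoc] using this

lemma hasSum_applyOp {f : ℂ → ℂ} {c : ℕ → ℂ} {ρ : ℝ}
    (h : ∀ z : ℂ, ‖z‖ < ρ → HasSum (fun n => c n * z ^ n) (f z)) (L : ℂ[X][X]) {z : ℂ}
    (hz : ‖z‖ < ρ) : HasSum (fun N => opSeq L c N * z ^ N) (applyOp L f z) := by
  have h1 : ∀ i j : ℕ, HasSum (fun N => if j ≤ N then (L.coeff i).coeff j * z ^ j *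
      ((((N - j : ℕ) : ℂ) ^ i * c (N - j)) * z ^ (N - j)) else 0)
      ((L.coeff i).coeff j * z ^ j * (euler^[i] f) z) := fun i j =>
    hasSum_shift ((hasSum_iterate_euler h i z hz).mul_left _) j
  have h2 := hasSum_sum fun j (_ : j ∈ Finset.range (opWidth L)) =>
    hasSum_sum fun i (_ : i ∈ Finset.range (L.natDegree + 1)) => h1 i j
  have h3 : applyOp L f z = ∑ j ∈ Finset.range (opWidth L), ∑ i ∈ Finset.range (L.natDegree + 1),
      (L.coeff i).coeff j * z ^ j * (euler^[i] f) z := by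
    rw [applyOp, Finset.sum_comm, L.sum_over_range (by simp)]
    refine Finset.sum_congr rfl fun i _ => ?_
    rw [← Finset.sum_mul, eval_eq_sum_range' (natDegree_coeff_lt_opWidth L i)]
  rw [h3]
  convert h2 using 1
  funext N
  -- The sum over `j ≤ N` and the sum over `j < opWidth L` agree: beyond the width the operator has
  -- no coefficients, and terms with `j > N` are set to zero.
  have h4 : opSeq L c N = ∑ j ∈ Finset.range (opWidth L), if j ≤ N then
      (opCoeff L j).eval ((N - j : ℕ) : ℂ) * c (N - j) else 0 := by
    rw [opSeq]
    have e : ∀ j ∈ Finset.range (N + 1), (opCoeff L j).eval ((N - j : ℕ) : ℂ) * c (N - j) =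
        if j ≤ N then (opCoeff L j).eval ((N - j : ℕ) : ℂ) * c (N - j) else 0 := fun j hj => by
      rw [if_pos (by simpa [Nat.lt_succ_iff] using hj)]
    rw [Finset.sum_congr rfl e]
    rcases le_total (N + 1) (opWidth L) with hle | hle
    · refine Finset.sum_subset (Finset.range_mono hle) fun j _ hj => if_neg ?_
      simpa [Nat.lt_succ_iff] using hj
    · refine (Finset.sum_subset (Finset.range_mono hle) fun j _ hj => ?_).symm
      rw [opCoeff_eq_zero L (by simpa using hj)]
      simp
  rw [h4, Finset.sum_mul]
  refine Finset.sum_congr rfl fun j _ => ?_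
  split_ifs with hj
  · rw [eval_eq_sum_range' (Nat.lt_succ_of_le (natDegree_opCoeff_le L j)), Finset.sum_mul,
      Finset.sum_mul]
    refine Finset.sum_congr rfl fun i _ => ?_
    rw [coeff_opCoeff, ← Nat.sub_add_cancel hj, pow_add]
    simp only [Nat.add_sub_cancel]
    ring
  · simp

/-- Uniqueness of power series expansions. -/
lemma eq_zero_of_hasSum_pow {c : ℕ → ℂ} {F : ℂ → ℂ} {ρ : ℝ} (hρ : 0 < ρ)
    (h : ∀ z : ℂ, ‖z‖ < ρ → HasSum (fun n => c n * z ^ n) (F z)) (hF : ∀ᶠ z in 𝓝 (0 : ℂ), F z = 0)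
    (n : ℕ) : c n = 0 := by
  have hp : HasFPowerSeriesOnBall F (FormalMultilinearSeries.ofScalars ℂ c) 0 (ENNReal.ofReal ρ) := by
    refine ⟨?_, by simpa using hρ, fun {y} hy => ?_⟩
    · refine ENNReal.le_of_forall_nnreal_lt fun r hr => ?_
      refine FormalMultilinearSeries.le_radius_of_summable_norm _ ?_
      have hr' : (r : ℝ) < ρ := by
        rwa [ENNReal.coe_lt_ofReal] at hr
      have := (h (r : ℝ) (by simpa using hr')).summable.norm
      simpa [FormalMultilinearSeries.ofScalars_norm] using this
    · have hy' : ‖y‖ < ρ := by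
        rw [Metric.mem_eball, edist_zero_right, ← ofReal_norm, ENNReal.ofReal_lt_ofReal_iff hρ] at hy
        exact hy
      simpa [FormalMultilinearSeries.ofScalars_apply_eq, mul_comm] using h y hy'
  have := hp.hasFPowerSeriesAt.eq_zero_of_eventually hF
  have h2 := congrFun this n
  exact (FormalMultilinearSeries.ofScalars_eq_zero (E := ℂ) n).1 h2

/-! ### No operator of order less than four annihilates the period -/

lemma periodCoeff_recurrence_complex (n : ℕ) :
    aperyQuad (2 * (n : ℂ) + 1) * (n + 2) ^ 4 * periodCoeff (n + 2)
      - midCoeff ((n : ℂ) + 1) * periodCoeff (n + 1)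
      + 16 * aperyQuad (2 * (n : ℂ) + 3) * (2 * n + 1) ^ 4 * periodCoeff n = 0 := by
  have := periodCoeff_recurrence n
  simp only [midCoeff, aperyQuad] at this ⊢
  exact_mod_cast this

lemma aperyQuad_intCast_ne_zero (n : ℤ) : aperyQuad (n : ℂ) ≠ 0 := by
  have h : aperyQuad (n : ℂ) = ((aperyQuad n : ℤ) : ℂ) := by simp [aperyQuad]
  have h2 : 0 < aperyQuad n := by
    rw [aperyQuad]
    rcases le_or_gt 0 n with h | h <;> nlinarith
  rw [h]
  exact_mod_cast h2.ne'

lemma eval_aperyQuad (u : ℂ[X]) (x : ℂ) : (aperyQuad u).eval x = aperyQuad (u.eval x) := by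
  simp [aperyQuad]

lemma eval_midCoeff (u : ℂ[X]) (x : ℂ) : (midCoeff u).eval x = midCoeff (u.eval x) := by
  simp [midCoeff, eval_aperyQuad]

/-- `c (n - j)` expressed in terms of `c n` and `c (n - 1)` by means of the recurrence. -/
lemma exists_backward (j : ℕ) : ∃ G U V : ℂ[X], G.eval 0 ≠ 0 ∧ ∀ n : ℕ,
    G.eval ((n : ℂ) + (j + 1)) * periodCoeff n =
      ((n : ℂ) + (j + 1)) ^ 4 * U.eval ((n : ℂ) + (j + 1)) * periodCoeff (n + (j + 1))
        + V.eval ((n : ℂ) + (j + 1)) * periodCoeff (n + j) := by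
  induction j using Nat.strong_induction_on with
  | _ j ih =>
    match j, ih with
    | 0, _ => exact ⟨1, 0, 1, by simp, by simp⟩
    | 1, _ =>
      -- This is the recurrence itself, in the variable `x = n + 2`; its top coefficient supplies
      -- the factor `x ^ 4`. At `x = 0` the factors of `G` are values of `aperyQuad` at an integer
      -- and powers of odd numbers, hence nonzero.
      refine ⟨16 * aperyQuad (2 * X - 1) * (2 * X - 3) ^ 4, - aperyQuad (2 * X - 3),
        midCoeff (X - 1), ?_, fun n => ?_⟩
      · have := aperyQuad_intCast_ne_zero (-1)
        simp only [aperyQuad] at this ⊢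
        norm_num at this ⊢
      · have h := periodCoeff_recurrence_complex n
        simp only [midCoeff, aperyQuad, eval_mul, eval_add, eval_pow, eval_X, eval_sub, eval_one,
          eval_ofNat, eval_neg] at h ⊢
        push_cast
        rw [show n + (1 + 1) = n + 2 by ring]
        linear_combination h
    | j + 2, ih =>
      obtain ⟨G₁, U₁, V₁, hG₁, h₁⟩ := ih j (by omega)
      obtain ⟨G₂, U₂, V₂, hG₂, h₂⟩ := ih (j + 1) (by omega)
      have hc : ∀ n : ℕ, (n : ℂ) + ((j + 2 : ℕ) + 1) = n + (j + 3) := fun n => by push_cast; ring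
      -- Put `x = n + j + 3`. The recurrence expresses `a n` by `a (n + 1)` and `a (n + 2)`, and the
      -- induction hypotheses express both of these by `a (n + j + 3)` and `a (n + j + 2)` with the
      -- same `x`; the factor `x ^ 4` at the top term is inherited from both.
      refine ⟨16 * aperyQuad (2 * X - C (2 * j + 3 : ℂ)) * (2 * X - C (2 * j + 5 : ℂ)) ^ 4 * G₁ * G₂,
        midCoeff (X - C (j + 2 : ℂ)) * G₁ * U₂
          - aperyQuad (2 * X - C (2 * j + 5 : ℂ)) * (X - C (j + 1 : ℂ)) ^ 4 * G₂ * U₁,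
        midCoeff (X - C (j + 2 : ℂ)) * G₁ * V₂
          - aperyQuad (2 * X - C (2 * j + 5 : ℂ)) * (X - C (j + 1 : ℂ)) ^ 4 * G₂ * V₁, ?_,
        fun n => ?_⟩
      · have h3 := aperyQuad_intCast_ne_zero (-(2 * j + 3))
        have h4 : (-(2 * j + 5 : ℂ)) ^ 4 ≠ 0 := by
          refine pow_ne_zero 4 (neg_ne_zero.2 ?_)
          exact_mod_cast (show 2 * j + 5 ≠ 0 by omega)
        simp only [aperyQuad, eval_mul, eval_add, eval_pow, eval_X, eval_sub, eval_C,
          eval_ofNat, mul_zero, zero_sub] at h3 h4 ⊢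
        push_cast at h3
        exact mul_ne_zero (mul_ne_zero (mul_ne_zero (mul_ne_zero (by norm_num) h3) h4) hG₁) hG₂
      · have h := periodCoeff_recurrence_complex n
        have h1 := h₁ (n + 2)
        have h2 := h₂ (n + 1)
        rw [hc]
        rw [show ((n + 2 : ℕ) : ℂ) + (j + 1) = n + (j + 3) by push_cast; ring,
          show n + 2 + (j + 1) = n + (j + 3) by ring,
          show n + 2 + j = n + (j + 2) by ring] at h1
        rw [show ((n + 1 : ℕ) : ℂ) + ((j + 1 : ℕ) + 1) = n + (j + 3) by push_cast; ring,
          show n + 1 + (j + 1 + 1) = n + (j + 3) by ring,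
          show n + 1 + (j + 1) = n + (j + 2) by ring] at h2
        rw [show n + (j + 2 + 1) = n + (j + 3) by ring]
        generalize hx : (n : ℂ) + (j + 3) = x at *
        simp only [eval_mul, eval_pow, eval_X, eval_sub, eval_C, eval_ofNat, eval_aperyQuad,
          eval_midCoeff]
        rw [show 2 * x - (2 * j + 3) = 2 * n + 3 by rw [← hx]; ring,
          show 2 * x - (2 * j + 5) = 2 * n + 1 by rw [← hx]; ring,
          show x - (j + 2) = n + 1 by rw [← hx]; ring,
          show x - (j + 1) = n + 2 by rw [← hx]; ring]
        linear_combination G₁.eval x * G₂.eval x * h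
          - aperyQuad (2 * (n : ℂ) + 1) * (n + 2) ^ 4 * G₂.eval x * h1
          + midCoeff ((n : ℂ) + 1) * G₁.eval x * h2

/-- All lower terms of a recurrence are collected into `a (n + 1)` and `a n` over a common
denominator. What matters later is that the denominator does not vanish at `n + 1 = 0`, whereas the
coefficient of `a (n + 1)` vanishes there to order four. -/
lemma exists_backward_sum (m : ℕ → ℂ[X]) (D : ℕ) : ∃ G U V : ℂ[X], G.eval 0 ≠ 0 ∧
    ∀ n : ℕ, D ≤ n → G.eval ((n : ℂ) + 1) * (∑ j ∈ Finset.range D,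
        (m j).eval ((n - j : ℕ) : ℂ) * periodCoeff (n - j)) =
      ((n : ℂ) + 1) ^ 4 * U.eval ((n : ℂ) + 1) * periodCoeff (n + 1)
        + V.eval ((n : ℂ) + 1) * periodCoeff n := by
  induction D with
  | zero => exact ⟨1, 0, 0, by simp, by simp⟩
  | succ D ih =>
    obtain ⟨G₁, U₁, V₁, hG₁, h₁⟩ := ih
    obtain ⟨G₂, U₂, V₂, hG₂, h₂⟩ := exists_backward D
    refine ⟨G₁ * G₂, G₂ * U₁ + (m D).comp (X - C (D + 1 : ℂ)) * G₁ * U₂,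
      G₂ * V₁ + (m D).comp (X - C (D + 1 : ℂ)) * G₁ * V₂, by simp [hG₁, hG₂], fun n hn => ?_⟩
    obtain ⟨k, rfl⟩ : ∃ k, n = k + D := ⟨n - D, by omega⟩
    have h1 := h₁ (k + D) (by omega)
    have h2 := h₂ k
    rw [show k + (D + 1) = k + D + 1 by ring,
      show (k : ℂ) + (D + 1) = ((k + D : ℕ) : ℂ) + 1 by push_cast; ring] at h2
    rw [Finset.sum_range_succ]
    simp only [eval_mul, eval_add, eval_comp, eval_sub, eval_X, eval_C, Nat.add_sub_cancel]
    rw [show ((k + D : ℕ) : ℂ) + 1 - (D + 1) = k by push_cast; ring]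
    generalize ((k + D : ℕ) : ℂ) + 1 = x at *
    linear_combination G₂.eval x * h1 + (m D).eval (k : ℂ) * G₁.eval x * h2

/-- After the reduction the recurrence reads `(G m₀ + X ^ 4 U) a (n + 1) + V a n = 0` at `X = n +
1`. Since the sequence is not hypergeometric, `G m₀ = -X ^ 4 U`, and `G` is prime to `X`. -/
lemma X_pow_four_dvd_of_recurrence {m : ℕ → ℂ[X]} {D n₀ : ℕ}
    (h : ∀ n : ℕ, n₀ ≤ n → ∑ j ∈ Finset.range (D + 1),
      (m j).eval ((n - j : ℕ) : ℂ) * periodCoeff (n - j) = 0) : X ^ 4 ∣ m 0 := by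
  obtain ⟨G, U, V, hG, hGUV⟩ := exists_backward_sum (fun j => m (j + 1)) D
  have key : G * m 0 + X ^ 4 * U = 0 := by
    refine not_hypergeometric (v := V) (n₀ := max n₀ D) fun n hn => ?_
    have h1 := h (n + 1) (by omega)
    have h2 := hGUV n (by omega)
    rw [Finset.sum_range_succ'] at h1
    simp only [Nat.add_sub_add_right, Nat.sub_zero] at h1
    push_cast at h1
    simp only [eval_add, eval_mul, eval_pow, eval_X]
    linear_combination G.eval ((n : ℂ) + 1) * h1 - h2
  have hdvd : X ^ 4 ∣ m 0 * G := ⟨-U, by linear_combination key⟩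
  refine IsCoprime.dvd_of_dvd_mul_right (IsCoprime.pow_left ?_) hdvd
  refine (prime_X.irreducible.coprime_iff_not_dvd).2 fun hX => hG ?_
  rwa [X_dvd_iff, coeff_zero_eq_eval_zero] at hX

/-- Every nonzero operator whose associated recurrence annihilates the coefficients of the period
has order at least four. -/
theorem four_le_natDegree_of_opSeq {L : ℂ[X][X]} (hL : L ≠ 0)
    (h : ∀ N, opSeq L (fun n => (periodCoeff n : ℂ)) N = 0) : 4 ≤ L.natDegree := by
  classical
  have hex : ∃ j, opCoeff L j ≠ 0 := by
    by_contra! hall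
    apply hL
    ext i j
    rw [← coeff_opCoeff, hall j]
    simp
  -- `j₀` is the lowest power of `φ` in the operator; after division by `φ ^ j₀` the coefficient `m
  -- 0` of the previous lemma is nonzero, so divisibility by `X ^ 4` bounds its degree from below.
  set j₀ := Nat.find hex with hj₀
  have hne : opCoeff L j₀ ≠ 0 := Nat.find_spec hex
  have hmin : ∀ j < j₀, opCoeff L j = 0 := fun j hj => by
    simpa using Nat.find_min hex hj
  have hdvd : X ^ 4 ∣ opCoeff L (j₀ + 0) := by
    refine X_pow_four_dvd_of_recurrence (m := fun j => opCoeff L (j₀ + j)) (D := opWidth L)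
      (n₀ := opWidth L) fun n hn => ?_
    have h1 := h (j₀ + n)
    rw [opSeq, show j₀ + n + 1 = j₀ + (n + 1) by ring, Finset.sum_range_add,
      Finset.sum_eq_zero (s := Finset.range j₀), zero_add] at h1
    · rw [← h1]
      refine (Finset.sum_subset (Finset.range_mono
        (show opWidth L + 1 ≤ n + 1 by omega)) fun j _ hj => ?_).trans ?_
      · rw [opCoeff_eq_zero L (j := j₀ + j) (by simp at hj; omega)]
        simp
      · refine Finset.sum_congr rfl fun j _ => ?_
        rw [Nat.add_sub_add_left]
    · intro j hj
      rw [hmin j (by simpa using hj)]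
      simp
  have := natDegree_le_of_dvd hdvd hne
  rw [natDegree_X_pow] at this
  exact this.trans (natDegree_opCoeff_le L _)

/-! ### The operator of the period -/

/-- A polynomial of degree at most four. -/
def quartic (a b c d e : ℂ) : ℂ[X] := C a + C b * X + C c * X ^ 2 + C d * X ^ 3 + C e * X ^ 4

lemma coeff_quartic (a b c d e : ℂ) (j : ℕ) : (quartic a b c d e).coeff j =
    match j with
    | 0 => a
    | 1 => b
    | 2 => c
    | 3 => d
    | 4 => e
    | _ => 0 := by
  match j with
  | 0 => simp [quartic]
  | 1 => simp [quartic]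
  | 2 => simp [quartic]
  | 3 => simp [quartic]
  | 4 => simp [quartic]
  | k + 5 => simp [quartic]

lemma operatorD5_eq : operatorD5 =
    monomial 0 (quartic 0 (-4 * 19) (-16 * 177) (-1024 * 3) 4096)
    + monomial 1 (quartic 0 (-4 * 189) (-16 * 1164) (-1024 * 6) (4096 * 8))
    + monomial 2 (quartic 0 (-4 * 677) (-16 * 1336) (1024 * 37) (4096 * 24))
    + monomial 3 (quartic 0 (-4 * 976) (16 * 3968) (-1024 * 24) (4096 * 32))
    + monomial 4 (quartic 1 (-4 * 500) (16 * 3968) (-1024 * 500) (4096 * 16)) := by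
  simp only [operatorD5, quartic, ← C_mul_X_pow_eq_monomial, map_add, map_mul, map_pow, map_neg,
    map_ofNat, map_one, map_zero]
  ring

lemma natDegree_operatorD5_le : operatorD5.natDegree ≤ 4 := by
  rw [operatorD5_eq]
  refine natDegree_add_le_of_degree_le (natDegree_add_le_of_degree_le (natDegree_add_le_of_degree_le
    (natDegree_add_le_of_degree_le ?_ ?_) ?_) ?_) ?_ <;>
  exact (natDegree_monomial_le _).trans (by norm_num)

lemma operatorD5_ne_zero : operatorD5 ≠ 0 := by
  intro h
  have h1 := congrArg (fun L : ℂ[X][X] => (L.coeff 4).coeff 0) h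
  rw [operatorD5_eq] at h1
  simp [coeff_monomial, coeff_quartic] at h1

lemma opCoeff_add (L M : ℂ[X][X]) (j : ℕ) : opCoeff (L + M) j = opCoeff L j + opCoeff M j := by
  ext i; simp [coeff_opCoeff]

lemma opCoeff_monomial (i j : ℕ) (p : ℂ[X]) :
    opCoeff (monomial i p) j = monomial i (p.coeff j) := by
  ext k
  rw [coeff_opCoeff, coeff_monomial, coeff_monomial]
  split_ifs <;> simp

/-- The value at `x` of the coefficient of `φ ^ j` in `operatorD5`. -/
lemma eval_opCoeff_operatorD5 (x : ℂ) (j : ℕ) : (opCoeff operatorD5 j).eval x =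
    match j with
    | 0 => x ^ 4
    | 1 => -4 * (500 * x ^ 4 + 976 * x ^ 3 + 677 * x ^ 2 + 189 * x + 19)
    | 2 => 16 * (3968 * x ^ 4 + 3968 * x ^ 3 - 1336 * x ^ 2 - 1164 * x - 177)
    | 3 => -1024 * (500 * x ^ 4 + 24 * x ^ 3 - 37 * x ^ 2 + 6 * x + 3)
    | 4 => 4096 * (2 * x + 1) ^ 4
    | _ => 0 := by
  rw [operatorD5_eq]
  simp only [opCoeff_add, opCoeff_monomial, coeff_quartic, eval_add, eval_monomial]
  split <;> ring

/-- The recurrence of order four given by the operator. -/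
lemma periodCoeff_recurrence_four (n : ℕ) :
    ((n : ℂ) + 4) ^ 4 * periodCoeff (n + 4)
      - 4 * (500 * ((n : ℂ) + 3) ^ 4 + 976 * (n + 3) ^ 3 + 677 * (n + 3) ^ 2 + 189 * (n + 3) + 19)
        * periodCoeff (n + 3)
      + 16 * (3968 * ((n : ℂ) + 2) ^ 4 + 3968 * (n + 2) ^ 3 - 1336 * (n + 2) ^ 2
        - 1164 * (n + 2) - 177) * periodCoeff (n + 2)
      - 1024 * (500 * ((n : ℂ) + 1) ^ 4 + 24 * (n + 1) ^ 3 - 37 * (n + 1) ^ 2 + 6 * (n + 1) + 3)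
        * periodCoeff (n + 1)
      + 4096 * (2 * (n : ℂ) + 1) ^ 4 * periodCoeff n = 0 := by
  have h0 := periodCoeff_recurrence_complex n
  have h1 := periodCoeff_recurrence_complex (n + 1)
  have h2 := periodCoeff_recurrence_complex (n + 2)
  have p3 := aperyQuad_intCast_ne_zero (2 * n + 3)
  have p5 := aperyQuad_intCast_ne_zero (2 * n + 5)
  push_cast at *
  apply mul_left_cancel₀ (mul_ne_zero p3 p5)
  rw [mul_zero]
  rw [show n + 1 + 2 = n + 3 by ring, show n + 1 + 1 = n + 2 by ring] at h1
  rw [show n + 2 + 2 = n + 4 by ring, show n + 2 + 1 = n + 3 by ring] at h2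
  simp only [aperyQuad, midCoeff] at *
  -- The left factor of the recurrence of order two. Its outer multipliers are dictated by the first
  -- and last terms of the recurrence of order four, multiplied by the nonzero `aperyQuad (2 n + 3)
  -- * aperyQuad (2 n + 5)`.
  linear_combination (11 * (2 * (n : ℂ) + 3) ^ 2 + 11 * (2 * n + 3) + 3) * h2
    + (960 - 704 * ((n : ℂ) + 2) - 1408 * (n + 2) ^ 2) * h1
    + 256 * (11 * (2 * (n : ℂ) + 5) ^ 2 + 11 * (2 * n + 5) + 3) * h0

lemma periodCoeff_zero : periodCoeff 0 = 1 := by rfl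

lemma periodCoeff_one : periodCoeff 1 = 76 := by rfl

lemma periodCoeff_two : periodCoeff 2 = 45036 := by rfl

lemma periodCoeff_three : periodCoeff 3 = 41983600 := by rfl

theorem opSeq_operatorD5 (N : ℕ) : opSeq operatorD5 (fun n => (periodCoeff n : ℂ)) N = 0 := by
  match N with
  -- For `N < 4` the recurrence is truncated at index `0` and is not an instance of the general one,
  -- so it is verified on the first four coefficients.
  | 0 => simp [opSeq, eval_opCoeff_operatorD5]
  | 1 =>
    simp [opSeq, Finset.sum_range_succ, eval_opCoeff_operatorD5, periodCoeff_zero, periodCoeff_one]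
    norm_num
  | 2 =>
    simp [opSeq, Finset.sum_range_succ, eval_opCoeff_operatorD5, periodCoeff_zero, periodCoeff_one,
      periodCoeff_two]
    norm_num
  | 3 =>
    simp [opSeq, Finset.sum_range_succ, eval_opCoeff_operatorD5, periodCoeff_zero, periodCoeff_one,
      periodCoeff_two, periodCoeff_three]
    norm_num
  | n + 4 =>
    rw [opSeq, show n + 4 + 1 = 5 + n by ring, Finset.sum_range_add]
    rw [Finset.sum_eq_zero (s := Finset.range n) fun j _ => ?_]
    · simp only [Finset.sum_range_succ, Finset.sum_range_zero, eval_opCoeff_operatorD5]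
      have h := periodCoeff_recurrence_four n
      simp only [Nat.sub_zero, show n + 4 - 1 = n + 3 by omega, show n + 4 - 2 = n + 2 by omega,
        show n + 4 - 3 = n + 1 by omega, show n + 4 - 4 = n by omega]
      push_cast
      linear_combination h
    · rw [add_comm 5 j, eval_opCoeff_operatorD5]
      simp

/-- A function with the power series `∑ periodCoeff n * φ ^ n` near `0` has the Picard–Fuchs
operator `operatorD5`. -/
theorem isPicardFuchsOperator_operatorD5 {Φ : ℂ → ℂ} {ρ : ℝ} (hρ : 0 < ρ)
    (h : ∀ φ : ℂ, ‖φ‖ < ρ → HasSum (fun n : ℕ => (periodCoeff n : ℂ) * φ ^ n) (Φ φ)) :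
    IsPicardFuchsOperator operatorD5 Φ := by
  have hball : ∀ᶠ z in 𝓝 (0 : ℂ), ‖z‖ < ρ := by
    filter_upwards [Metric.ball_mem_nhds (0 : ℂ) hρ] with z hz using by simpa using hz
  refine ⟨operatorD5_ne_zero, ?_, fun M hM hMz => natDegree_operatorD5_le.trans ?_⟩
  · filter_upwards [hball] with z hz
    have h1 := hasSum_applyOp (c := fun n => (periodCoeff n : ℂ)) h operatorD5 hz
    simp only [opSeq_operatorD5, zero_mul] at h1
    exact h1.unique hasSum_zero
  · exact four_le_natDegree_of_opSeq hM (eq_zero_of_hasSum_pow hρ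
      (fun z hz => hasSum_applyOp (c := fun n => (periodCoeff n : ℂ)) h M hz) hMz)

/-! ### The pfaffians of the mirror family -/

lemma pfaffian_two {A : Matrix (Fin (1 + 1)) (Fin (1 + 1)) ℂ} (hA : A.transpose = -A) :
    pfaffian (r := 1) A = A 0 1 := by
  have h : A 1 0 = - A 0 1 := congrFun (congrFun hA 0) 1
  rw [pfaffian, show (Finset.univ : Finset (Equiv.Perm (Fin (1 + 1)))) = {1, Equiv.swap 0 1} by decide,
    Finset.sum_pair (by decide)]
  simp [Fin.natAdd, Fin.castAdd]
  rw [h]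
  ring

/-- The signs and the values of the permutations of four elements. -/
lemma univ_perm_four : (Finset.univ : Finset (Equiv.Perm (Fin (2 + 2)))).val.map
      (fun σ => ((Equiv.Perm.sign σ : ℤ), σ 0, σ 1, σ 2, σ 3)) =
    {(1, 0, 1, 2, 3), (-1, 0, 1, 3, 2), (-1, 0, 2, 1, 3), (1, 0, 2, 3, 1), (1, 0, 3, 1, 2),
      (-1, 0, 3, 2, 1), (-1, 1, 0, 2, 3), (1, 1, 0, 3, 2), (1, 1, 2, 0, 3), (-1, 1, 2, 3, 0),
      (-1, 1, 3, 0, 2), (1, 1, 3, 2, 0), (1, 2, 0, 1, 3), (-1, 2, 0, 3, 1), (-1, 2, 1, 0, 3),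
      (1, 2, 1, 3, 0), (1, 2, 3, 0, 1), (-1, 2, 3, 1, 0), (-1, 3, 0, 1, 2), (1, 3, 0, 2, 1),
      (1, 3, 1, 0, 2), (-1, 3, 1, 2, 0), (-1, 3, 2, 0, 1), (1, 3, 2, 1, 0)} := by
  decide +kernel

/-- The 24 permutations give each of the three perfect matchings eight times, which cancels `2! 2²`.
The convention pairs `σ(i)` with `σ(r + i)`, so the identity contributes `A 0 2 * A 1 3` with a plus
sign: the result is the negative of the usual pfaffian. -/
lemma pfaffian_four {A : Matrix (Fin (2 + 2)) (Fin (2 + 2)) ℂ} (hA : A.transpose = -A) :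
    pfaffian (r := 2) A = -(A 0 1 * A 2 3 - A 0 2 * A 1 3 + A 0 3 * A 1 2) := by
  have h : ∀ i j, A i j = - A j i := fun i j => congrFun (congrFun hA j) i
  have e : ∑ σ : Equiv.Perm (Fin (2 + 2)), ((Equiv.Perm.sign σ : ℤ) : ℂ) *
      ∏ i : Fin 2, A (σ (Fin.castAdd 2 i)) (σ (Fin.natAdd 2 i)) =
      (((Finset.univ : Finset (Equiv.Perm (Fin (2 + 2)))).val.map
        (fun σ => ((Equiv.Perm.sign σ : ℤ), σ 0, σ 1, σ 2, σ 3))).map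
        fun p : ℤ × Fin (2 + 2) × Fin (2 + 2) × Fin (2 + 2) × Fin (2 + 2) =>
          (p.1 : ℂ) * (A p.2.1 p.2.2.2.1 * A p.2.2.1 p.2.2.2.2)).sum := by
    rw [Multiset.map_map]
    refine Finset.sum_congr rfl fun σ _ => ?_
    rw [Fin.prod_univ_two]
    rfl
  rw [pfaffian, e, univ_perm_four]
  simp only [Multiset.insert_eq_cons, Multiset.map_cons, Multiset.sum_cons, Multiset.map_singleton,
    Multiset.sum_singleton, Nat.factorial]
  rw [h 1 0, h 2 0, h 3 0, h 2 1, h 3 1, h 3 2]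
  push_cast
  ring

lemma mirrorMatrix_transpose (t : ℂ) (x : Fin 7 → ℂ) :
    (mirrorMatrix t x).transpose = - mirrorMatrix t x := by
  ext i j
  fin_cases i <;> fin_cases j <;> simp [mirrorMatrix]

lemma subPfaffian_eq (t : ℂ) (x : Fin 7 → ℂ) (i : Fin 5) : subPfaffian t x i =
    -(mirrorMatrix t x (i.succAbove 0) (i.succAbove 1) * mirrorMatrix t x (i.succAbove 2) (i.succAbove 3)
     - mirrorMatrix t x (i.succAbove 0) (i.succAbove 2) * mirrorMatrix t x (i.succAbove 1) (i.succAbove 3)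
     + mirrorMatrix t x (i.succAbove 0) (i.succAbove 3) * mirrorMatrix t x (i.succAbove 1) (i.succAbove 2)) := by
  rw [subPfaffian, pfaffian_four]
  · rfl
  · rw [Matrix.transpose_submatrix, mirrorMatrix_transpose]; rfl

lemma subPfaffian_zero (t : ℂ) (x : Fin 7 → ℂ) : subPfaffian t x 0 =
    x 5 * x 6 - t ^ 2 * x 4 * (x 0 ^ 2 + x 1 ^ 2) - t * x 2 * x 3 * (x 2 ^ 2 + x 3 ^ 2) := by
  rw [subPfaffian_eq]
  change -(t * (x 0 ^ 2 + x 1 ^ 2) * (t * x 4) - x 5 * x 6 + x 2 * x 3 * (t * (x 2 ^ 2 + x 3 ^ 2))) = _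
  ring

lemma subPfaffian_one (t : ℂ) (x : Fin 7 → ℂ) : subPfaffian t x 1 =
    x 0 * x 1 * x 6 - t * x 4 ^ 2 - t ^ 2 * x 5 * (x 2 ^ 2 + x 3 ^ 2) := by
  rw [subPfaffian_eq]
  change -(x 4 * (t * x 4) - x 0 * x 1 * x 6 + t * x 5 * (t * (x 2 ^ 2 + x 3 ^ 2))) = _
  ring

lemma subPfaffian_two (t : ℂ) (x : Fin 7 → ℂ) : subPfaffian t x 2 =
    x 0 * x 1 * x 2 * x 3 - t ^ 2 * x 6 * x 4 - t * x 5 ^ 2 := by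
  rw [subPfaffian_eq]
  change -(t * x 6 * (t * x 4) - x 0 * x 1 * (x 2 * x 3) + t * x 5 * x 5) = _
  ring

lemma subPfaffian_three (t : ℂ) (x : Fin 7 → ℂ) : subPfaffian t x 3 =
    x 4 * x 2 * x 3 - t * x 6 ^ 2 - t ^ 2 * x 5 * (x 0 ^ 2 + x 1 ^ 2) := by
  rw [subPfaffian_eq]
  change -(t * x 6 * x 6 - x 4 * (x 2 * x 3) + t * x 5 * (t * (x 0 ^ 2 + x 1 ^ 2))) = _
  ring

lemma subPfaffian_four (t : ℂ) (x : Fin 7 → ℂ) : subPfaffian t x 4 =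
    x 4 * x 5 - t ^ 2 * x 6 * (x 2 ^ 2 + x 3 ^ 2) - t * x 0 * x 1 * (x 0 ^ 2 + x 1 ^ 2) := by
  rw [subPfaffian_eq]
  change -(t * x 6 * (t * (x 2 ^ 2 + x 3 ^ 2)) - x 4 * x 5 + x 0 * x 1 * (t * (x 0 ^ 2 + x 1 ^ 2))) = _
  ring

lemma subPfaffian245_eq (t : ℂ) (x : Fin 7 → ℂ) : subPfaffian245 t x = x 4 := by
  rw [subPfaffian245, pfaffian_two]
  · rfl
  · rw [Matrix.transpose_submatrix, mirrorMatrix_transpose]; rfl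


/-! ### Points of the fibres in the chart `x₀ = 1` -/

lemma subPfaffian_weighted (t c : ℂ) {x y : Fin 7 → ℂ} (h : ∀ i, y i = c ^ weight i * x i)
    (i : Fin 5) : subPfaffian t y i = c ^ 4 * subPfaffian t x i := by
  have h0 : y 0 = c * x 0 := by simpa [weight] using h 0
  have h1 : y 1 = c * x 1 := by simpa [weight] using h 1
  have h2 : y 2 = c * x 2 := by simpa [weight] using h 2
  have h3 : y 3 = c * x 3 := by simpa [weight] using h 3
  have h4 : y 4 = c ^ 2 * x 4 := by simpa [weight] using h 4
  have h5 : y 5 = c ^ 2 * x 5 := by simpa [weight] using h 5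
  have h6 : y 6 = c ^ 2 * x 6 := by simpa [weight] using h 6
  fin_cases i
  · simp only [Fin.mk_zero, subPfaffian_zero, h0, h1, h2, h3, h4, h5, h6]; ring
  · simp only [Fin.mk_one, subPfaffian_one, h0, h1, h2, h3, h4, h5, h6]; ring
  · simp only [Fin.reduceFinMk, subPfaffian_two, h0, h1, h2, h3, h4, h5, h6]; ring
  · simp only [Fin.reduceFinMk, subPfaffian_three, h0, h1, h2, h3, h4, h5, h6]; ring
  · simp only [Fin.reduceFinMk, subPfaffian_four, h0, h1, h2, h3, h4, h5, h6]; ring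

lemma liesOn_iff (t : ℂ) (x : Fin 7 → ℂ) : LiesOn t x ↔ x ≠ 0 ∧ ∀ i, subPfaffian t x i = 0 := by
  constructor
  · rintro ⟨h, y, hy, hP⟩
    obtain ⟨c, hc⟩ : ∃ c : ℂˣ, ∀ i, x i = (c : ℂ) ^ weight i * y.1 i := Quotient.exact hy
    exact ⟨h, fun i => by rw [subPfaffian_weighted t c hc, hP, mul_zero]⟩
  · rintro ⟨h, hP⟩
    exact ⟨h, ⟨x, h⟩, rfl, hP⟩

/-- The equation `P₄ = 0` solved for `x₃`, where `u = (x₁, x₂, x₄)` and `x₀ = 1`. -/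
def solveThree (t : ℂ) (u : Fin 3 → ℂ) (x₅ x₆ : ℂ) : ℂ :=
  (t * x₆ ^ 2 + t ^ 2 * x₅ * (1 + u 0 ^ 2)) / (u 2 * u 1)

/-- The equation `P₅ = 0` solved for `x₅`. -/
def solveFive (t : ℂ) (u : Fin 3 → ℂ) (x₃ x₆ : ℂ) : ℂ :=
  (t * u 0 * (1 + u 0 ^ 2) + t ^ 2 * x₆ * (u 1 ^ 2 + x₃ ^ 2)) / u 2

/-- The equation `P₂ = 0` solved for `x₆`. -/
def solveSix (t : ℂ) (u : Fin 3 → ℂ) (x₃ x₅ : ℂ) : ℂ :=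
  (t * u 2 ^ 2 + t ^ 2 * x₅ * (u 1 ^ 2 + x₃ ^ 2)) / u 0

/-- The map whose fixed points are the coordinates `(x₃, x₅, x₆)` of the points of the fibre with
given `(x₁, x₂, x₄)`. -/
def solveMap (t : ℂ) (u y : Fin 3 → ℂ) : Fin 3 → ℂ :=
  ![solveThree t u (y 1) (y 2), solveFive t u (y 0) (y 2), solveSix t u (y 0) (y 1)]

/-- The point of the chart `x₀ = 1` with coordinates `u = (x₁, x₂, x₄)` and `y = (x₃, x₅, x₆)`. -/
def chartPoint (u y : Fin 3 → ℂ) : Fin 7 → ℂ := ![1, u 0, u 1, y 0, u 2, y 1, y 2]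

lemma eq_chartPoint {x : Fin 7 → ℂ} {u : Fin 3 → ℂ}
    (h : x 0 = 1 ∧ x 1 = u 0 ∧ x 2 = u 1 ∧ x 4 = u 2) :
    x = chartPoint u ![x 3, x 5, x 6] := by
  ext i
  fin_cases i
  exacts [h.1, h.2.1, h.2.2.1, rfl, h.2.2.2, rfl, rfl]

lemma chartPoint_ne_zero (u y : Fin 3 → ℂ) : chartPoint u y ≠ 0 := fun h => by
  have := congrFun h 0
  simp [chartPoint] at this

lemma liesOn_chartPoint_iff {t : ℂ} {u y : Fin 3 → ℂ} (hu : ∀ i, u i ≠ 0) :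
    LiesOn t (chartPoint u y) ↔ solveMap t u y = y := by
  have h0 := hu 0
  have h1 := hu 1
  have h2 := hu 2
  rw [liesOn_iff, and_iff_right (chartPoint_ne_zero u y)]
  have e1 : subPfaffian t (chartPoint u y) 1 =
      u 0 * y 2 - t * u 2 ^ 2 - t ^ 2 * y 1 * (u 1 ^ 2 + y 0 ^ 2) := by
    rw [subPfaffian_one]
    change 1 * u 0 * y 2 - t * u 2 ^ 2 - t ^ 2 * y 1 * (u 1 ^ 2 + y 0 ^ 2) = _
    rw [one_mul]
  have e3 : subPfaffian t (chartPoint u y) 3 =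
      u 2 * u 1 * y 0 - t * y 2 ^ 2 - t ^ 2 * y 1 * (1 + u 0 ^ 2) := by
    rw [subPfaffian_three]
    change u 2 * u 1 * y 0 - t * y 2 ^ 2 - t ^ 2 * y 1 * (1 ^ 2 + u 0 ^ 2) = _
    rw [one_pow]
  have e4 : subPfaffian t (chartPoint u y) 4 =
      u 2 * y 1 - t ^ 2 * y 2 * (u 1 ^ 2 + y 0 ^ 2) - t * u 0 * (1 + u 0 ^ 2) := by
    rw [subPfaffian_four]
    change u 2 * y 1 - t ^ 2 * y 2 * (u 1 ^ 2 + y 0 ^ 2) - t * 1 * u 0 * (1 ^ 2 + u 0 ^ 2) = _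
    ring
  have e2 : subPfaffian t (chartPoint u y) 2 =
      u 0 * u 1 * y 0 - t ^ 2 * y 2 * u 2 - t * y 1 ^ 2 := by
    rw [subPfaffian_two]
    change 1 * u 0 * u 1 * y 0 - t ^ 2 * y 2 * u 2 - t * y 1 ^ 2 = _
    rw [one_mul]
  have e0 : subPfaffian t (chartPoint u y) 0 =
      y 1 * y 2 - t ^ 2 * u 2 * (1 + u 0 ^ 2) - t * u 1 * y 0 * (u 1 ^ 2 + y 0 ^ 2) := by
    rw [subPfaffian_zero]
    change y 1 * y 2 - t ^ 2 * u 2 * (1 ^ 2 + u 0 ^ 2) - t * u 1 * y 0 * (u 1 ^ 2 + y 0 ^ 2) = _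
    rw [one_pow]
  constructor
  · intro h
    have h1' := h 1
    have h3' := h 3
    have h4' := h 4
    rw [e1] at h1'
    rw [e3] at h3'
    rw [e4] at h4'
    ext i
    fin_cases i
    · change solveThree t u (y 1) (y 2) = y 0
      rw [solveThree, div_eq_iff (mul_ne_zero h2 h1)]
      linear_combination -h3'
    · change solveFive t u (y 0) (y 2) = y 1
      rw [solveFive, div_eq_iff h2]
      linear_combination -h4'
    · change solveSix t u (y 0) (y 1) = y 2
      rw [solveSix, div_eq_iff h0]
      linear_combination -h1'
  · intro h
    have k0 : solveThree t u (y 1) (y 2) = y 0 := congrFun h 0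
    have k1 : solveFive t u (y 0) (y 2) = y 1 := congrFun h 1
    have k2 : solveSix t u (y 0) (y 1) = y 2 := congrFun h 2
    rw [solveThree, div_eq_iff (mul_ne_zero h2 h1)] at k0
    rw [solveFive, div_eq_iff h2] at k1
    rw [solveSix, div_eq_iff h0] at k2
    intro i
    fin_cases i
    -- The first and third pfaffians follow from the other three: multiplied by `x₄`, which is
    -- nonzero here, they are combinations of `P₂, P₄, P₅`.
    · refine e0.trans (mul_left_cancel₀ h2 ?_)
      linear_combination (-(y 2)) * k1 + t * (u 1 ^ 2 + y 0 ^ 2) * k0 - t * (1 + u 0 ^ 2) * k2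
    · refine e1.trans ?_
      linear_combination -k2
    · refine e2.trans (mul_left_cancel₀ h2 ?_)
      linear_combination t * y 1 * k1 - t * y 2 * k2 - u 0 * k0
    · refine e3.trans ?_
      linear_combination -k0
    · refine e4.trans ?_
      linear_combination -k1

lemma deriv_quadratic (a b c z : ℂ) :
    deriv (fun z : ℂ => a * z ^ 2 + b * z + c) z = 2 * a * z + b := by
  have h : HasDerivAt (fun z : ℂ => a * z ^ 2 + b * z + c) (a * (2 * z) + b * 1) z := by
    simpa using (((hasDerivAt_pow 2 z).const_mul a).add ((hasDerivAt_id z).const_mul b)).add_const c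
  rw [h.deriv]; ring

lemma jacobian_eq (t : ℂ) (x : Fin 7 → ℂ) : jacobian t x =
    x 0 * x 1 * x 2 * x 4 ^ 2 - t ^ 4 * x 2 * x 4 * (x 2 ^ 2 + x 3 ^ 2) ^ 2
      - 2 * t ^ 4 * x 0 * x 1 * x 3 * x 6 * (x 0 ^ 2 + x 1 ^ 2)
      - 4 * t ^ 5 * x 3 * x 6 ^ 2 * (x 2 ^ 2 + x 3 ^ 2) - 4 * t ^ 3 * x 3 * x 4 * x 5 * x 6
      - 2 * t ^ 6 * x 3 * x 5 * (x 0 ^ 2 + x 1 ^ 2) * (x 2 ^ 2 + x 3 ^ 2) := by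
  have h : ∀ (a : Fin 5) (b : Fin 7) (p q r : ℂ),
      (∀ z, subPfaffian t (Function.update x b z) a = p * z ^ 2 + q * z + r) →
      deriv (fun z => subPfaffian t (Function.update x b z) a) (x b) = 2 * p * x b + q := by
    intro a b p q r hz
    rw [funext hz, deriv_quadratic]
  have h13 := h 1 3 (-(t ^ 2 * x 5)) 0 (x 0 * x 1 * x 6 - t * x 4 ^ 2 - t ^ 2 * x 5 * x 2 ^ 2)
    fun z => by rw [subPfaffian_one]; simp [Function.update]; ring
  have h15 := h 1 5 0 (-(t ^ 2 * (x 2 ^ 2 + x 3 ^ 2))) (x 0 * x 1 * x 6 - t * x 4 ^ 2)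
    fun z => by rw [subPfaffian_one]; simp [Function.update]; ring
  have h16 := h 1 6 0 (x 0 * x 1) (- t * x 4 ^ 2 - t ^ 2 * x 5 * (x 2 ^ 2 + x 3 ^ 2))
    fun z => by rw [subPfaffian_one]; simp [Function.update]; ring
  have h33 := h 3 3 0 (x 4 * x 2) (- t * x 6 ^ 2 - t ^ 2 * x 5 * (x 0 ^ 2 + x 1 ^ 2))
    fun z => by rw [subPfaffian_three]; simp [Function.update]; ring
  have h35 := h 3 5 0 (-(t ^ 2 * (x 0 ^ 2 + x 1 ^ 2))) (x 4 * x 2 * x 3 - t * x 6 ^ 2)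
    fun z => by rw [subPfaffian_three]; simp [Function.update]; ring
  have h36 := h 3 6 (-t) 0 (x 4 * x 2 * x 3 - t ^ 2 * x 5 * (x 0 ^ 2 + x 1 ^ 2))
    fun z => by rw [subPfaffian_three]; simp [Function.update]; ring
  have h43 := h 4 3 (-(t ^ 2 * x 6)) 0
    (x 4 * x 5 - t ^ 2 * x 6 * x 2 ^ 2 - t * x 0 * x 1 * (x 0 ^ 2 + x 1 ^ 2))
    fun z => by rw [subPfaffian_four]; simp [Function.update]; ring
  have h45 := h 4 5 0 (x 4)
    (- t ^ 2 * x 6 * (x 2 ^ 2 + x 3 ^ 2) - t * x 0 * x 1 * (x 0 ^ 2 + x 1 ^ 2))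
    fun z => by rw [subPfaffian_four]; simp [Function.update]; ring
  have h46 := h 4 6 0 (-(t ^ 2 * (x 2 ^ 2 + x 3 ^ 2)))
    (x 4 * x 5 - t * x 0 * x 1 * (x 0 ^ 2 + x 1 ^ 2))
    fun z => by rw [subPfaffian_four]; simp [Function.update]; ring
  rw [jacobian, Matrix.det_fin_three]
  simp only [Matrix.of_apply, Matrix.cons_val, h13, h15, h16, h33, h35, h36, h43, h45, h46]
  ring

/-! ### The points of the fibres near the component `x₃ = x₅ = x₆ = 0` -/

/-- The parameter `t` is so small that the map `solveMap t u` is a contraction of the polydisc of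
radius `ε` for `u` in the torus of radius `ε`. -/
structure IsSmall (ε : ℝ) (t : ℂ) : Prop where
  le_one : ‖t‖ ≤ 1
  three : ‖t‖ * (ε ^ 2 + ε * (1 + ε ^ 2)) ≤ ε ^ 3 / 4
  five : ‖t‖ * (ε * (1 + ε ^ 2) + ε * (2 * ε ^ 2)) ≤ ε ^ 2 / 4
  six : ‖t‖ * (ε ^ 2 + ε * (2 * ε ^ 2)) ≤ ε ^ 2 / 4
  lipschitz_three : ‖t‖ * (2 * ε + (1 + ε ^ 2)) ≤ ε ^ 2 / 2
  lipschitz_five : ‖t‖ * (4 * ε) ≤ 1 / 2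

lemma exists_isSmall {ε : ℝ} (hε : 0 < ε) : ∃ δ : ℝ, 0 < δ ∧ ∀ t : ℂ, ‖t‖ < δ → IsSmall ε t := by
  have h : ∀ c r : ℝ, 0 < r → ∀ᶠ t : ℂ in 𝓝 0, ‖t‖ * c ≤ r := fun c r hr => by
    have hc : Tendsto (fun t : ℂ => ‖t‖ * c) (𝓝 0) (𝓝 (‖(0 : ℂ)‖ * c)) :=
      (continuous_norm.mul continuous_const).tendsto 0
    rw [norm_zero, zero_mul] at hc
    exact (hc.eventually_lt_const hr).mono fun _ => le_of_lt
  have hall : ∀ᶠ t : ℂ in 𝓝 0, IsSmall ε t := by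
    filter_upwards [h 1 1 one_pos, h (ε ^ 2 + ε * (1 + ε ^ 2)) (ε ^ 3 / 4) (by positivity),
      h (ε * (1 + ε ^ 2) + ε * (2 * ε ^ 2)) (ε ^ 2 / 4) (by positivity),
      h (ε ^ 2 + ε * (2 * ε ^ 2)) (ε ^ 2 / 4) (by positivity),
      h (2 * ε + (1 + ε ^ 2)) (ε ^ 2 / 2) (by positivity), h (4 * ε) (1 / 2) (by positivity)]
      with t h1 h2 h3 h4 h5 h6
    exact ⟨by simpa using h1, h2, h3, h4, h5, h6⟩
  obtain ⟨δ, hδ, hb⟩ := Metric.eventually_nhds_iff.1 hall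
  exact ⟨δ, hδ, fun t ht => hb (by simpa using ht)⟩

lemma norm_sq_add_sq_le {ε : ℝ} {a b : ℂ} (ha : ‖a‖ ≤ ε) (hb : ‖b‖ ≤ ε) :
    ‖a ^ 2 + b ^ 2‖ ≤ 2 * ε ^ 2 := by
  refine (norm_add_le _ _).trans ?_
  rw [norm_pow, norm_pow, two_mul]
  gcongr

lemma norm_one_add_sq_le {ε : ℝ} {a : ℂ} (ha : ‖a‖ ≤ ε) : ‖1 + a ^ 2‖ ≤ 1 + ε ^ 2 := by
  refine (norm_add_le _ _).trans ?_
  rw [norm_pow, norm_one]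
  gcongr

/-- Since `‖t‖ ≤ 1`, the square of `t` may be replaced by `‖t‖`; this makes every smallness
condition linear in `‖t‖`. -/
lemma norm_mul_add_sq_mul_le {t a b : ℂ} {A B : ℝ} (ht : ‖t‖ ≤ 1) (ha : ‖a‖ ≤ A) (hb : ‖b‖ ≤ B) :
    ‖t * a + t ^ 2 * b‖ ≤ ‖t‖ * (A + B) := by
  refine (norm_add_le _ _).trans ?_
  rw [norm_mul, norm_mul, norm_pow, mul_add]
  have hB : 0 ≤ B := (norm_nonneg b).trans hb
  have : ‖t‖ ^ 2 ≤ ‖t‖ := by nlinarith [norm_nonneg t]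
  gcongr

section estimates

variable {ε : ℝ} {t : ℂ} {u : Fin 3 → ℂ}

lemma norm_solveThree_le (hε : 0 < ε) (ht : IsSmall ε t) (hu : u ∈ torus ε) {x₅ x₆ : ℂ}
    (h₅ : ‖x₅‖ ≤ ε) (h₆ : ‖x₆‖ ≤ ε) : ‖solveThree t u x₅ x₆‖ ≤ ε / 4 := by
  have h := norm_mul_add_sq_mul_le (A := ε ^ 2) (B := ε * (1 + ε ^ 2)) ht.le_one
    (a := x₆ ^ 2) (b := x₅ * (1 + u 0 ^ 2)) (by rw [norm_pow]; gcongr)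
    (by rw [norm_mul]; gcongr; exact norm_one_add_sq_le (hu 0).le)
  rw [solveThree, norm_div, norm_mul, hu 2, hu 1, div_le_iff₀ (by positivity), mul_assoc (t ^ 2)]
  exact h.trans (ht.three.trans_eq (by ring))

lemma norm_solveFive_le (hε : 0 < ε) (ht : IsSmall ε t) (hu : u ∈ torus ε) {x₃ x₆ : ℂ}
    (h₃ : ‖x₃‖ ≤ ε) (h₆ : ‖x₆‖ ≤ ε) : ‖solveFive t u x₃ x₆‖ ≤ ε / 4 := by
  have h := norm_mul_add_sq_mul_le (A := ε * (1 + ε ^ 2)) (B := ε * (2 * ε ^ 2)) ht.le_one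
    (a := u 0 * (1 + u 0 ^ 2)) (b := x₆ * (u 1 ^ 2 + x₃ ^ 2))
    (by rw [norm_mul, hu 0]; gcongr; exact norm_one_add_sq_le (hu 0).le)
    (by rw [norm_mul]; gcongr; exact norm_sq_add_sq_le (hu 1).le h₃)
  rw [solveFive, norm_div, hu 2, div_le_iff₀ hε, mul_assoc (t ^ 2), mul_assoc t]
  exact h.trans (ht.five.trans_eq (by ring))

lemma norm_solveSix_le (hε : 0 < ε) (ht : IsSmall ε t) (hu : u ∈ torus ε) {x₃ x₅ : ℂ}
    (h₃ : ‖x₃‖ ≤ ε) (h₅ : ‖x₅‖ ≤ ε) : ‖solveSix t u x₃ x₅‖ ≤ ε / 4 := by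
  have h := norm_mul_add_sq_mul_le (A := ε ^ 2) (B := ε * (2 * ε ^ 2)) ht.le_one
    (a := u 2 ^ 2) (b := x₅ * (u 1 ^ 2 + x₃ ^ 2))
    (by rw [norm_pow, hu 2])
    (by rw [norm_mul]; gcongr; exact norm_sq_add_sq_le (hu 1).le h₃)
  rw [solveSix, norm_div, hu 0, div_le_iff₀ hε, mul_assoc (t ^ 2)]
  exact h.trans (ht.six.trans_eq (by ring))

lemma norm_sq_sub_sq_le {a b : ℂ} {d : ℝ} (ha : ‖a‖ ≤ ε) (hb : ‖b‖ ≤ ε)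
    (hd : ‖a - b‖ ≤ d) : ‖a ^ 2 - b ^ 2‖ ≤ 2 * ε * d := by
  rw [sq_sub_sq, norm_mul]
  have : ‖a + b‖ ≤ 2 * ε := (norm_add_le _ _).trans (by linarith)
  have h0 : 0 ≤ 2 * ε := (norm_nonneg _).trans this
  gcongr

lemma norm_solveThree_sub_le (hε : 0 < ε) (ht : IsSmall ε t) (hu : u ∈ torus ε)
    {x₅ x₆ z₅ z₆ : ℂ} {d : ℝ} (h₆ : ‖x₆‖ ≤ ε) (k₆ : ‖z₆‖ ≤ ε)
    (d₅ : ‖x₅ - z₅‖ ≤ d) (d₆ : ‖x₆ - z₆‖ ≤ d) :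
    ‖solveThree t u x₅ x₆ - solveThree t u z₅ z₆‖ ≤ d / 2 := by
  have hd : 0 ≤ d := (norm_nonneg _).trans d₅
  have h := norm_mul_add_sq_mul_le (A := 2 * ε * d) (B := d * (1 + ε ^ 2)) ht.le_one
    (a := x₆ ^ 2 - z₆ ^ 2) (b := (x₅ - z₅) * (1 + u 0 ^ 2)) (norm_sq_sub_sq_le h₆ k₆ d₆)
    (by rw [norm_mul]; gcongr; exact norm_one_add_sq_le (hu 0).le)
  have e : solveThree t u x₅ x₆ - solveThree t u z₅ z₆ =
      (t * (x₆ ^ 2 - z₆ ^ 2) + t ^ 2 * ((x₅ - z₅) * (1 + u 0 ^ 2))) / (u 2 * u 1) := by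
    rw [solveThree, solveThree]; ring
  rw [e, norm_div, norm_mul, hu 2, hu 1, div_le_iff₀ (by positivity)]
  have := mul_le_mul_of_nonneg_left ht.lipschitz_three hd
  linarith

lemma norm_quadratic_sub_le {d : ℝ} (ht : IsSmall ε t) (hu : u ∈ torus ε) {x₃ x z₃ z : ℂ}
    (h₃ : ‖x₃‖ ≤ ε) (k₃ : ‖z₃‖ ≤ ε) (k : ‖z‖ ≤ ε)
    (d₃ : ‖x₃ - z₃‖ ≤ d) (d₅ : ‖x - z‖ ≤ d) :
    ‖t ^ 2 * (x * (u 1 ^ 2 + x₃ ^ 2)) - t ^ 2 * (z * (u 1 ^ 2 + z₃ ^ 2))‖ ≤ ε * (d / 2) := by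
  have hε : 0 ≤ ε := (norm_nonneg _).trans h₃
  have hd : 0 ≤ d := (norm_nonneg _).trans d₃
  have h := norm_mul_add_sq_mul_le (t := t) (a := 0) (A := 0)
    (b := (x - z) * (u 1 ^ 2 + x₃ ^ 2) + z * (x₃ ^ 2 - z₃ ^ 2))
    (B := d * (2 * ε ^ 2) + ε * (2 * ε * d)) ht.le_one (by simp) (by
      refine (norm_add_le _ _).trans ?_
      rw [norm_mul, norm_mul]
      gcongr
      · exact norm_sq_add_sq_le (hu 1).le h₃
      · exact norm_sq_sub_sq_le h₃ k₃ d₃)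
  have e : t ^ 2 * (x * (u 1 ^ 2 + x₃ ^ 2)) - t ^ 2 * (z * (u 1 ^ 2 + z₃ ^ 2)) =
      t * 0 + t ^ 2 * ((x - z) * (u 1 ^ 2 + x₃ ^ 2) + z * (x₃ ^ 2 - z₃ ^ 2)) := by ring
  rw [e]
  have := mul_le_mul_of_nonneg_left ht.lipschitz_five (mul_nonneg hε hd)
  linarith

lemma norm_solveFive_sub_le (hε : 0 < ε) (ht : IsSmall ε t) (hu : u ∈ torus ε)
    {x₃ x₆ z₃ z₆ : ℂ} {d : ℝ} (h₃ : ‖x₃‖ ≤ ε) (k₃ : ‖z₃‖ ≤ ε) (k₆ : ‖z₆‖ ≤ ε)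
    (d₃ : ‖x₃ - z₃‖ ≤ d) (d₆ : ‖x₆ - z₆‖ ≤ d) :
    ‖solveFive t u x₃ x₆ - solveFive t u z₃ z₆‖ ≤ d / 2 := by
  have h := norm_quadratic_sub_le ht hu h₃ k₃ k₆ d₃ d₆
  have e : solveFive t u x₃ x₆ - solveFive t u z₃ z₆ =
      (t ^ 2 * (x₆ * (u 1 ^ 2 + x₃ ^ 2)) - t ^ 2 * (z₆ * (u 1 ^ 2 + z₃ ^ 2))) / u 2 := by
    rw [solveFive, solveFive]; ring
  rw [e, norm_div, hu 2, div_le_iff₀ hε]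
  linarith

lemma norm_solveSix_sub_le (hε : 0 < ε) (ht : IsSmall ε t) (hu : u ∈ torus ε)
    {x₃ x₅ z₃ z₅ : ℂ} {d : ℝ} (h₃ : ‖x₃‖ ≤ ε) (k₃ : ‖z₃‖ ≤ ε) (k₅ : ‖z₅‖ ≤ ε)
    (d₃ : ‖x₃ - z₃‖ ≤ d) (d₅ : ‖x₅ - z₅‖ ≤ d) :
    ‖solveSix t u x₃ x₅ - solveSix t u z₃ z₅‖ ≤ d / 2 := by
  have h := norm_quadratic_sub_le ht hu h₃ k₃ k₅ d₃ d₅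
  have e : solveSix t u x₃ x₅ - solveSix t u z₃ z₅ =
      (t ^ 2 * (x₅ * (u 1 ^ 2 + x₃ ^ 2)) - t ^ 2 * (z₅ * (u 1 ^ 2 + z₃ ^ 2))) / u 0 := by
    rw [solveSix, solveSix]; ring
  rw [e, norm_div, hu 0, div_le_iff₀ hε]
  linarith

/-- The margin `ε / 4` excludes fixed points on the boundary of the polydisc; the corresponding
bounds for the components keep `1 - Sᵢ / xᵢ` away from zero on the circles of radius `ε`. -/
lemma norm_solveMap_le (hε : 0 < ε) (ht : IsSmall ε t) (hu : u ∈ torus ε) {y : Fin 3 → ℂ}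
    (hy : ‖y‖ ≤ ε) : ‖solveMap t u y‖ ≤ ε / 4 := by
  rw [pi_norm_le_iff_of_nonneg hε.le] at hy
  rw [pi_norm_le_iff_of_nonneg (by positivity)]
  intro i
  fin_cases i
  exacts [norm_solveThree_le hε ht hu (hy 1) (hy 2), norm_solveFive_le hε ht hu (hy 0) (hy 2),
    norm_solveSix_le hε ht hu (hy 0) (hy 1)]

lemma norm_solveMap_sub_le (hε : 0 < ε) (ht : IsSmall ε t) (hu : u ∈ torus ε) {y z : Fin 3 → ℂ}
    (hy : ‖y‖ ≤ ε) (hz : ‖z‖ ≤ ε) : ‖solveMap t u y - solveMap t u z‖ ≤ ‖y - z‖ / 2 := by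
  have hd : ∀ i, ‖y i - z i‖ ≤ ‖y - z‖ := fun i => norm_le_pi_norm (y - z) i
  rw [pi_norm_le_iff_of_nonneg hε.le] at hy hz
  rw [pi_norm_le_iff_of_nonneg (by positivity)]
  intro i
  fin_cases i
  exacts [norm_solveThree_sub_le hε ht hu (hy 2) (hz 2) (hd 1) (hd 2),
    norm_solveFive_sub_le hε ht hu (hy 0) (hz 0) (hz 2) (hd 0) (hd 2),
    norm_solveSix_sub_le hε ht hu (hy 0) (hz 0) (hz 1) (hd 0) (hd 1)]

lemma solveMap_fixed_unique (hε : 0 < ε) (ht : IsSmall ε t) (hu : u ∈ torus ε) {y z : Fin 3 → ℂ}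
    (hy : ‖y‖ ≤ ε) (hz : ‖z‖ ≤ ε) (hy' : solveMap t u y = y) (hz' : solveMap t u z = z) :
    y = z := by
  have h := norm_solveMap_sub_le hε ht hu hy hz
  rw [hy', hz'] at h
  have : ‖y - z‖ = 0 := by linarith [norm_nonneg (y - z)]
  rwa [norm_eq_zero, sub_eq_zero] at this

lemma exists_solveMap_fixed (hε : 0 < ε) (ht : IsSmall ε t) (hu : u ∈ torus ε) :
    ∃ y : Fin 3 → ℂ, ‖y‖ ≤ ε ∧ solveMap t u y = y := by
  have hm : Set.MapsTo (solveMap t u) (Metric.closedBall 0 ε) (Metric.closedBall 0 ε) := by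
    intro y hy
    rw [mem_closedBall_zero_iff] at hy ⊢
    exact (norm_solveMap_le hε ht hu hy).trans (by linarith)
  have hc : ContractingWith (1 / 2) (hm.restrict (solveMap t u) _ _) := by
    refine ⟨by rw [← NNReal.coe_lt_coe]; norm_num, LipschitzWith.of_dist_le_mul fun y z => ?_⟩
    have := norm_solveMap_sub_le hε ht hu (mem_closedBall_zero_iff.1 y.2)
      (mem_closedBall_zero_iff.1 z.2)
    rw [Subtype.dist_eq, Subtype.dist_eq, dist_eq_norm, dist_eq_norm]
    simp only [Set.MapsTo.val_restrict_apply]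
    push_cast
    linarith
  obtain ⟨y, hy, hfix, -⟩ := hc.exists_fixedPoint' Metric.isClosed_closedBall.isComplete hm
    (x := 0) (by simpa using hε.le) (edist_ne_top _ _)
  exact ⟨y, mem_closedBall_zero_iff.1 hy, hfix⟩

end estimates

/-- The coordinates `(x₃, x₅, x₆)` of the point near `x₃ = x₅ = x₆ = 0` of the fibre over `t` with
`(x₁, x₂, x₄) = u`. -/
def solution (ε : ℝ) (t : ℂ) (u : Fin 3 → ℂ) : Fin 3 → ℂ :=
  open Classical in
  if h : ∃ y : Fin 3 → ℂ, ‖y‖ ≤ ε ∧ solveMap t u y = y then h.choose else 0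

section solution

variable {ε : ℝ} {t : ℂ} {u : Fin 3 → ℂ}

lemma solution_spec (hε : 0 < ε) (ht : IsSmall ε t) (hu : u ∈ torus ε) :
    ‖solution ε t u‖ ≤ ε ∧ solveMap t u (solution ε t u) = solution ε t u := by
  have h := exists_solveMap_fixed hε ht hu
  rw [solution, dif_pos h]
  exact h.choose_spec

lemma ne_zero_of_mem_torus (hε : 0 < ε) (hu : u ∈ torus ε) (i : Fin 3) : u i ≠ 0 := by
  rw [← norm_pos_iff, hu i]; exact hε

lemma continuousAt_solveMap (y : Fin 3 → ℂ) {p : ℂ × (Fin 3 → ℂ)} (hp : ∀ i, p.2 i ≠ 0) :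
    ContinuousAt (fun q : ℂ × (Fin 3 → ℂ) => solveMap q.1 q.2 y) p := by
  have h0 := hp 0
  have h1 := hp 1
  have h2 := hp 2
  refine continuousAt_pi.2 fun i => ?_
  fin_cases i
  · change ContinuousAt (fun q : ℂ × (Fin 3 → ℂ) =>
      (q.1 * y 2 ^ 2 + q.1 ^ 2 * y 1 * (1 + q.2 0 ^ 2)) / (q.2 2 * q.2 1)) p
    exact ContinuousAt.div (by fun_prop) (by fun_prop) (mul_ne_zero h2 h1)
  · change ContinuousAt (fun q : ℂ × (Fin 3 → ℂ) =>
      (q.1 * q.2 0 * (1 + q.2 0 ^ 2) + q.1 ^ 2 * y 2 * (q.2 1 ^ 2 + y 0 ^ 2)) / q.2 2) p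
    exact ContinuousAt.div (by fun_prop) (by fun_prop) h2
  · change ContinuousAt (fun q : ℂ × (Fin 3 → ℂ) =>
      (q.1 * q.2 2 ^ 2 + q.1 ^ 2 * y 1 * (q.2 1 ^ 2 + y 0 ^ 2)) / q.2 0) p
    exact ContinuousAt.div (by fun_prop) (by fun_prop) h0

/-- Fixed points of maps contracting by `1 / 2` satisfy `‖y_q - y_p‖ ≤ 2 ‖S_q (y_p) - y_p‖`, and the
right-hand side tends to zero because `S_q (y_p)` is continuous in `q`. -/
lemma continuousOn_solution (hε : 0 < ε) {δ : ℝ} (hδ : ∀ t : ℂ, ‖t‖ < δ → IsSmall ε t) :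
    ContinuousOn (fun p : ℂ × (Fin 3 → ℂ) => solution ε p.1 p.2)
      (Metric.ball (0 : ℂ) δ ×ˢ torus ε) := by
  rintro ⟨t, u⟩ ⟨ht, hu⟩
  have ht' : IsSmall ε t := hδ t (by simpa using ht)
  obtain ⟨h1, h2⟩ := solution_spec hε ht' hu
  have hc : Tendsto (fun q : ℂ × (Fin 3 → ℂ) => 2 * ‖solveMap q.1 q.2 (solution ε t u)
      - solution ε t u‖) (𝓝[Metric.ball (0 : ℂ) δ ×ˢ torus ε] (t, u)) (𝓝 0) := by
    have := (((continuousAt_solveMap (solution ε t u) (p := (t, u))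
      (ne_zero_of_mem_torus hε hu)).sub (continuousAt_const (y := solution ε t u))).norm.const_mul 2
      ).continuousWithinAt (s := Metric.ball (0 : ℂ) δ ×ˢ torus ε)
    have h3 := this.tendsto
    simpa [h2] using h3
  rw [ContinuousWithinAt, tendsto_iff_norm_sub_tendsto_zero]
  refine squeeze_zero' (Eventually.of_forall fun _ => norm_nonneg _) ?_ hc
  filter_upwards [self_mem_nhdsWithin] with q hq
  have hq1 : IsSmall ε q.1 := hδ q.1 (by simpa using hq.1)
  obtain ⟨h3, h4⟩ := solution_spec hε hq1 hq.2
  have h5 := norm_solveMap_sub_le hε hq1 hq.2 h3 h1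
  rw [h4] at h5
  have h6 := norm_sub_le_norm_sub_add_norm_sub (solution ε q.1 q.2)
    (solveMap q.1 q.2 (solution ε t u)) (solution ε t u)
  linarith

lemma solution_zero (hε : 0 < ε) (h : IsSmall ε 0) (hu : u ∈ torus ε) : solution ε 0 u = 0 := by
  obtain ⟨-, h2⟩ := solution_spec hε h hu
  rw [← h2]
  ext i
  fin_cases i <;> simp [solveMap, solveThree, solveFive, solveSix]

/-- The torus extends to a continuous family of torus cycles. -/
theorem isTorusCycle_chartPoint_solution (hε : 0 < ε) {δ : ℝ} (hδ0 : 0 < δ)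
    (hδ : ∀ t : ℂ, ‖t‖ < δ → IsSmall ε t) :
    IsTorusCycle ε δ (fun t u => chartPoint u (solution ε t u)) where
  continuousOn := by
    have h := continuousOn_solution hε hδ
    rw [continuousOn_pi] at h ⊢
    have hu : ∀ j, ContinuousOn (fun p : ℂ × (Fin 3 → ℂ) => p.2 j)
      (Metric.ball (0 : ℂ) δ ×ˢ torus ε) := fun j => by fun_prop
    intro i
    fin_cases i
    exacts [continuousOn_const, hu 0, hu 1, h 0, hu 2, h 1, h 2]
  liesOn t ht u hu := (liesOn_chartPoint_iff (ne_zero_of_mem_torus hε hu)).2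
    (solution_spec hε (hδ t (by simpa using ht)) hu).2
  coords t _ u _ := ⟨rfl, rfl, rfl, rfl⟩
  base u hu := by
    have h := solution_zero hε (hδ 0 (by simpa using hδ0)) hu
    exact ⟨congrFun h 0, congrFun h 1, congrFun h 2⟩

/-- Every continuous family of torus cycles is the one given by `solution`. -/
theorem IsTorusCycle.eq_chartPoint_solution {γ : ℂ → (Fin 3 → ℂ) → (Fin 7 → ℂ)} {δ : ℝ}
    (hγ : IsTorusCycle ε δ γ) (hε : 0 < ε) (hδ : ∀ t : ℂ, ‖t‖ < δ → IsSmall ε t) (ht : ‖t‖ < δ)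
    (hu : u ∈ torus ε) : γ t u = chartPoint u (solution ε t u) := by
  set y : ℂ → Fin 3 → ℂ := fun s => ![γ s u 3, γ s u 5, γ s u 6] with hy
  have hpt : ∀ s ∈ Metric.ball (0 : ℂ) δ, γ s u = chartPoint u (y s) := fun s hs =>
    eq_chartPoint (hγ.coords s hs u hu)
  have hfix : ∀ s ∈ Metric.ball (0 : ℂ) δ, solveMap s u (y s) = y s := fun s hs => by
    rw [← liesOn_chartPoint_iff (ne_zero_of_mem_torus hε hu), ← hpt s hs]
    exact hγ.liesOn s hs u hu
  have hcont : ContinuousOn y (Metric.ball (0 : ℂ) δ) := by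
    have h : ContinuousOn (fun s => γ s u) (Metric.ball (0 : ℂ) δ) :=
      hγ.continuousOn.comp (f := fun s => (s, u)) (by fun_prop) fun s hs => ⟨hs, hu⟩
    rw [continuousOn_pi] at h ⊢
    intro i
    fin_cases i
    exacts [h 3, h 5, h 6]
  have ht' : t ∈ Metric.ball (0 : ℂ) δ := by simpa using ht
  have h0 : (0 : ℂ) ∈ Metric.ball (0 : ℂ) δ :=
    Metric.mem_ball_self ((norm_nonneg t).trans_lt ht)
  have hy0 : y 0 = 0 := by
    obtain ⟨b3, b5, b6⟩ := hγ.base u hu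
    ext i
    fin_cases i
    exacts [b3, b5, b6]
  -- If the family left the polydisc, then on its way from `y 0 = 0` it would have norm exactly `ε`
  -- at some parameter; but a fixed point of norm `ε` has norm at most `ε / 4`.
  have hle : ‖y t‖ ≤ ε := by
    by_contra! hlt
    obtain ⟨s, hs, hsε⟩ := (convex_ball (0 : ℂ) δ).isPreconnected.intermediate_value h0 ht'
      hcont.norm (show ε ∈ Set.Icc ‖y 0‖ ‖y t‖ from ⟨by rw [hy0, norm_zero]; exact hε.le, hlt.le⟩)
    have h1 := norm_solveMap_le hε (hδ s (by simpa using hs)) hu (le_of_eq hsε)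
    rw [hfix s hs] at h1
    simp only at hsε
    linarith
  obtain ⟨s1, s2⟩ := solution_spec hε (hδ t ht) hu
  rw [hpt t ht', solveMap_fixed_unique hε (hδ t ht) hu hle s1 (hfix t ht') s2]

end solution

/-! ### The period integrand as an iterated residue -/

open Real (circleAverage)

lemma one_sub_ne_zero_of_norm_le {z : ℂ} (h : ‖z‖ ≤ 1 / 2) : 1 - z ≠ 0 := by
  intro h0
  rw [sub_eq_zero] at h0
  rw [← h0, norm_one] at h
  norm_num at h

/-- The residue at the fixed point of a contraction of a disc. -/
lemma circleAverage_div_one_sub {R : ℝ} (hR : 0 < R) {f h : ℂ → ℂ}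
    (hf : DifferentiableOn ℂ f (Metric.closedBall 0 R))
    (hh : DifferentiableOn ℂ h (Metric.closedBall 0 R))
    (hlip : ∀ z w : ℂ, ‖z‖ ≤ R → ‖w‖ ≤ R → ‖h z - h w‖ ≤ ‖z - w‖ / 2)
    {w : ℂ} (hw : ‖w‖ < R) (hfix : h w = w) :
    ‖deriv h w‖ ≤ 1 / 2 ∧
      circleAverage (fun z => f z / (1 - h z / z)) 0 R = f w / (1 - deriv h w) := by
  have hnhds : Metric.closedBall (0 : ℂ) R ∈ 𝓝 w :=
    Filter.mem_of_superset (Metric.isOpen_ball.mem_nhds (by simpa using hw))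
      Metric.ball_subset_closedBall
  have hd : ‖deriv h w‖ ≤ 1 / 2 := by
    refine norm_deriv_le_of_lip' (by norm_num) ?_
    filter_upwards [hnhds] with z hz
    have := hlip z w (by simpa using hz) hw.le
    linarith
  refine ⟨hd, ?_⟩
  -- The average is `(2πi)⁻¹ ∮ f / F`. By contraction `w` is the only zero of `F` in the disc, and
  -- it is simple because `‖h' w‖ ≤ 1 / 2`. Hence `f / F = (z - w)⁻¹ (f / dslope F w)` with a
  -- differentiable second factor, and Cauchy's formula applies.
  set F : ℂ → ℂ := fun z => z - h z with hF
  have hFd : DifferentiableOn ℂ F (Metric.closedBall 0 R) := differentiableOn_id.sub hh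
  have hFw : F w = 0 := by simp [hF, hfix]
  have hhw : HasDerivAt h (deriv h w) w := (hh.differentiableAt hnhds).hasDerivAt
  have hderiv : deriv F w = 1 - deriv h w := ((hasDerivAt_id w).sub hhw).deriv
  have hslope : ∀ z, z ≠ w → dslope F w z = F z / (z - w) := fun z hz => by
    rw [dslope_of_ne _ hz, slope_def_field, hFw, sub_zero]
  have hFz : ∀ z, ‖z‖ ≤ R → z ≠ w → F z ≠ 0 := fun z hz hzw h0 => by
    have h1 := hlip z w hz hw.le
    have h2 : h z = z := (sub_eq_zero.1 h0).symm
    rw [h2, hfix] at h1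
    have : ‖z - w‖ = 0 := by linarith [norm_nonneg (z - w)]
    exact hzw (sub_eq_zero.1 (norm_eq_zero.1 this))
  have hslope_ne : ∀ z, ‖z‖ ≤ R → dslope F w z ≠ 0 := fun z hz => by
    rcases eq_or_ne z w with rfl | hzw
    · rw [dslope_same, hderiv]
      exact one_sub_ne_zero_of_norm_le hd
    · rw [hslope z hzw]
      exact div_ne_zero (hFz z hz hzw) (sub_ne_zero.2 hzw)
  have hdiff : DifferentiableOn ℂ (fun z => f z / dslope F w z) (Metric.closedBall 0 R) :=
    hf.div ((Complex.differentiableOn_dslope hnhds).2 hFd) fun z hz =>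
      hslope_ne z (by simpa using hz)
  have hc := hdiff.circleIntegral_sub_inv_smul (w := w) (by simpa using hw)
  rw [Real.circleAverage_eq_circleIntegral hR.ne']
  have hcongr : (∮ z in C(0, R), (z - 0)⁻¹ • (f z / (1 - h z / z))) =
      ∮ z in C(0, R), (z - w)⁻¹ • (f z / dslope F w z) := by
    refine circleIntegral.integral_congr hR.le fun z hz => ?_
    have hz' : ‖z‖ = R := by simpa using hz
    have hzw : z ≠ w := by rintro rfl; exact hw.ne hz'
    have hz0 : z ≠ 0 := by rw [← norm_pos_iff, hz']; exact hR
    have h1 := hFz z hz'.le hzw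
    have h2 : z - w ≠ 0 := sub_ne_zero.2 hzw
    have h3 : z - h z ≠ 0 := h1
    simp only [smul_eq_mul, sub_zero]
    rw [hslope z hzw]
    simp only [hF]
    field_simp
  rw [hcongr, hc, dslope_same, hderiv, smul_smul, inv_mul_cancel₀, one_smul]
  simp [Real.pi_ne_zero]

/-- The integrand of the period on the six-dimensional torus. -/
def kernel (t : ℂ) (u : Fin 3 → ℂ) (x₃ x₅ x₆ : ℂ) : ℂ :=
  ((1 - solveThree t u x₅ x₆ / x₃) * (1 - solveFive t u x₃ x₆ / x₅)
    * (1 - solveSix t u x₃ x₅ / x₆))⁻¹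

section kernel

variable {ε : ℝ} {t : ℂ} {u : Fin 3 → ℂ}

lemma one_sub_div_ne_zero (hε : 0 < ε) {a z : ℂ} (ha : ‖a‖ ≤ ε / 4) (hz : ‖z‖ = ε) :
    1 - a / z ≠ 0 := by
  refine one_sub_ne_zero_of_norm_le ?_
  rw [norm_div, hz, div_le_iff₀ hε]
  linarith

/-- `solveFive` does not involve `x₅`, so this residue has a constant contraction with derivative
zero: it just substitutes the solved value for `x₅`. -/
lemma circleAverage_kernel_five (hε : 0 < ε) (ht : IsSmall ε t) (hu : u ∈ torus ε) {x₃ x₆ : ℂ}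
    (h₃ : ‖x₃‖ = ε) (h₆ : ‖x₆‖ = ε) :
    circleAverage (fun x₅ => kernel t u x₃ x₅ x₆) 0 ε =
      ((1 - solveThree t u (solveFive t u x₃ x₆) x₆ / x₃)
        * (1 - solveSix t u x₃ (solveFive t u x₃ x₆) / x₆))⁻¹ := by
  have hb := norm_solveFive_le hε ht hu h₃.le h₆.le
  have h := (circleAverage_div_one_sub hε (h := fun _ => solveFive t u x₃ x₆)
    (f := fun x₅ => ((1 - solveThree t u x₅ x₆ / x₃) * (1 - solveSix t u x₃ x₅ / x₆))⁻¹)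
    (w := solveFive t u x₃ x₆) ?_ (differentiableOn_const _)
    (fun z w _ _ => by rw [sub_self, norm_zero]; positivity) (by linarith) rfl).2
  · rw [deriv_const, sub_zero, div_one] at h
    rw [← h]
    congr 1
    funext x₅
    simp only [kernel, div_eq_mul_inv, mul_inv]
    ring
  · refine DifferentiableOn.inv ?_ fun z hz => mul_ne_zero ?_ ?_
    · simp only [solveThree, solveSix, div_eq_mul_inv]
      fun_prop
    · exact one_sub_div_ne_zero hε (norm_solveThree_le hε ht hu (by simpa using hz) h₆.le) h₃
    · exact one_sub_div_ne_zero hε (norm_solveSix_le hε ht hu h₃.le (by simpa using hz)) h₆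

/-- The derivative of the affine map `x₆ ↦ solveSix (solveFive x₆)`. -/
def slopeSix (t : ℂ) (u : Fin 3 → ℂ) (x₃ : ℂ) : ℂ :=
  t ^ 2 * (u 1 ^ 2 + x₃ ^ 2) / u 0 * (t ^ 2 * (u 1 ^ 2 + x₃ ^ 2) / u 2)

lemma solveSix_solveFive (x₃ x₆ : ℂ) : solveSix t u x₃ (solveFive t u x₃ x₆) =
    solveSix t u x₃ (solveFive t u x₃ 0) + slopeSix t u x₃ * x₆ := by
  simp only [solveSix, solveFive, slopeSix]
  ring

/-- The value of `x₆` for which the equations for `x₅` and `x₆` hold, given `x₃`. -/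
def sixOfThree (t : ℂ) (u : Fin 3 → ℂ) (x₃ : ℂ) : ℂ :=
  solveSix t u x₃ (solveFive t u x₃ 0) / (1 - slopeSix t u x₃)

/-- The value of `x₅` for which the equations for `x₅` and `x₆` hold, given `x₃`. -/
def fiveOfThree (t : ℂ) (u : Fin 3 → ℂ) (x₃ : ℂ) : ℂ := solveFive t u x₃ (sixOfThree t u x₃)

lemma norm_slopeSix_le (hε : 0 < ε) (ht : IsSmall ε t) (hu : u ∈ torus ε) {x₃ : ℂ}
    (h₃ : ‖x₃‖ ≤ ε) : ‖slopeSix t u x₃‖ ≤ 1 / 4 := by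
  have h1 := norm_mul_add_sq_mul_le (t := t) (a := 0) (A := 0) (b := u 1 ^ 2 + x₃ ^ 2) ht.le_one
    (by simp) (norm_sq_add_sq_le (hu 1).le h₃)
  rw [mul_zero, zero_add, zero_add] at h1
  have h2 : ‖t ^ 2 * (u 1 ^ 2 + x₃ ^ 2)‖ ≤ ε / 2 := by
    have := mul_le_mul_of_nonneg_left ht.lipschitz_five hε.le
    linarith
  have h3 : ∀ i, ‖t ^ 2 * (u 1 ^ 2 + x₃ ^ 2) / u i‖ ≤ 1 / 2 := fun i => by
    rw [norm_div, hu i, div_le_iff₀ hε]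
    linarith
  rw [slopeSix, norm_mul, show (1 / 4 : ℝ) = 1 / 2 * (1 / 2) by norm_num]
  exact mul_le_mul (h3 0) (h3 2) (norm_nonneg _) (by norm_num)

lemma one_sub_slopeSix_ne_zero (hε : 0 < ε) (ht : IsSmall ε t) (hu : u ∈ torus ε) {x₃ : ℂ}
    (h₃ : ‖x₃‖ ≤ ε) : 1 - slopeSix t u x₃ ≠ 0 :=
  one_sub_ne_zero_of_norm_le ((norm_slopeSix_le hε ht hu h₃).trans (by norm_num))

lemma solveSix_fiveOfThree (hε : 0 < ε) (ht : IsSmall ε t) (hu : u ∈ torus ε) {x₃ : ℂ}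
    (h₃ : ‖x₃‖ ≤ ε) : solveSix t u x₃ (fiveOfThree t u x₃) = sixOfThree t u x₃ := by
  have := one_sub_slopeSix_ne_zero hε ht hu h₃
  rw [fiveOfThree, solveSix_solveFive, sixOfThree]
  field_simp
  ring

lemma norm_sixOfThree_lt (hε : 0 < ε) (ht : IsSmall ε t) (hu : u ∈ torus ε) {x₃ : ℂ}
    (h₃ : ‖x₃‖ ≤ ε) : ‖sixOfThree t u x₃‖ < ε := by
  have h1 := norm_solveFive_le hε ht hu h₃ (x₆ := 0) (by simpa using hε.le)
  have h2 := norm_solveSix_le hε ht hu h₃ (h1.trans (by linarith))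
  have h3 := norm_slopeSix_le hε ht hu h₃
  have h4 : 3 / 4 ≤ ‖1 - slopeSix t u x₃‖ := by
    have := norm_sub_norm_le (1 : ℂ) (slopeSix t u x₃)
    rw [norm_one] at this
    linarith
  rw [sixOfThree, norm_div, div_lt_iff₀ (by linarith)]
  nlinarith

lemma norm_fiveOfThree_le (hε : 0 < ε) (ht : IsSmall ε t) (hu : u ∈ torus ε) {x₃ : ℂ}
    (h₃ : ‖x₃‖ ≤ ε) : ‖fiveOfThree t u x₃‖ ≤ ε := 
  (norm_solveFive_le hε ht hu h₃ (norm_sixOfThree_lt hε ht hu h₃).le).trans (by linarith)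

/-- Once `x₅` is eliminated, the equation for `x₆` is affine with slope `slopeSix` and fixed point
`sixOfThree`; the factor belonging to `x₃` is carried along as numerator. -/
lemma circleAverage_kernel_six (hε : 0 < ε) (ht : IsSmall ε t) (hu : u ∈ torus ε) {x₃ : ℂ}
    (h₃ : ‖x₃‖ = ε) :
    circleAverage (fun x₆ => circleAverage (fun x₅ => kernel t u x₃ x₅ x₆) 0 ε) 0 ε =
      (1 - slopeSix t u x₃)⁻¹ /
        (1 - solveThree t u (fiveOfThree t u x₃) (sixOfThree t u x₃) / x₃) := by
  have hd : HasDerivAt (fun x₆ => solveSix t u x₃ (solveFive t u x₃ x₆)) (slopeSix t u x₃)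
      (sixOfThree t u x₃) := by
    rw [funext (solveSix_solveFive x₃)]
    simpa using ((hasDerivAt_id (sixOfThree t u x₃)).const_mul (slopeSix t u x₃)).const_add
      (solveSix t u x₃ (solveFive t u x₃ 0))
  have h := (circleAverage_div_one_sub hε
    (h := fun x₆ => solveSix t u x₃ (solveFive t u x₃ x₆))
    (f := fun x₆ => (1 - solveThree t u (solveFive t u x₃ x₆) x₆ / x₃)⁻¹)
    (w := sixOfThree t u x₃) ?_ ?_ ?_ (norm_sixOfThree_lt hε ht hu h₃.le)
    (solveSix_fiveOfThree hε ht hu h₃.le)).2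
  · rw [hd.deriv] at h
    have e : ∀ a b : ℂ, (1 - a)⁻¹ / (1 - b) = (1 - b)⁻¹ / (1 - a) := fun a b => by ring
    rw [e, fiveOfThree, ← h]
    refine Real.circleAverage_congr_sphere fun x₆ hx₆ => ?_
    rw [circleAverage_kernel_five hε ht hu h₃ (by simpa [abs_of_pos hε] using hx₆), mul_inv,
      ← div_eq_mul_inv]
  · refine DifferentiableOn.inv ?_ fun z hz => ?_
    · simp only [solveThree, solveFive, div_eq_mul_inv]
      fun_prop
    · have hz' : ‖z‖ ≤ ε := by simpa using hz
      exact one_sub_div_ne_zero hε (norm_solveThree_le hε ht hu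
        ((norm_solveFive_le hε ht hu h₃.le hz').trans (by linarith)) hz') h₃
  · simp only [solveSix, solveFive, div_eq_mul_inv]
    fun_prop
  · intro z w hz hw
    refine norm_solveSix_sub_le hε ht hu h₃.le h₃.le
      ((norm_solveFive_le hε ht hu h₃.le hw).trans (by linarith)) (by simp) ?_
    refine (norm_solveFive_sub_le hε ht hu h₃.le h₃.le hw (d := ‖z - w‖) (by simp) le_rfl).trans ?_
    linarith [norm_nonneg (z - w)]

lemma differentiableOn_sixOfThree (hε : 0 < ε) (ht : IsSmall ε t) (hu : u ∈ torus ε) :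
    DifferentiableOn ℂ (sixOfThree t u) (Metric.closedBall 0 ε) := by
  refine DifferentiableOn.div ?_ ?_ fun z hz =>
    one_sub_slopeSix_ne_zero hε ht hu (by simpa using hz)
  · simp only [solveSix, solveFive, div_eq_mul_inv]
    fun_prop
  · simp only [slopeSix, div_eq_mul_inv]
    fun_prop

lemma differentiableOn_fiveOfThree (hε : 0 < ε) (ht : IsSmall ε t) (hu : u ∈ torus ε) :
    DifferentiableOn ℂ (fiveOfThree t u) (Metric.closedBall 0 ε) := by
  have := differentiableOn_sixOfThree hε ht hu
  unfold fiveOfThree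
  simp only [solveFive, div_eq_mul_inv]
  fun_prop

/-- With `d` the largest of the three differences, the Lipschitz bounds make the differences of `x₅`
and of `x₆` at most `d / 2`, so `d` is attained by `‖z - w‖`. Thus the equation for `x₃`, with `x₅,
x₆` eliminated, is still a contraction. -/
lemma norm_ofThree_sub_le (hε : 0 < ε) (ht : IsSmall ε t) (hu : u ∈ torus ε) {z w : ℂ}
    (hz : ‖z‖ ≤ ε) (hw : ‖w‖ ≤ ε) :
    ‖fiveOfThree t u z - fiveOfThree t u w‖ ≤ ‖z - w‖ ∧
      ‖sixOfThree t u z - sixOfThree t u w‖ ≤ ‖z - w‖ := by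
  set d := max ‖z - w‖ (max ‖fiveOfThree t u z - fiveOfThree t u w‖
    ‖sixOfThree t u z - sixOfThree t u w‖) with hd
  have d3 : ‖z - w‖ ≤ d := le_max_left _ _
  have d5 : ‖fiveOfThree t u z - fiveOfThree t u w‖ ≤ d :=
    (le_max_left _ _).trans (le_max_right _ _)
  have d6 : ‖sixOfThree t u z - sixOfThree t u w‖ ≤ d :=
    (le_max_right _ _).trans (le_max_right _ _)
  have h5 := norm_solveFive_sub_le hε ht hu hz hw (norm_sixOfThree_lt hε ht hu hw).le d3 d6
  have h6 := norm_solveSix_sub_le hε ht hu hz hw (norm_fiveOfThree_le hε ht hu hw) d3 d5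
  rw [solveSix_fiveOfThree hε ht hu hz, solveSix_fiveOfThree hε ht hu hw] at h6
  have h5' : ‖fiveOfThree t u z - fiveOfThree t u w‖ ≤ d / 2 := h5
  have hdle : d ≤ ‖z - w‖ := by
    by_contra! hlt
    have h0 : 0 < d := (norm_nonneg _).trans_lt hlt
    have : d < d := max_lt hlt (max_lt (by linarith) (by linarith))
    exact lt_irrefl _ this
  exact ⟨d5.trans hdle, d6.trans hdle⟩

/-- The iterated average of the kernel is the coefficient of the holomorphic three-form at the
point of the torus cycle, up to the factor `x₁ x₂ x₄`. -/
theorem circleAverage_kernel (hε : 0 < ε) (ht : IsSmall ε t) (hu : u ∈ torus ε) :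
    jacobian t (chartPoint u (solution ε t u)) ≠ 0 ∧
    circleAverage (fun x₃ => circleAverage (fun x₆ => circleAverage
      (fun x₅ => kernel t u x₃ x₅ x₆) 0 ε) 0 ε) 0 ε =
      u 0 * u 1 * u 2 * (u 2 / jacobian t (chartPoint u (solution ε t u))) := by
  obtain ⟨hy, hfix⟩ := solution_spec hε ht hu
  set y := solution ε t u with hydef
  have hylt : ‖y‖ < ε := by
    rw [← hfix]; exact (norm_solveMap_le hε ht hu hy).trans_lt (by linarith)
  have k0 : solveThree t u (y 1) (y 2) = y 0 := congrFun hfix 0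
  have k1 : solveFive t u (y 0) (y 2) = y 1 := congrFun hfix 1
  have k2 : solveSix t u (y 0) (y 1) = y 2 := congrFun hfix 2
  have y0 : ‖y 0‖ < ε := (norm_le_pi_norm y 0).trans_lt hylt
  have hs := one_sub_slopeSix_ne_zero hε ht hu y0.le
  have e6 : sixOfThree t u (y 0) = y 2 := by
    rw [sixOfThree, div_eq_iff hs]
    have := solveSix_solveFive (t := t) (u := u) (y 0) (y 2)
    rw [k1, k2] at this
    linear_combination -this
  have e5 : fiveOfThree t u (y 0) = y 1 := by rw [fiveOfThree, e6, k1]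
  have D5 := differentiableOn_fiveOfThree hε ht hu
  have D6 := differentiableOn_sixOfThree hε ht hu
  obtain ⟨hd, h⟩ := circleAverage_div_one_sub hε
    (h := fun x₃ => solveThree t u (fiveOfThree t u x₃) (sixOfThree t u x₃))
    (f := fun x₃ => (1 - slopeSix t u x₃)⁻¹) (w := y 0)
    (by
      refine DifferentiableOn.inv ?_ fun z hz =>
        one_sub_slopeSix_ne_zero hε ht hu (by simpa using hz)
      simp only [slopeSix, div_eq_mul_inv]
      fun_prop)
    (by
      simp only [solveThree, div_eq_mul_inv]
      fun_prop)
    (fun z w hz hw => by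
      obtain ⟨h1, h2⟩ := norm_ofThree_sub_le hε ht hu hz hw
      exact norm_solveThree_sub_le hε ht hu (norm_sixOfThree_lt hε ht hu hz).le
        (norm_sixOfThree_lt hε ht hu hw).le h1 h2)
    y0 (by rw [e5, e6, k0])
  have hnhds : Metric.closedBall (0 : ℂ) ε ∈ 𝓝 (y 0) :=
    Filter.mem_of_superset (Metric.isOpen_ball.mem_nhds (by simpa using y0))
      Metric.ball_subset_closedBall
  have H5 : HasDerivAt (fiveOfThree t u) (deriv (fiveOfThree t u) (y 0)) (y 0) :=
    (D5.differentiableAt hnhds).hasDerivAt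
  have H6 : HasDerivAt (sixOfThree t u) (deriv (sixOfThree t u) (y 0)) (y 0) :=
    (D6.differentiableAt hnhds).hasDerivAt
  set d5 := deriv (fiveOfThree t u) (y 0)
  set d6 := deriv (sixOfThree t u) (y 0)
  have hsq : HasDerivAt (fun x₃ : ℂ => u 1 ^ 2 + x₃ ^ 2) (2 * y 0) (y 0) := by
    simpa using (hasDerivAt_pow 2 (y 0)).const_add (u 1 ^ 2)
  -- Implicit differentiation of the equations for `x₅` and `x₆` with respect to `x₃` gives a linear
  -- system for `d5, d6`.
  have E5 : d5 = (t ^ 2 * d6 * (u 1 ^ 2 + y 0 ^ 2) + t ^ 2 * y 2 * (2 * y 0)) / u 2 := by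
    have := ((((H6.const_mul (t ^ 2)).mul hsq).const_add (t * u 0 * (1 + u 0 ^ 2))).div_const (u 2))
    rw [e6] at this
    exact H5.unique this
  have E6 : d6 = (t ^ 2 * d5 * (u 1 ^ 2 + y 0 ^ 2) + t ^ 2 * y 1 * (2 * y 0)) / u 0 := by
    have := ((((H5.const_mul (t ^ 2)).mul hsq).const_add (t * u 2 ^ 2)).div_const (u 0))
    rw [e5] at this
    refine H6.unique (this.congr_of_eventuallyEq ?_)
    filter_upwards [hnhds] with z hz
    exact (solveSix_fiveOfThree hε ht hu (by simpa using hz)).symm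
  have E3 : deriv (fun x₃ => solveThree t u (fiveOfThree t u x₃) (sixOfThree t u x₃)) (y 0) =
      (t * (2 * y 2 * d6) + t ^ 2 * d5 * (1 + u 0 ^ 2)) / (u 2 * u 1) := by
    have := (((H6.pow 2).const_mul t).add ((H5.const_mul (t ^ 2)).mul_const (1 + u 0 ^ 2))).div_const
      (u 2 * u 1)
    rw [e6] at this
    refine HasDerivAt.deriv (this.congr_deriv ?_)
    simp
  have n0 := ne_zero_of_mem_torus hε hu 0
  have n1 := ne_zero_of_mem_torus hε hu 1
  have n2 := ne_zero_of_mem_torus hε hu 2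
  -- Eliminating the variables one after another factors the Jacobian determinant: each residue
  -- contributes one factor, the one for `x₅` being `1`. The monomial comes from the coefficients `u
  -- 2 * u 1`, `u 2`, `u 0` by which the three pfaffians were divided.
  have hJ : jacobian t (chartPoint u y) = u 0 * u 1 * u 2 ^ 2 * ((1 - slopeSix t u (y 0)) *
      (1 - deriv (fun x₃ => solveThree t u (fiveOfThree t u x₃) (sixOfThree t u x₃)) (y 0))) := by
    have hj : jacobian t (chartPoint u y) =
        1 * u 0 * u 1 * u 2 ^ 2 - t ^ 4 * u 1 * u 2 * (u 1 ^ 2 + y 0 ^ 2) ^ 2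
      - 2 * t ^ 4 * 1 * u 0 * y 0 * y 2 * (1 ^ 2 + u 0 ^ 2)
      - 4 * t ^ 5 * y 0 * y 2 ^ 2 * (u 1 ^ 2 + y 0 ^ 2) - 4 * t ^ 3 * y 0 * u 2 * y 1 * y 2
      - 2 * t ^ 6 * y 0 * y 1 * (1 ^ 2 + u 0 ^ 2) * (u 1 ^ 2 + y 0 ^ 2) := jacobian_eq _ _
    rw [hj, E3, slopeSix]
    rw [eq_div_iff n2] at E5
    rw [eq_div_iff n0] at E6
    have F5 : (u 0 * u 2 - t ^ 4 * (u 1 ^ 2 + y 0 ^ 2) ^ 2) * d5 =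
        t ^ 4 * y 1 * (2 * y 0) * (u 1 ^ 2 + y 0 ^ 2) + u 0 * t ^ 2 * y 2 * (2 * y 0) := by
      linear_combination u 0 * E5 + t ^ 2 * (u 1 ^ 2 + y 0 ^ 2) * E6
    have F6 : (u 0 * u 2 - t ^ 4 * (u 1 ^ 2 + y 0 ^ 2) ^ 2) * d6 =
        t ^ 4 * y 2 * (2 * y 0) * (u 1 ^ 2 + y 0 ^ 2) + u 2 * t ^ 2 * y 1 * (2 * y 0) := by
      linear_combination u 2 * E6 + t ^ 2 * (u 1 ^ 2 + y 0 ^ 2) * E5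
    field_simp
    linear_combination 2 * t * y 2 * F6 + t ^ 2 * (1 + u 0 ^ 2) * F5
  have hd' := one_sub_ne_zero_of_norm_le hd
  refine ⟨by rw [hJ]; exact mul_ne_zero (by positivity) (mul_ne_zero hs hd'), ?_⟩
  rw [hJ, Real.circleAverage_congr_sphere (f₂ := fun x₃ => (1 - slopeSix t u x₃)⁻¹ /
        (1 - solveThree t u (fiveOfThree t u x₃) (sixOfThree t u x₃) / x₃)), h]
  · field_simp
  · intro z hz
    exact circleAverage_kernel_six hε ht hu (by simpa [abs_of_pos hε] using hz)

end kernel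

/-! ### Averages over circles and tori -/

open MeasureTheory

lemma norm_circleMap_zero {R : ℝ} (hR : 0 < R) (θ : ℝ) : ‖circleMap 0 R θ‖ = R := by
  simp [abs_of_pos hR]

lemma continuous_comp_circleMap {F : ℂ → ℂ} {R : ℝ} (hR : 0 < R)
    (hF : ContinuousOn F (Metric.sphere 0 R)) : Continuous fun θ => F (circleMap 0 R θ) :=
  hF.comp_continuous (by fun_prop) fun θ => by simp [abs_of_pos hR]

lemma circleIntegrable_of_continuousOn {F : ℂ → ℂ} {R : ℝ} (hR : 0 < R)
    (hF : ContinuousOn F (Metric.sphere 0 R)) : CircleIntegrable F 0 R :=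
  hF.circleIntegrable hR.le

lemma hasSum_circleAverage {ι : Type*} [Countable ι] {F : ι → ℂ → ℂ} {f : ℂ → ℂ} {B : ι → ℝ}
    {R : ℝ} (hR : 0 < R) (hc : ∀ i, ContinuousOn (F i) (Metric.sphere 0 R))
    (hb : ∀ i z, ‖z‖ = R → ‖F i z‖ ≤ B i) (hB : Summable B)
    (h : ∀ z, ‖z‖ = R → HasSum (fun i => F i z) (f z)) :
    HasSum (fun i => circleAverage (F i) 0 R) (circleAverage f 0 R) := by
  refine HasSum.const_smul _ ?_
  refine intervalIntegral.hasSum_integral_of_dominated_convergence (fun i _ => B i)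
    (fun i => (continuous_comp_circleMap hR (hc i)).aestronglyMeasurable)
    (fun i => Eventually.of_forall fun θ _ => hb i _ (norm_circleMap_zero hR θ))
    (Eventually.of_forall fun _ _ => hB) ?_
    (Eventually.of_forall fun θ _ => h _ (norm_circleMap_zero hR θ))
  exact intervalIntegrable_const

lemma norm_circleAverage_le {F : ℂ → ℂ} {R b : ℝ} (hR : 0 < R)
    (hb : ∀ z, ‖z‖ = R → ‖F z‖ ≤ b) : ‖circleAverage F 0 R‖ ≤ b := by
  have h := intervalIntegral.norm_integral_le_of_norm_le_const (a := 0) (b := 2 * π)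
    (f := fun θ => F (circleMap 0 R θ)) (C := b) fun θ _ => hb _ (norm_circleMap_zero hR θ)
  rw [circleAverage, norm_smul, norm_inv, Real.norm_of_nonneg (by positivity),
    inv_mul_le_iff₀ (by positivity)]
  rw [sub_zero, abs_of_pos (by positivity)] at h
  linarith

lemma circleAverage_const_mul (a : ℂ) (f : ℂ → ℂ) (R : ℝ) :
    circleAverage (fun z => a * f z) 0 R = a * circleAverage f 0 R :=
  Real.circleAverage_fun_smul (a := a) (f := f)

lemma continuousOn_pow_mul_inv_pow {R : ℝ} (hR : 0 < R) (m n : ℕ) :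
    ContinuousOn (fun z : ℂ => z ^ m * z⁻¹ ^ n) (Metric.sphere 0 R) := by
  refine (continuousOn_id.pow m).mul ((continuousOn_inv₀.mono fun z hz => ?_).pow n)
  have : ‖z‖ = R := by simpa using hz
  exact norm_pos_iff.1 (this ▸ hR)

lemma circleAverage_pow_mul_inv_pow {R : ℝ} (hR : 0 < R) (m n : ℕ) :
    circleAverage (fun z => z ^ m * z⁻¹ ^ n) 0 R = if m = n then 1 else 0 := by
  rw [Real.circleAverage_eq_circleIntegral hR.ne']
  have h : (∮ z in C(0, R), (z - 0)⁻¹ • (z ^ m * z⁻¹ ^ n)) =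
      ∮ z in C(0, R), (z - 0) ^ ((m : ℤ) - n - 1) := by
    refine circleIntegral.integral_congr hR.le fun z hz => ?_
    have hz0 : z ≠ 0 := by
      have : ‖z‖ = R := by simpa using hz
      exact norm_pos_iff.1 (this ▸ hR)
    simp only [sub_zero, smul_eq_mul]
    rw [zpow_sub₀ hz0, zpow_sub₀ hz0, zpow_natCast, zpow_natCast, zpow_one, inv_pow]
    field_simp
  rw [h]
  split_ifs with hmn
  · subst hmn
    simp only [sub_self, zero_sub, zpow_neg, zpow_one]
    rw [circleIntegral.integral_sub_center_inv 0 hR.ne', smul_eq_mul, inv_mul_cancel₀]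
    simp [Real.pi_ne_zero]
  · rw [circleIntegral.integral_sub_zpow_of_ne (by omega), smul_zero]

lemma continuousOn_binomial {R : ℝ} (hR : 0 < R) (w : ℂ) (M c L : ℕ) :
    ContinuousOn (fun z : ℂ => (w ^ 2 + z ^ 2) ^ M * (z ^ c * z⁻¹ ^ L)) (Metric.sphere 0 R) :=
  ContinuousOn.mul (by fun_prop) (continuousOn_pow_mul_inv_pow hR c L)

/-- The average extracts the coefficient of `z ^ l` in `(w² + z²) ^ M`. For `l > 2 M` the truncated
exponent of `w` is harmless since the binomial coefficient vanishes. -/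
lemma circleAverage_binomial {R : ℝ} (hR : 0 < R) (w : ℂ) (M c l : ℕ) :
    circleAverage (fun z => (w ^ 2 + z ^ 2) ^ M * (z ^ c * z⁻¹ ^ (c + l))) 0 R =
      if Even l then M.choose (l / 2) * w ^ (2 * M - l) else 0 := by
  have h : (fun z : ℂ => (w ^ 2 + z ^ 2) ^ M * (z ^ c * z⁻¹ ^ (c + l))) = fun z =>
      ∑ k ∈ Finset.range (M + 1), (M.choose k * w ^ (2 * (M - k))) *
        (z ^ (2 * k + c) * z⁻¹ ^ (c + l)) := by
    funext z
    rw [add_comm, add_pow, Finset.sum_mul]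
    refine Finset.sum_congr rfl fun k _ => ?_
    rw [← pow_mul, ← pow_mul, pow_add z]
    ring
  have hsum := Real.circleAverage_fun_sum (c := 0) (R := R) (s := Finset.range (M + 1))
    (f := fun k z => (M.choose k * w ^ (2 * (M - k))) * (z ^ (2 * k + c) * z⁻¹ ^ (c + l)))
    fun k _ => circleIntegrable_of_continuousOn hR
      (continuousOn_const.mul (continuousOn_pow_mul_inv_pow hR _ _))
  rw [h, hsum]
  simp only [circleAverage_const_mul, circleAverage_pow_mul_inv_pow hR]
  split_ifs with hl
  · obtain ⟨r, rfl⟩ := hl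
    rw [show (r + r) / 2 = r by omega]
    rcases le_or_gt r M with hr | hr
    · rw [Finset.sum_eq_single_of_mem r (by simpa [Nat.lt_succ_iff] using hr)
        fun k _ hk => by rw [if_neg (by omega), mul_zero]]
      rw [if_pos (by omega), mul_one, show 2 * (M - r) = 2 * M - (r + r) by omega]
    · rw [Nat.choose_eq_zero_of_lt hr, Nat.cast_zero, zero_mul]
      refine Finset.sum_eq_zero fun k hk => ?_
      rw [Finset.mem_range] at hk
      rw [if_neg (by omega), mul_zero]
  · refine Finset.sum_eq_zero fun k hk => ?_
    rw [if_neg, mul_zero]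
    rintro h2
    exact hl ⟨k, by omega⟩

/-- The average of a function over a three-dimensional torus. -/
def torusAverage (R : ℝ) (f : (Fin 3 → ℂ) → ℂ) : ℂ :=
  ((2 * π : ℂ) ^ 3)⁻¹ * ∫ θ in Set.Icc (0 : Fin 3 → ℝ) fun _ => 2 * π,
    f (torusMap 0 (fun _ => R) θ)

lemma torusMap_mem_torus {R : ℝ} (hR : 0 < R) (θ : Fin 3 → ℝ) :
    torusMap (0 : Fin 3 → ℂ) (fun _ => R) θ ∈ torus R := fun i => by
  simp [torusMap, abs_of_pos hR]

/-- From `du = i u dθ` in each variable: the product of the coordinates turns the form into `dθ`,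
and `i³` cancels against `(2πi)³`. -/
lemma torusIntegral_eq_torusAverage {R : ℝ} (hR : 0 < R) {f g : (Fin 3 → ℂ) → ℂ}
    (h : ∀ u ∈ torus R, u 0 * u 1 * u 2 * f u = ((2 * π * Complex.I) ^ 3)⁻¹ * g u) :
    torusIntegral f 0 (fun _ => R) = torusAverage R g := by
  rw [torusIntegral, torusAverage, ← integral_const_mul]
  congr 1
  funext θ
  have h1 := h _ (torusMap_mem_torus hR θ)
  have h2 : ∀ i, (R : ℂ) * Complex.exp (θ i * Complex.I) =
      torusMap (0 : Fin 3 → ℂ) (fun _ => R) θ i := fun i => by simp [torusMap]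
  rw [Fin.prod_univ_three, h2, h2, h2, smul_eq_mul]
  have hI : Complex.I ^ 3 * (Complex.I ^ 3)⁻¹ = 1 := mul_inv_cancel₀ (by simp)
  rw [mul_pow, mul_inv] at h1
  generalize torusMap (0 : Fin 3 → ℂ) (fun _ => R) θ = u at *
  linear_combination Complex.I ^ 3 * h1 + ((2 * π : ℂ) ^ 3)⁻¹ * g u * hI

lemma torusAverage_prod {R : ℝ} (a : ℂ) (g : Fin 3 → ℂ → ℂ) :
    torusAverage R (fun u => a * ∏ k, g k (u k)) = a * ∏ k, circleAverage (g k) 0 R := by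
  have h1 : (volume.restrict (Set.Icc (0 : Fin 3 → ℝ) fun _ => 2 * π)) =
      Measure.pi fun _ : Fin 3 => (volume : Measure ℝ).restrict (Set.Icc 0 (2 * π)) := by
    rw [← Set.pi_univ_Icc, volume_pi, Measure.restrict_pi_pi]
    rfl
  have h2 : ∀ k, circleAverage (g k) 0 R = (2 * π : ℂ)⁻¹ *
      ∫ θ : ℝ, g k (circleMap 0 R θ) ∂((volume : Measure ℝ).restrict (Set.Icc 0 (2 * π))) := by
    intro k
    rw [circleAverage, intervalIntegral.integral_of_le (by positivity),
      ← integral_Icc_eq_integral_Ioc, Complex.real_smul]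
    push_cast
    rfl
  have h3 := integral_fintype_prod_eq_prod (𝕜 := ℂ) (fun k (x : ℝ) => g k (circleMap 0 R x))
    (μ := fun _ : Fin 3 => (volume : Measure ℝ).restrict (Set.Icc 0 (2 * π)))
  have h4 : ∀ (θ : Fin 3 → ℝ) (k : Fin 3), torusMap (0 : Fin 3 → ℂ) (fun _ => R) θ k =
      circleMap 0 R (θ k) := fun θ k => by simp [torusMap, circleMap]
  rw [torusAverage, h1]
  simp only [h4]
  rw [integral_const_mul, h3]
  simp only [h2]
  rw [Finset.prod_mul_distrib, Finset.prod_const, Finset.card_univ, Fintype.card_fin, inv_pow]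
  ring

lemma hasSum_torusAverage {ι : Type*} [Countable ι] {F : ι → (Fin 3 → ℂ) → ℂ}
    {f : (Fin 3 → ℂ) → ℂ} {B : ι → ℝ} {R : ℝ} (hR : 0 < R) (hc : ∀ i, ContinuousOn (F i) (torus R))
    (hb : ∀ i, ∀ u ∈ torus R, ‖F i u‖ ≤ B i) (hB : Summable B)
    (h : ∀ u ∈ torus R, HasSum (fun i => F i u) (f u)) :
    HasSum (fun i => torusAverage R (F i)) (torusAverage R f) := by
  have hcm : Continuous fun θ : Fin 3 → ℝ => torusMap (0 : Fin 3 → ℂ) (fun _ => R) θ := by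
    unfold torusMap
    fun_prop
  refine HasSum.mul_left _ ?_
  refine hasSum_integral_of_dominated_convergence (fun i _ => B i)
    (fun i => ((hc i).comp_continuous hcm fun θ => torusMap_mem_torus hR θ).aestronglyMeasurable)
    (fun i => Eventually.of_forall fun θ => hb i _ (torusMap_mem_torus hR θ))
    (Eventually.of_forall fun _ => hB) ?_
    (Eventually.of_forall fun θ => h _ (torusMap_mem_torus hR θ))
  have : IsFiniteMeasure ((volume : Measure (Fin 3 → ℝ)).restrict
      (Set.Icc (0 : Fin 3 → ℝ) fun _ => 2 * π)) := ⟨by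
    rw [Measure.restrict_apply_univ]
    exact isCompact_Icc.measure_lt_top⟩
  exact integrable_const _

/-! ### The expansion of the integrand -/

/-- The term of bidegree `p` in the expansion of `(1 - (y + z))⁻¹`. -/
def binomialTerm {R : Type*} [CommSemiring R] (y z : R) (p : ℕ × ℕ) : R :=
  (p.1 + p.2).choose p.2 * (y ^ p.1 * z ^ p.2)

lemma sum_antidiagonal_binomialTerm {R : Type*} [CommSemiring R] (y z : R) (n : ℕ) :
    ∑ p ∈ Finset.HasAntidiagonal.antidiagonal n, binomialTerm y z p = (y + z) ^ n := by
  rw [(Commute.all y z).add_pow']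
  refine Finset.sum_congr rfl fun p hp => ?_
  rw [Finset.HasAntidiagonal.mem_antidiagonal] at hp
  rw [binomialTerm, nsmul_eq_mul, ← hp, ← Nat.choose_symm_add]

/-- Summed along antidiagonals the double series is the geometric series of `y + z`. -/
lemma summable_binomialTerm {y z : ℝ} (hy : 0 ≤ y) (hz : 0 ≤ z) (h : y + z < 1) :
    Summable (binomialTerm y z) := by
  rw [← Finset.HasAntidiagonal.sigmaAntidiagonalEquivProd.summable_iff, summable_sigma_of_nonneg]
  · refine ⟨fun n => Summable.of_finite, ?_⟩
    refine (summable_geometric_of_lt_one (add_nonneg hy hz) h).congr fun n => ?_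
    rw [tsum_fintype, ← sum_antidiagonal_binomialTerm, ← Finset.sum_coe_sort]
    rfl
  · intro p
    simp only [Function.comp, binomialTerm]
    positivity

lemma binomialTerm_nonneg {y z : ℝ} (hy : 0 ≤ y) (hz : 0 ≤ z) (p : ℕ × ℕ) :
    0 ≤ binomialTerm y z p := by
  unfold binomialTerm
  positivity

lemma norm_binomialTerm_le {y z : ℂ} {a b : ℝ} (hy : ‖y‖ ≤ a) (hz : ‖z‖ ≤ b) (p : ℕ × ℕ) :
    ‖binomialTerm y z p‖ ≤ binomialTerm a b p := by
  have ha := (norm_nonneg y).trans hy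
  rw [binomialTerm, binomialTerm, norm_mul, norm_mul, norm_pow, norm_pow, Complex.norm_natCast]
  gcongr

lemma hasSum_binomialTerm {y z : ℂ} {a b : ℝ} (hy : ‖y‖ ≤ a) (hz : ‖z‖ ≤ b) (h : a + b < 1) :
    HasSum (binomialTerm y z) (1 - (y + z))⁻¹ := by
  have hs : Summable (binomialTerm y z) :=
    (summable_binomialTerm ((norm_nonneg y).trans hy) ((norm_nonneg z).trans hz) h).of_norm_bounded
      (norm_binomialTerm_le hy hz)
  have h1 := (Finset.HasAntidiagonal.sigmaAntidiagonalEquivProd.hasSum_iff.2 hs.hasSum).sigma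
    fun n => hasSum_fintype _
  have h2 : HasSum (fun n => (y + z) ^ n) (1 - (y + z))⁻¹ :=
    hasSum_geometric_of_norm_lt_one (((norm_add_le y z).trans (add_le_add hy hz)).trans_lt h)
  have h3 : HasSum (fun n => (y + z) ^ n) (∑' p, binomialTerm y z p) := by
    refine h1.congr_fun fun n => ?_
    rw [← sum_antidiagonal_binomialTerm, ← Finset.sum_coe_sort]
    rfl
  rw [← h3.unique h2]
  exact hs.hasSum

lemma hasSum_mul {ι κ : Type*} {f : ι → ℂ} {g : κ → ℂ} {a b : ℂ} (hf : HasSum f a)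
    (hg : HasSum g b) : HasSum (fun p : ι × κ => f p.1 * g p.2) (a * b) :=
  hf.mul hg (summable_mul_of_summable_norm hf.summable.norm hg.summable.norm)

lemma hasSum_triple_mul {ι κ ν : Type*} {f : ι → ℂ} {g : κ → ℂ} {h : ν → ℂ} {a b c : ℂ}
    (hf : HasSum f a) (hg : HasSum g b) (hh : HasSum h c) :
    HasSum (fun p : ι × κ × ν => f p.1 * (g p.2.1 * h p.2.2)) (a * (b * c)) := by
  have h1 := hasSum_mul hg hh
  have h2 : HasSum (fun p : ι × (κ × ν) => f p.1 * (fun q : κ × ν => g q.1 * h q.2) p.2)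
      (a * (b * c)) := by
    apply hasSum_mul hf h1
  exact h2

/-- The terms of the expansion of `kernel`, indexed by the exponents of the two terms in each of
`solveSix`, `solveThree` and `solveFive`. -/
def kernelTerm (t : ℂ) (u : Fin 3 → ℂ) (x₃ x₅ x₆ : ℂ) (i : (ℕ × ℕ) × (ℕ × ℕ) × (ℕ × ℕ)) : ℂ :=
  binomialTerm (t * u 2 ^ 2 / (u 0 * x₆)) (t ^ 2 * (x₅ * (u 1 ^ 2 + x₃ ^ 2)) / (u 0 * x₆)) i.1 *
    (binomialTerm (t * x₆ ^ 2 / (u 2 * u 1 * x₃)) (t ^ 2 * (x₅ * (1 + u 0 ^ 2)) / (u 2 * u 1 * x₃))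
        i.2.1 *
      binomialTerm (t * (u 0 * (1 + u 0 ^ 2)) / (u 2 * x₅))
        (t ^ 2 * (x₆ * (u 1 ^ 2 + x₃ ^ 2)) / (u 2 * x₅)) i.2.2)

/-- A bound for `kernelTerm` on the torus of radius `ε`. -/
def kernelBound (ε r : ℝ) (i : (ℕ × ℕ) × (ℕ × ℕ) × (ℕ × ℕ)) : ℝ :=
  binomialTerm (r * ε ^ 2 / ε ^ 2) (r * (ε * (2 * ε ^ 2)) / ε ^ 2) i.1 *
    (binomialTerm (r * ε ^ 2 / ε ^ 3) (r * (ε * (1 + ε ^ 2)) / ε ^ 3) i.2.1 *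
      binomialTerm (r * (ε * (1 + ε ^ 2)) / ε ^ 2) (r * (ε * (2 * ε ^ 2)) / ε ^ 2) i.2.2)

section expansion

variable {ε : ℝ} {t : ℂ} {u : Fin 3 → ℂ} {x₃ x₅ x₆ : ℂ}

lemma norm_mul_div_le {a d : ℂ} {A D : ℝ} (hD : 0 < D) (ha : ‖a‖ ≤ A) (hd : ‖d‖ = D) :
    ‖t * a / d‖ ≤ ‖t‖ * A / D := by
  rw [norm_div, norm_mul, hd]
  gcongr

lemma norm_sq_mul_div_le {a d : ℂ} {A D : ℝ} (ht : ‖t‖ ≤ 1) (hD : 0 < D) (ha : ‖a‖ ≤ A)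
    (hd : ‖d‖ = D) : ‖t ^ 2 * a / d‖ ≤ ‖t‖ * A / D := by
  have : ‖t‖ ^ 2 ≤ ‖t‖ := by nlinarith [norm_nonneg t]
  have hA : 0 ≤ A := (norm_nonneg a).trans ha
  rw [norm_div, norm_mul, hd, norm_pow]
  gcongr

lemma summable_kernelBound (hε : 0 < ε) (ht : IsSmall ε t) : Summable (kernelBound ε ‖t‖) := by
  have key : ∀ {A B D : ℝ}, 0 < D → 0 ≤ A → 0 ≤ B → ‖t‖ * (A + B) ≤ D / 4 →
      Summable (fun p => binomialTerm (‖t‖ * A / D) (‖t‖ * B / D) p) ∧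
      ∀ p, 0 ≤ binomialTerm (‖t‖ * A / D) (‖t‖ * B / D) p := fun {A B D} hD hA hB h =>
    ⟨summable_binomialTerm (by positivity) (by positivity) (by
      rw [← add_div, ← mul_add, div_lt_one hD]
      linarith), binomialTerm_nonneg (by positivity) (by positivity)⟩
  obtain ⟨s6, p6⟩ := key (A := ε ^ 2) (B := ε * (2 * ε ^ 2)) (D := ε ^ 2) (by positivity)
    (by positivity) (by positivity) ht.six
  obtain ⟨s3, p3⟩ := key (A := ε ^ 2) (B := ε * (1 + ε ^ 2)) (D := ε ^ 3) (by positivity)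
    (by positivity) (by positivity) ht.three
  obtain ⟨s5, p5⟩ := key (A := ε * (1 + ε ^ 2)) (B := ε * (2 * ε ^ 2)) (D := ε ^ 2)
    (by positivity) (by positivity) (by positivity) ht.five
  exact s6.mul_of_nonneg (s3.mul_of_nonneg s5 p3 p5) p6 fun i => mul_nonneg (p3 i.1) (p5 i.2)

lemma norm_factors_le (hε : 0 < ε) (ht : IsSmall ε t) (hu : u ∈ torus ε) (h₃ : ‖x₃‖ = ε)
    (h₅ : ‖x₅‖ = ε) (h₆ : ‖x₆‖ = ε) :
    (‖t * u 2 ^ 2 / (u 0 * x₆)‖ ≤ ‖t‖ * ε ^ 2 / ε ^ 2 ∧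
      ‖t ^ 2 * (x₅ * (u 1 ^ 2 + x₃ ^ 2)) / (u 0 * x₆)‖ ≤ ‖t‖ * (ε * (2 * ε ^ 2)) / ε ^ 2) ∧
    (‖t * x₆ ^ 2 / (u 2 * u 1 * x₃)‖ ≤ ‖t‖ * ε ^ 2 / ε ^ 3 ∧
      ‖t ^ 2 * (x₅ * (1 + u 0 ^ 2)) / (u 2 * u 1 * x₃)‖ ≤ ‖t‖ * (ε * (1 + ε ^ 2)) / ε ^ 3) ∧
    (‖t * (u 0 * (1 + u 0 ^ 2)) / (u 2 * x₅)‖ ≤ ‖t‖ * (ε * (1 + ε ^ 2)) / ε ^ 2 ∧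
      ‖t ^ 2 * (x₆ * (u 1 ^ 2 + x₃ ^ 2)) / (u 2 * x₅)‖ ≤ ‖t‖ * (ε * (2 * ε ^ 2)) / ε ^ 2) := by
  have hs := norm_sq_add_sq_le (hu 1).le h₃.le
  have h1 := norm_one_add_sq_le (hu 0).le
  have hmul : ∀ {a b : ℂ} {B : ℝ}, ‖a‖ = ε → ‖b‖ ≤ B → ‖a * b‖ ≤ ε * B := fun ha hb => by
    rw [norm_mul, ha]
    gcongr
  have h6 : ‖u 0 * x₆‖ = ε ^ 2 := by rw [norm_mul, hu 0, h₆, sq]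
  have h5 : ‖u 2 * x₅‖ = ε ^ 2 := by rw [norm_mul, hu 2, h₅, sq]
  have h3 : ‖u 2 * u 1 * x₃‖ = ε ^ 3 := by rw [norm_mul, norm_mul, hu 2, hu 1, h₃]; ring
  have e2 : 0 < ε ^ 2 := by positivity
  have e3 : 0 < ε ^ 3 := by positivity
  exact ⟨⟨norm_mul_div_le e2 (by rw [norm_pow, hu 2]) h6,
      norm_sq_mul_div_le ht.le_one e2 (hmul h₅ hs) h6⟩,
    ⟨norm_mul_div_le e3 (by rw [norm_pow, h₆]) h3,
      norm_sq_mul_div_le ht.le_one e3 (hmul h₅ h1) h3⟩,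
    ⟨norm_mul_div_le e2 (hmul (hu 0) h1) h5, norm_sq_mul_div_le ht.le_one e2 (hmul h₆ hs) h5⟩⟩

lemma norm_kernelTerm_le (hε : 0 < ε) (ht : IsSmall ε t) (hu : u ∈ torus ε) (h₃ : ‖x₃‖ = ε)
    (h₅ : ‖x₅‖ = ε) (h₆ : ‖x₆‖ = ε) (i : (ℕ × ℕ) × (ℕ × ℕ) × (ℕ × ℕ)) :
    ‖kernelTerm t u x₃ x₅ x₆ i‖ ≤ kernelBound ε ‖t‖ i := by
  obtain ⟨⟨a1, a2⟩, ⟨b1, b2⟩, c1, c2⟩ := norm_factors_le hε ht hu h₃ h₅ h₆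
  have hA := norm_binomialTerm_le a1 a2 i.1
  have hB := norm_binomialTerm_le b1 b2 i.2.1
  have hC := norm_binomialTerm_le c1 c2 i.2.2
  rw [kernelTerm, kernelBound, norm_mul, norm_mul]
  have := (norm_nonneg _).trans hA
  have := (norm_nonneg _).trans hB
  gcongr

lemma hasSum_kernelTerm (hε : 0 < ε) (ht : IsSmall ε t) (hu : u ∈ torus ε) (h₃ : ‖x₃‖ = ε)
    (h₅ : ‖x₅‖ = ε) (h₆ : ‖x₆‖ = ε) :
    HasSum (kernelTerm t u x₃ x₅ x₆) (kernel t u x₃ x₅ x₆) := by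
  obtain ⟨⟨a1, a2⟩, ⟨b1, b2⟩, c1, c2⟩ := norm_factors_le hε ht hu h₃ h₅ h₆
  have key : ∀ {A B D : ℝ}, 0 < D → ‖t‖ * (A + B) ≤ D / 4 → ‖t‖ * A / D + ‖t‖ * B / D < 1 :=
    fun {A B D} hD h => by
      rw [← add_div, ← mul_add, div_lt_one hD]
      linarith
  have l6 := key (by positivity) ht.six
  have l3 := key (by positivity) ht.three
  have l5 := key (by positivity) ht.five
  have hA := hasSum_binomialTerm a1 a2 l6
  have hB := hasSum_binomialTerm b1 b2 l3
  have hC := hasSum_binomialTerm c1 c2 l5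
  have e3 : solveThree t u x₅ x₆ / x₃ = t * x₆ ^ 2 / (u 2 * u 1 * x₃)
      + t ^ 2 * (x₅ * (1 + u 0 ^ 2)) / (u 2 * u 1 * x₃) := by
    rw [solveThree, div_div, ← add_div, mul_assoc (t ^ 2)]
  have e5 : solveFive t u x₃ x₆ / x₅ = t * (u 0 * (1 + u 0 ^ 2)) / (u 2 * x₅)
      + t ^ 2 * (x₆ * (u 1 ^ 2 + x₃ ^ 2)) / (u 2 * x₅) := by
    rw [solveFive, div_div, ← add_div, mul_assoc (t ^ 2), mul_assoc t]
  have e6 : solveSix t u x₃ x₅ / x₆ = t * u 2 ^ 2 / (u 0 * x₆)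
      + t ^ 2 * (x₅ * (u 1 ^ 2 + x₃ ^ 2)) / (u 0 * x₆) := by
    rw [solveSix, div_div, ← add_div, mul_assoc (t ^ 2)]
  rw [kernel, e3, e5, e6, mul_comm, mul_inv, mul_inv]
  exact hasSum_triple_mul hA hB hC

end expansion

/-! ### The residues of the terms -/

/-- The coefficient of the monomial `kernelTerm`. -/
def monomialCoeff (t : ℂ) (i : (ℕ × ℕ) × (ℕ × ℕ) × (ℕ × ℕ)) : ℂ :=
  (i.1.1 + i.1.2).choose i.1.2 * (i.2.1.1 + i.2.1.2).choose i.2.1.2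
    * (i.2.2.1 + i.2.2.2).choose i.2.2.2
    * t ^ (i.1.1 + 2 * i.1.2 + i.2.1.1 + 2 * i.2.1.2 + i.2.2.1 + 2 * i.2.2.2)

/-- The factor of `kernelTerm` that depends on `u` only. -/
def torusFactor (i : (ℕ × ℕ) × (ℕ × ℕ) × (ℕ × ℕ)) : Fin 3 → ℂ → ℂ :=
  ![fun z => (1 ^ 2 + z ^ 2) ^ (i.2.1.2 + i.2.2.1) * (z ^ i.2.2.1 * z⁻¹ ^ (i.1.1 + i.1.2)),
    fun z => z ^ (2 * (i.1.2 + i.2.2.2) - (i.2.1.1 + i.2.1.2)) * z⁻¹ ^ (i.2.1.1 + i.2.1.2),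
    fun z => z ^ (2 * i.1.1) * z⁻¹ ^ (i.2.1.1 + i.2.1.2 + i.2.2.1 + i.2.2.2)]

/-- The variables are separated except for `u 1` and `x₃`, which remain coupled through `u 1 ^ 2 +
x₃ ^ 2`; the average over `x₃` decouples them. The exponents `0` and `0 + _` fit the form of
`circleAverage_binomial`. -/
lemma kernelTerm_eq (t : ℂ) (u : Fin 3 → ℂ) (x₃ x₅ x₆ : ℂ) (i : (ℕ × ℕ) × (ℕ × ℕ) × (ℕ × ℕ)) :
    kernelTerm t u x₃ x₅ x₆ i = monomialCoeff t i * torusFactor i 0 (u 0) * torusFactor i 2 (u 2)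
      * (u 1)⁻¹ ^ (i.2.1.1 + i.2.1.2)
      * ((u 1 ^ 2 + x₃ ^ 2) ^ (i.1.2 + i.2.2.2) * (x₃ ^ 0 * x₃⁻¹ ^ (0 + (i.2.1.1 + i.2.1.2))))
      * (x₆ ^ (2 * i.2.1.1 + i.2.2.2) * x₆⁻¹ ^ (i.1.1 + i.1.2))
      * (x₅ ^ (i.1.2 + i.2.1.2) * x₅⁻¹ ^ (i.2.2.1 + i.2.2.2)) := by
  obtain ⟨⟨a, i⟩, ⟨b, q⟩, c, p⟩ := i
  change _ = ((a + i).choose i * (b + q).choose q * (c + p).choose p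
    * t ^ (a + 2 * i + b + 2 * q + c + 2 * p)) *
    ((1 ^ 2 + u 0 ^ 2) ^ (q + c) * (u 0 ^ c * (u 0)⁻¹ ^ (a + i)))
    * (u 2 ^ (2 * a) * (u 2)⁻¹ ^ (b + q + c + p)) * (u 1)⁻¹ ^ (b + q)
    * ((u 1 ^ 2 + x₃ ^ 2) ^ (i + p) * (x₃ ^ 0 * x₃⁻¹ ^ (0 + (b + q))))
    * (x₆ ^ (2 * b + p) * x₆⁻¹ ^ (a + i)) * (x₅ ^ (i + q) * x₅⁻¹ ^ (c + p))
  rw [one_pow]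
  simp only [kernelTerm, binomialTerm, div_eq_mul_inv, mul_inv, mul_pow]
  generalize u 1 ^ 2 + x₃ ^ 2 = s
  generalize 1 + u 0 ^ 2 = v
  generalize x₃⁻¹ = y₃
  generalize x₅⁻¹ = y₅
  generalize x₆⁻¹ = y₆
  generalize (u 0)⁻¹ = y₀
  generalize (u 1)⁻¹ = y₁
  generalize (u 2)⁻¹ = y₂
  simp only [pow_add, pow_mul, pow_zero]
  simp only [← pow_mul]
  ring

section average

variable {ε : ℝ} {t : ℂ}

lemma circleAverage_kernelTerm_five (hε : 0 < ε) (u : Fin 3 → ℂ) (x₃ x₆ : ℂ)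
    (i : (ℕ × ℕ) × (ℕ × ℕ) × (ℕ × ℕ)) :
    circleAverage (fun x₅ => kernelTerm t u x₃ x₅ x₆ i) 0 ε =
      monomialCoeff t i * torusFactor i 0 (u 0) * torusFactor i 2 (u 2)
      * (u 1)⁻¹ ^ (i.2.1.1 + i.2.1.2)
      * ((u 1 ^ 2 + x₃ ^ 2) ^ (i.1.2 + i.2.2.2) * (x₃ ^ 0 * x₃⁻¹ ^ (0 + (i.2.1.1 + i.2.1.2))))
      * (if i.1.2 + i.2.1.2 = i.2.2.1 + i.2.2.2 then 1 else 0)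
      * (x₆ ^ (2 * i.2.1.1 + i.2.2.2) * x₆⁻¹ ^ (i.1.1 + i.1.2)) := by
  simp only [kernelTerm_eq]
  rw [circleAverage_const_mul, circleAverage_pow_mul_inv_pow hε]
  ring

lemma circleAverage_kernelTerm_six (hε : 0 < ε) (u : Fin 3 → ℂ) (x₃ : ℂ)
    (i : (ℕ × ℕ) × (ℕ × ℕ) × (ℕ × ℕ)) :
    circleAverage (fun x₆ => circleAverage (fun x₅ => kernelTerm t u x₃ x₅ x₆ i) 0 ε) 0 ε =
      monomialCoeff t i * torusFactor i 0 (u 0) * torusFactor i 2 (u 2)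
      * (u 1)⁻¹ ^ (i.2.1.1 + i.2.1.2)
      * (if i.1.2 + i.2.1.2 = i.2.2.1 + i.2.2.2 then 1 else 0)
      * (if 2 * i.2.1.1 + i.2.2.2 = i.1.1 + i.1.2 then 1 else 0)
      * ((u 1 ^ 2 + x₃ ^ 2) ^ (i.1.2 + i.2.2.2)
        * (x₃ ^ 0 * x₃⁻¹ ^ (0 + (i.2.1.1 + i.2.1.2)))) := by
  simp only [circleAverage_kernelTerm_five hε]
  rw [circleAverage_const_mul, circleAverage_pow_mul_inv_pow hε]
  ring

/-- The coefficient of the iterated residue of `kernelTerm` along `x₃ = x₅ = x₆ = 0`. -/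
def residueCoeff (t : ℂ) (i : (ℕ × ℕ) × (ℕ × ℕ) × (ℕ × ℕ)) : ℂ :=
  monomialCoeff t i * (if i.1.2 + i.2.1.2 = i.2.2.1 + i.2.2.2 then 1 else 0)
    * (if 2 * i.2.1.1 + i.2.2.2 = i.1.1 + i.1.2 then 1 else 0)
    * (if Even (i.2.1.1 + i.2.1.2) then
        ((i.1.2 + i.2.2.2).choose ((i.2.1.1 + i.2.1.2) / 2) : ℂ) else 0)

lemma circleAverage_kernelTerm (hε : 0 < ε) (u : Fin 3 → ℂ)
    (i : (ℕ × ℕ) × (ℕ × ℕ) × (ℕ × ℕ)) :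
    circleAverage (fun x₃ => circleAverage (fun x₆ => circleAverage
      (fun x₅ => kernelTerm t u x₃ x₅ x₆ i) 0 ε) 0 ε) 0 ε =
      residueCoeff t i * ∏ k, torusFactor i k (u k) := by
  simp only [circleAverage_kernelTerm_six hε]
  rw [circleAverage_const_mul, circleAverage_binomial hε, Fin.prod_univ_three, residueCoeff]
  have h : torusFactor i 1 (u 1) = u 1 ^ (2 * (i.1.2 + i.2.2.2) - (i.2.1.1 + i.2.1.2))
    * (u 1)⁻¹ ^ (i.2.1.1 + i.2.1.2) := rfl
  rw [h]
  by_cases he : Even (i.2.1.1 + i.2.1.2)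
  · rw [if_pos he, if_pos he]
    ring
  · rw [if_neg he, if_neg he]
    ring

/-- The contribution of a term of the expansion of `kernel` to the period. -/
lemma torusAverage_residue (hε : 0 < ε) (i : (ℕ × ℕ) × (ℕ × ℕ) × (ℕ × ℕ)) :
    torusAverage ε (fun u => residueCoeff t i * ∏ k, torusFactor i k (u k)) =
      if i.2.1.1 = i.1.2 ∧ i.2.2.1 = i.1.2 ∧ i.2.1.2 = i.2.2.2 ∧ i.1.1 = i.1.2 + i.2.2.2 ∧
        Even i.1.1 then
      (t ^ 10) ^ (i.1.1 / 2) * (i.1.1.choose (i.1.1 / 2)) ^ 2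
        * (i.1.1.choose i.2.2.2 ^ 2 * (i.1.1 + i.1.2).choose i.1.2) else 0 := by
  rw [torusAverage_prod, Fin.prod_univ_three]
  obtain ⟨⟨a, i⟩, ⟨b, q⟩, c, p⟩ := i
  have h0 : circleAverage (torusFactor ((a, i), (b, q), c, p) 0) 0 ε = circleAverage
    (fun z => (1 ^ 2 + z ^ 2) ^ (q + c) * (z ^ c * z⁻¹ ^ (a + i))) 0 ε := rfl
  have h1 : circleAverage (torusFactor ((a, i), (b, q), c, p) 1) 0 ε = circleAverage
    (fun z => z ^ (2 * (i + p) - (b + q)) * z⁻¹ ^ (b + q)) 0 ε := rfl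
  have h2 : circleAverage (torusFactor ((a, i), (b, q), c, p) 2) 0 ε = circleAverage
    (fun z => z ^ (2 * a) * z⁻¹ ^ (b + q + c + p)) 0 ε := rfl
  rw [h0, h1, h2, circleAverage_pow_mul_inv_pow hε, circleAverage_pow_mul_inv_pow hε]
  simp only [residueCoeff, monomialCoeff]
  by_cases h : b = i ∧ c = i ∧ q = p ∧ a = i + p ∧ Even a
  · rw [if_pos h]
    obtain ⟨rfl, rfl, rfl, rfl, n, hn⟩ := h
    -- The averages over `x₁` and `x₃` each contribute `binom(2n, n)`, where `a = 2 n`; the power of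
    -- `t` is `5 a = 10 n`.
    have hN : circleAverage (fun z : ℂ => (1 ^ 2 + z ^ 2) ^ (q + c)
        * (z ^ c * z⁻¹ ^ (c + q + c))) 0 ε = ((c + q).choose n : ℂ) := by
      rw [add_comm q c, add_comm (c + q) c, circleAverage_binomial hε, if_pos ⟨n, hn⟩, one_pow,
        mul_one, show (c + q) / 2 = n by omega]
    rw [hN, if_pos rfl, if_pos (by omega), if_pos ⟨n, hn⟩, if_pos (by omega), if_pos (by omega),
      show (c + q) / 2 = n by omega, ← pow_mul,
      show c + q + 2 * c + c + 2 * q + c + 2 * q = 10 * n by omega]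
    ring
  · rw [if_neg h]
    by_contra hne
    -- A nonzero contribution forces the exponents of `x₅`, `x₆`, `x₂`, `x₄` to vanish. These four
    -- linear equations have exactly the solutions `b = c = i`, `q = p`, `a = i + p`; the average
    -- over `x₃` adds that `b + q = a` is even.
    have c1 : i + q = c + p := by
      by_contra hc
      exact hne (by rw [if_neg hc]; ring)
    have c2 : 2 * b + p = a + i := by
      by_contra hc
      exact hne (by rw [if_neg hc]; ring)
    have c3 : Even (b + q) := by
      by_contra hc
      exact hne (by rw [if_neg hc]; ring)
    have c4 : 2 * (i + p) - (b + q) = b + q := by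
      by_contra hc
      exact hne (by rw [if_neg hc]; ring)
    have c5 : 2 * a = b + q + c + p := by
      by_contra hc
      exact hne (by rw [if_neg hc]; ring)
    obtain ⟨n, hn⟩ := c3
    exact h ⟨by omega, by omega, by omega, by omega, n, by omega⟩

end average

/-! ### The series of the period -/

section series

variable {ε : ℝ} {t : ℂ} {u : Fin 3 → ℂ}

/-- Averages do not increase sup norms, so the single majorant `kernelBound` serves for all three
interchanges of sum and average; the bound is returned for the remaining integration over `u`. -/
lemma hasSum_circleAverage_kernel (hε : 0 < ε) (ht : IsSmall ε t) (hu : u ∈ torus ε) :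
    (∀ i, ‖residueCoeff t i * ∏ k, torusFactor i k (u k)‖ ≤ kernelBound ε ‖t‖ i) ∧
    HasSum (fun i => residueCoeff t i * ∏ k, torusFactor i k (u k))
      (circleAverage (fun x₃ => circleAverage (fun x₆ => circleAverage
        (fun x₅ => kernel t u x₃ x₅ x₆) 0 ε) 0 ε) 0 ε) := by
  have hB := summable_kernelBound hε ht
  have b5 : ∀ i x₃ x₆, ‖x₃‖ = ε → ‖x₆‖ = ε →
      ‖circleAverage (fun x₅ => kernelTerm t u x₃ x₅ x₆ i) 0 ε‖ ≤ kernelBound ε ‖t‖ i :=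
    fun i x₃ x₆ h₃ h₆ => norm_circleAverage_le hε fun x₅ h₅ =>
      norm_kernelTerm_le hε ht hu h₃ h₅ h₆ i
  have b6 : ∀ i x₃, ‖x₃‖ = ε → ‖circleAverage (fun x₆ => circleAverage
      (fun x₅ => kernelTerm t u x₃ x₅ x₆ i) 0 ε) 0 ε‖ ≤ kernelBound ε ‖t‖ i :=
    fun i x₃ h₃ => norm_circleAverage_le hε fun x₆ h₆ => b5 i x₃ x₆ h₃ h₆
  have s5 : ∀ x₃ x₆, ‖x₃‖ = ε → ‖x₆‖ = ε →
      HasSum (fun i => circleAverage (fun x₅ => kernelTerm t u x₃ x₅ x₆ i) 0 ε)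
        (circleAverage (fun x₅ => kernel t u x₃ x₅ x₆) 0 ε) := by
    intro x₃ x₆ h₃ h₆
    refine hasSum_circleAverage hε (fun i => ?_) (fun i x₅ h₅ =>
      norm_kernelTerm_le hε ht hu h₃ h₅ h₆ i) hB fun x₅ h₅ => hasSum_kernelTerm hε ht hu h₃ h₅ h₆
    simp only [kernelTerm_eq]
    exact continuousOn_const.mul (continuousOn_pow_mul_inv_pow hε _ _)
  have s6 : ∀ x₃, ‖x₃‖ = ε → HasSum (fun i => circleAverage (fun x₆ => circleAverage
      (fun x₅ => kernelTerm t u x₃ x₅ x₆ i) 0 ε) 0 ε)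
        (circleAverage (fun x₆ => circleAverage (fun x₅ => kernel t u x₃ x₅ x₆) 0 ε) 0 ε) := by
    intro x₃ h₃
    refine hasSum_circleAverage hε (fun i => ?_) (fun i x₆ h₆ => b5 i x₃ x₆ h₃ h₆) hB
      fun x₆ h₆ => s5 x₃ x₆ h₃ h₆
    simp only [circleAverage_kernelTerm_five hε]
    exact continuousOn_const.mul (continuousOn_pow_mul_inv_pow hε _ _)
  simp only [← circleAverage_kernelTerm hε]
  refine ⟨fun i => norm_circleAverage_le hε fun x₃ h₃ => b6 i x₃ h₃,
    hasSum_circleAverage hε (fun i => ?_) (fun i x₃ h₃ => b6 i x₃ h₃) hB fun x₃ h₃ => s6 x₃ h₃⟩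
  simp only [circleAverage_kernelTerm_six hε]
  exact continuousOn_const.mul (continuousOn_binomial hε _ _ _ _)

lemma continuousOn_torusFactor (hε : 0 < ε) (i : (ℕ × ℕ) × (ℕ × ℕ) × (ℕ × ℕ)) (k : Fin 3) :
    ContinuousOn (torusFactor i k) (Metric.sphere 0 ε) := by
  fin_cases k
  exacts [continuousOn_binomial hε _ _ _ _, continuousOn_pow_mul_inv_pow hε _ _,
    continuousOn_pow_mul_inv_pow hε _ _]

lemma hasSum_torusAverage_kernel (hε : 0 < ε) (ht : IsSmall ε t) :
    HasSum (fun n : ℕ => (periodCoeff n : ℂ) * (t ^ 10) ^ n)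
      (torusAverage ε fun u => circleAverage (fun x₃ => circleAverage (fun x₆ => circleAverage
        (fun x₅ => kernel t u x₃ x₅ x₆) 0 ε) 0 ε) 0 ε) := by
  have h := hasSum_torusAverage hε (fun i => ?_)
    (fun i u hu => (hasSum_circleAverage_kernel hε ht hu).1 i) (summable_kernelBound hε ht)
    fun u hu => (hasSum_circleAverage_kernel hε ht hu).2
  swap
  · refine continuousOn_const.mul (continuousOn_finsetProd _ fun k _ => ?_)
    exact (continuousOn_torusFactor hε i k).comp (by fun_prop) fun u hu => by simpa using hu k
  simp only [torusAverage_residue hε] at h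
  -- The surviving exponents are parametrized by `n` and a pair with `i + p = 2 n`; all terms
  -- outside the range of `e` vanish, and for fixed `n` the finite sum is `apery (2 * n)`.
  set e : (Σ n : ℕ, Finset.HasAntidiagonal.antidiagonal (2 * n)) →
      (ℕ × ℕ) × (ℕ × ℕ) × (ℕ × ℕ) := fun x =>
    ((2 * x.1, x.2.1.1), (x.2.1.1, x.2.1.2), (x.2.1.1, x.2.1.2)) with he
  have hinj : Function.Injective e := by
    rintro ⟨n, ⟨k, p⟩, hx⟩ ⟨m, ⟨k', p'⟩, hy⟩ hxy
    simp only [he, Prod.mk.injEq] at hxy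
    obtain ⟨⟨h1, rfl⟩, ⟨-, rfl⟩, -⟩ := hxy
    obtain rfl : n = m := by omega
    rfl
  rw [← hinj.hasSum_iff] at h
  · refine (h.sigma fun n => hasSum_fintype _).congr_fun fun n => ?_
    have hx : ∀ x : Finset.HasAntidiagonal.antidiagonal (2 * n), (2 * n).choose x.1.2 =
        (2 * n).choose x.1.1 := fun x => Nat.choose_symm_of_eq_add (by
      have := Finset.HasAntidiagonal.mem_antidiagonal.1 x.2
      omega)
    have hn : ∀ x : Finset.HasAntidiagonal.antidiagonal (2 * n), 2 * n = x.1.1 + x.1.2 :=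
      fun x => (Finset.HasAntidiagonal.mem_antidiagonal.1 x.2).symm
    have hsum := Finset.sum_coe_sort (Finset.HasAntidiagonal.antidiagonal (2 * n))
      fun x => (t ^ 10) ^ n * ((2 * n).choose n : ℂ) ^ 2
        * ((2 * n).choose x.1 ^ 2 * (2 * n + x.1).choose x.1)
    rw [Finset.Nat.sum_antidiagonal_eq_sum_range_succ_mk] at hsum
    simp only [he, Function.comp_def, even_two_mul, and_true, ← hn, if_true, hx,
      Nat.mul_div_cancel_left n two_pos]
    rw [hsum, periodCoeff_eq, apery, ← Finset.mul_sum, Nat.centralBinom]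
    push_cast
    ring
  · rintro ⟨⟨a, i⟩, ⟨b, q⟩, c, p⟩ hi
    refine if_neg ?_
    rintro ⟨h1, h2, h3, h4, n, h5⟩
    simp only at h1 h2 h3 h4 h5
    refine hi ⟨⟨n, (i, p), by rw [Finset.HasAntidiagonal.mem_antidiagonal]; simp only; omega⟩, ?_⟩
    simp only [he, Prod.mk.injEq]
    exact ⟨⟨by omega, trivial⟩, ⟨h1.symm, h3.symm⟩, h2.symm, trivial⟩

end series

/-- The period is a power series in `t ^ 10`. -/
lemma hasSum_period {ε δ : ℝ} {t : ℂ} {γ : ℂ → (Fin 3 → ℂ) → (Fin 7 → ℂ)} (hε : 0 < ε)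
    (hδ : ∀ t : ℂ, ‖t‖ < δ → IsSmall ε t) (hγ : IsTorusCycle ε δ γ) (ht : ‖t‖ < δ) :
    HasSum (fun n : ℕ => (periodCoeff n : ℂ) * (t ^ 10) ^ n) (period ε γ t) := by
  rw [period, torusIntegral_eq_torusAverage hε]
  · exact hasSum_torusAverage_kernel hε (hδ t ht)
  · intro u hu
    rw [(circleAverage_kernel hε (hδ t ht) hu).2, hγ.eq_chartPoint_solution hε hδ ht hu,
      formCoefficient, subPfaffian245_eq]
    have h4 : chartPoint u (solution ε t u) 4 = u 2 := rfl
    rw [h4]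
    ring

end PfaffianMirror

end

theorem mainTheorem3 (ε : ℝ) (hε : 0 < ε) :
    ∃ δ : ℝ, 0 < δ ∧
      (∃ γ : ℂ → (Fin 3 → ℂ) → (Fin 7 → ℂ), PfaffianMirror.IsTorusCycle ε δ γ) ∧
      ∀ γ : ℂ → (Fin 3 → ℂ) → (Fin 7 → ℂ), PfaffianMirror.IsTorusCycle ε δ γ →
        (∀ t : ℂ, ‖t‖ < δ → ∀ u ∈ PfaffianMirror.torus ε,
          PfaffianMirror.subPfaffian245 t (γ t u) ≠ 0 ∧
          PfaffianMirror.jacobian t (γ t u) ≠ 0) ∧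
        ∃ Φ : ℂ → ℂ,
          (∀ t : ℂ, ‖t‖ < δ → PfaffianMirror.period ε γ t = Φ (t ^ 10)) ∧
          (∀ φ : ℂ, ‖φ‖ < δ ^ 10 →
            HasSum (fun n : ℕ => (PfaffianMirror.periodCoeff n : ℂ) * φ ^ n) (Φ φ)) ∧
          PfaffianMirror.IsPicardFuchsOperator PfaffianMirror.operatorD5 Φ := by
  obtain ⟨δ, hδ0, hδ⟩ := PfaffianMirror.exists_isSmall hε
  refine ⟨δ, hδ0, ⟨_, PfaffianMirror.isTorusCycle_chartPoint_solution hε hδ0 hδ⟩,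
    fun γ hγ => ⟨fun t ht u hu => ?_, ?_⟩⟩
  · rw [hγ.eq_chartPoint_solution hε hδ ht hu, PfaffianMirror.subPfaffian245_eq]
    exact ⟨PfaffianMirror.ne_zero_of_mem_torus hε hu 2,
      (PfaffianMirror.circleAverage_kernel hε (hδ t ht) hu).1⟩
  · have hsum : ∀ φ : ℂ, ‖φ‖ < δ ^ 10 →
        HasSum (fun n : ℕ => (PfaffianMirror.periodCoeff n : ℂ) * φ ^ n)
          (∑' n : ℕ, (PfaffianMirror.periodCoeff n : ℂ) * φ ^ n) := by
      intro φ hφ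
      -- Every `φ` in the disc is `t ^ 10` with `‖t‖ < δ`, so convergence at `φ` is convergence of
      -- the period series at `t`.
      obtain ⟨t, rfl⟩ := IsAlgClosed.exists_pow_nat_eq φ (n := 10) (by norm_num)
      rw [norm_pow] at hφ
      exact (PfaffianMirror.hasSum_period hε hδ hγ
        (lt_of_pow_lt_pow_left₀ 10 hδ0.le hφ)).summable.hasSum
    exact ⟨fun φ => ∑' n : ℕ, (PfaffianMirror.periodCoeff n : ℂ) * φ ^ n,
      fun t ht => (PfaffianMirror.hasSum_period hε hδ hγ ht).tsum_eq.symm, hsum,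
      PfaffianMirror.isPicardFuchsOperator_operatorD5 (pow_pos hδ0 10) hsum⟩
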